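/- All vector spaces are over $\mathbb Q$, and $(-)^\vee=\mathrm{Hom}(-,\mathbb Q)$. For a graded vector space $V$, $\land V$ is the free graded commutative algebra on $V$, $\land^pV$ is the span of the products of $p$ elements of $V$, and $\land^+V=\land^{\geq 1}V$. Let $(\land V,d)$ be a minimal Sullivan algebra: $V=V^{\geq 1}$, $d$ is a derivation of degree $1$ with $d^2=0$, $d:V\to\land^{\geq 2}V$, and $V=\bigcup_{n\ge 0}V(n)$ with $V(0)=V\cap\ker d$, $V(n+1)=V\cap d^{-1}(\land V(n))$. Its homotopy Lie algebra $L_V=\{(L_V)_p\}_{p\geq 0}$ is given by $s:(L_V)_p\cong (V^{p+1})^\vee$ and $$\langle v,s[x,y]\rangle=(-1)^{\deg y+1}\langle d_1v,sx,sy\rangle,$$ where $d_1v$ is the component of $dv$ in $\land^2V$ and $\langle vw,sx,sy\rangle=\langle v,sy\rangle\langle w,sx\rangle+(-1)^{\deg v\deg w}\langle w,sy\rangle\langle v,sx\rangle$. Let $\{V_\alpha\}$ be the family of finite dimensional graded subspaces of $V$ for which $\land V_\alpha$ is preserved by $d$, let $L_\alpha$ be the homotopy Lie algebra of $\land V_\alpha$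 and $I_\alpha$ the augmentation ideal of $UL_\alpha$, and let $$\overline{UL_V}=\varprojlim_\alpha\varprojlim_n UL_\alpha/I_\alpha^n$$ be the Sullivan completion of $UL_V$. Let $(\land V\otimes\land U,d)$, $U=U^{\geq 0}$, be the acyclic closure of $(\land V,d)$. That is, it is a commutative differential graded algebra in which $d$ extends the differential of $\land V$; $U=\bigcup_{k\geq 0}U(k)$ for an increasing family of subspaces with $d(1\otimes U(0))\subset\land V\otimes 1$ and $d(1\otimes U(k+1))\subset\land V\otimes\land U(k)$; it is minimal, i.e. the quotient differential $\bar d$ in $\land U=\mathbb Q\otimes_{\land V}(\land V\otimes\land U)$ satisfies $\bar d:U\to\land^{\geq 2}U$; and the augmentation $\varepsilon:\land V\otimes\land U\to\mathbb Q$ sending $V,U\to 0$ is a quasi-isomorphism. Then $\bar d=0$, so that $d(1\otimes\Phi)=\sum_i v_i\otimes\theta_i\Phi+\Omega$ for $\Phi\in\land U$, where $(v_i)$ is a basis of $V$ and $\Omega\in\land^{\geq 2}V\otimes\land U$. The operators $\bar\theta(x)=-\sum_i\langle v_i,sx\rangle\theta_i$, $x\in L_V$, extend to a unique representation of the algebra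 $\overline{UL_V}$ in $\land U$ such that for each $\Phi\in\land U$ there are $\alpha$ and $n$ for which $a\cdot\Phi=0$ whenever $a\in\overline{UL_V}$ has zero component in $UL_\alpha/I_\alpha^n$ (the holonomy representation). Let $\overline{UL_V}$ act from the right on $(\land U)^\vee$ by the dual right representation, $\langle\Phi,f\cdot a\rangle=(-1)^{\deg a}\langle a\cdot\Phi,f\rangle$ for homogeneous $a$ (for general $a$, replace $(-1)^{\deg a}a$ by the image of $a$ under the degree involution), and let $\varepsilon_U:\land U\to\mathbb Q$ be the augmentation vanishing on $\land^+U$. Then $$\overline{UL_V}\longrightarrow(\land U)^\vee,\qquad a\longmapsto\varepsilon_U\cdot a,$$ is an isomorphism of right $\overline{UL_V}$-modules. It identifies the component of degree $m$ of $\overline{UL_V}$ with $((\land U)^m)^\vee$ for every $m\geq 0$. -/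

import Mathlib

open scoped TensorProduct DirectSum

noncomputable section

namespace Sullivan

universe u v

/-! ### Free graded commutative algebras -/

section FreeGCA

variable {V : Type u} [AddCommGroup V] [Module ℚ V]

/-- The relations `v w = (-1)^{ij} w v` for `v ∈ V^i`, `w ∈ V^j`. -/
inductive FreeGCA.Rel (𝒱 : ℕ → Submodule ℚ V) : TensorAlgebra ℚ V → TensorAlgebra ℚ V → Prop
  | comm {i j : ℕ} {v w : V} (hv : v ∈ 𝒱 i) (hw : w ∈ 𝒱 j) :
      FreeGCA.Rel 𝒱 (TensorAlgebra.ι ℚ v * TensorAlgebra.ι ℚ w)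
        ((-1 : ℚ) ^ (i * j) • (TensorAlgebra.ι ℚ w * TensorAlgebra.ι ℚ v))

/-- The free graded commutative algebra `∧V` on a graded rational vector space `V = {V^i}_{i ≥ 0}`,
as a quotient of the tensor algebra. -/
def FreeGCA (𝒱 : ℕ → Submodule ℚ V) : Type u := RingQuot (FreeGCA.Rel 𝒱)

namespace FreeGCA

variable (𝒱 : ℕ → Submodule ℚ V)

instance : Ring (FreeGCA 𝒱) := inferInstanceAs (Ring (RingQuot (FreeGCA.Rel 𝒱)))

instance : Algebra ℚ (FreeGCA 𝒱) := inferInstanceAs (Algebra ℚ (RingQuot (FreeGCA.Rel 𝒱)))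

/-- The inclusion `V → ∧V`. -/
def ι : V →ₗ[ℚ] FreeGCA 𝒱 :=
  (RingQuot.mkAlgHom ℚ (FreeGCA.Rel 𝒱)).toLinearMap ∘ₗ TensorAlgebra.ι ℚ

variable {𝒱}

theorem ι_mul_ι {i j : ℕ} {v w : V} (hv : v ∈ 𝒱 i) (hw : w ∈ 𝒱 j) :
    ι 𝒱 v * ι 𝒱 w = (-1 : ℚ) ^ (i * j) • (ι 𝒱 w * ι 𝒱 v) := by
  have h := RingQuot.mkAlgHom_rel ℚ (Rel.comm (𝒱 := 𝒱) hv hw)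
  rw [map_mul, map_smul, map_mul] at h
  exact h

/-- The universal property of `∧V`. -/
def lift {A : Type*} [Semiring A] [Algebra ℚ A] (f : V →ₗ[ℚ] A)
    (hf : ∀ (i j : ℕ) (v w : V), v ∈ 𝒱 i → w ∈ 𝒱 j →
      f v * f w = (-1 : ℚ) ^ (i * j) • (f w * f v)) : FreeGCA 𝒱 →ₐ[ℚ] A :=
  RingQuot.liftAlgHom ℚ ⟨TensorAlgebra.lift ℚ f, by
    rintro _ _ ⟨hv, hw⟩
    simpa using hf _ _ _ _ hv hw⟩

@[simp]
theorem lift_ι {A : Type*} [Semiring A] [Algebra ℚ A] (f : V →ₗ[ℚ] A)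
    (hf : ∀ (i j : ℕ) (v w : V), v ∈ 𝒱 i → w ∈ 𝒱 j →
      f v * f w = (-1 : ℚ) ^ (i * j) • (f w * f v)) (v : V) : lift f hf (ι 𝒱 v) = f v := by
  have h := RingQuot.liftAlgHom_mkAlgHom_apply ℚ (s := Rel 𝒱) (TensorAlgebra.lift ℚ f) (by
    rintro _ _ ⟨hv, hw⟩
    simpa using hf _ _ _ _ hv hw) (TensorAlgebra.ι ℚ v)
  rw [TensorAlgebra.lift_ι_apply] at h
  exact h

theorem hom_ext {A : Type*} [Semiring A] [Algebra ℚ A] {f g : FreeGCA 𝒱 →ₐ[ℚ] A}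
    (h : ∀ v, f (ι 𝒱 v) = g (ι 𝒱 v)) : f = g := by
  apply RingQuot.ringQuot_ext' ℚ
  apply TensorAlgebra.hom_ext
  ext v
  exact h v

variable (𝒱)

/-- Monomials `v₁ ⋯ v_k` in homogeneous elements of `V`, of total degree `n`. -/
inductive IsMonomial : ℕ → FreeGCA 𝒱 → Prop
  | one : IsMonomial 0 1
  | cons {i n : ℕ} {v : V} {a : FreeGCA 𝒱} (hv : v ∈ 𝒱 i) (ha : IsMonomial n a) :
      IsMonomial (i + n) (ι 𝒱 v * a)

/-- The component `(∧V)^n` of degree `n`. -/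
def gr (n : ℕ) : Submodule ℚ (FreeGCA 𝒱) := Submodule.span ℚ {a | IsMonomial 𝒱 n a}

variable {𝒱}

theorem IsMonomial.mul {m n : ℕ} {a b : FreeGCA 𝒱} (ha : IsMonomial 𝒱 m a)
    (hb : IsMonomial 𝒱 n b) : IsMonomial 𝒱 (m + n) (a * b) := by
  induction ha with
  | one => simpa using hb
  | cons hv _ ih => rw [mul_assoc, add_assoc]; exact .cons hv ih

instance : SetLike.GradedMonoid (gr 𝒱) where
  one_mem := Submodule.subset_span .one
  mul_mem := by
    intro m n a b ha hb
    induction ha, hb using Submodule.span_induction₂ with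
    | mem_mem a b ha hb => exact Submodule.subset_span (ha.mul hb)
    | zero_left b hb => simp
    | zero_right a ha => simp
    | add_left a b c _ _ _ h₁ h₂ => rw [add_mul]; exact add_mem h₁ h₂
    | add_right a b c _ _ _ h₁ h₂ => rw [mul_add]; exact add_mem h₁ h₂
    | smul_left r a b _ _ h => rw [smul_mul_assoc]; exact Submodule.smul_mem _ r h
    | smul_right r a b _ _ h => rw [mul_smul_comm]; exact Submodule.smul_mem _ r h

theorem ι_mem_gr {i : ℕ} {v : V} (hv : v ∈ 𝒱 i) : ι 𝒱 v ∈ gr 𝒱 i :=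
  Submodule.subset_span (by simpa using IsMonomial.cons hv .one)

variable (𝒱) in
/-- Auxiliary to `gradedAlgebra`. -/
def toGraded [DirectSum.Decomposition 𝒱] : V →ₗ[ℚ] ⨁ i, gr 𝒱 i :=
  (DirectSum.toModule ℚ ℕ _ fun i => (DirectSum.lof ℚ ℕ (fun i => gr 𝒱 i) i).comp
    (((ι 𝒱).comp (𝒱 i).subtype).codRestrict (gr 𝒱 i) fun v => ι_mem_gr v.2)).comp
    (DirectSum.decomposeLinearEquiv 𝒱).toLinearMap

theorem toGraded_apply [DirectSum.Decomposition 𝒱] {i : ℕ} {v : V} (hv : v ∈ 𝒱 i) :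
    toGraded 𝒱 v = DirectSum.of (fun i => gr 𝒱 i) i ⟨ι 𝒱 v, ι_mem_gr hv⟩ := by
  simp only [toGraded, LinearMap.comp_apply, LinearEquiv.coe_coe,
    DirectSum.decomposeLinearEquiv_apply]
  rw [DirectSum.decompose_of_mem 𝒱 hv, ← DirectSum.lof_eq_of ℚ, DirectSum.toModule_lof]
  rfl

theorem toGraded_comm [DirectSum.Decomposition 𝒱] (i j : ℕ) (v w : V) (hv : v ∈ 𝒱 i)
    (hw : w ∈ 𝒱 j) : toGraded 𝒱 v * toGraded 𝒱 w =
      (-1 : ℚ) ^ (i * j) • (toGraded 𝒱 w * toGraded 𝒱 v) := by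
  rw [toGraded_apply hv, toGraded_apply hw, DirectSum.of_mul_of, DirectSum.of_mul_of,
    ← DirectSum.lof_eq_of ℚ, ← DirectSum.lof_eq_of ℚ, ← map_smul, DirectSum.lof_eq_of,
    DirectSum.lof_eq_of]
  exact DirectSum.of_eq_of_gradedMonoid_eq (Sigma.subtype_ext (add_comm _ _) (ι_mul_ι hv hw))

/-- `∧V` is a graded algebra. -/
instance gradedAlgebra [DirectSum.Decomposition 𝒱] : GradedAlgebra (gr 𝒱) :=
  GradedAlgebra.ofAlgHom (gr 𝒱)
    (lift (toGraded 𝒱) toGraded_comm)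
    (by
      apply hom_ext
      intro v
      rw [AlgHom.comp_apply, lift_ι, AlgHom.id_apply]
      induction v using DirectSum.Decomposition.inductionOn 𝒱 with
      | zero => simp
      | homogeneous v => rw [toGraded_apply v.2, DirectSum.coeAlgHom_of]
      | add v w hv hw => rw [map_add, map_add, hv, hw, map_add])
    (by
      rintro i ⟨x, hx⟩
      induction hx using Submodule.span_induction with
      | mem x hx =>
        induction hx with
        | one => rw [map_one]; rfl
        | cons hv ha ih =>
          dsimp only at ih ⊢
          rw [map_mul, lift_ι, toGraded_apply hv, ih,
            DirectSum.of_mul_of]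
          rfl
      | zero => rw [map_zero]; exact (map_zero _).symm
      | add x y hx hy ihx ihy =>
        dsimp only at ihx ihy ⊢
        rw [map_add, ihx, ihy, ← map_add]
        rfl
      | smul r x hx ih =>
        dsimp only at ih ⊢
        rw [map_smul, ih, ← DirectSum.lof_eq_of ℚ, ← map_smul]
        rfl)

variable (𝒱)

/-- `∧^p V`, the span of the products of `p` elements of `V`. -/
def wedge (p : ℕ) : Submodule ℚ (FreeGCA 𝒱) := LinearMap.range (ι 𝒱) ^ p

/-- `∧^{≥ k} V`. -/
def wedgeGE (k : ℕ) : Submodule ℚ (FreeGCA 𝒱) := ⨆ (p : ℕ) (_ : k ≤ p), wedge 𝒱 p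

/-- For a subspace `W ⊆ V`, the subalgebra `∧W ⊆ ∧V`. -/
def sub (W : Submodule ℚ V) : Subalgebra ℚ (FreeGCA 𝒱) := Algebra.adjoin ℚ (ι 𝒱 '' W)

/-- The augmentation `∧V → ℚ` sending `V` to `0`. -/
def aug : FreeGCA 𝒱 →ₐ[ℚ] ℚ := lift 0 (by simp)

/-- For a linear form `f` on `V`, the linear form on `∧V` which is `f` on `V = ∧^1 V` and `0` on
`∧^p V` for `p ≠ 1`. It is the coefficient of `ε` of the algebra map `v ↦ f(v) ε` into the dual
numbers `ℚ[ε]`. -/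
def ev (f : Module.Dual ℚ V) : FreeGCA 𝒱 →ₗ[ℚ] ℚ :=
  (TrivSqZeroExt.sndHom ℚ ℚ).comp
    (lift (𝒱 := 𝒱) (A := DualNumber ℚ) ((TrivSqZeroExt.inrHom ℚ ℚ).comp f)
      (by intros; simp)).toLinearMap

variable {𝒱} in
theorem ev_ι (f : Module.Dual ℚ V) (v : V) : ev 𝒱 f (ι 𝒱 v) = f v := by simp [ev]

variable {𝒱} in
theorem ev_one (f : Module.Dual ℚ V) : ev 𝒱 f 1 = 0 := by simp [ev]

variable {𝒱} in
theorem ev_ι_mul_ι_mul (f : Module.Dual ℚ V) (v w : V) (a : FreeGCA 𝒱) :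
    ev 𝒱 f (ι 𝒱 v * ι 𝒱 w * a) = 0 := by simp [ev]

end FreeGCA

end FreeGCA

/-! ### Differentials and minimal Sullivan algebras -/

/-- `d` is a derivation of degree `1` and square zero in the graded algebra `A = ⨁ 𝒜 n`. -/
structure IsDifferential {A : Type*} [Ring A] [Algebra ℚ A] (𝒜 : ℕ → Submodule ℚ A)
    (d : A →ₗ[ℚ] A) : Prop where
  degree : ∀ (n : ℕ) (a : A), a ∈ 𝒜 n → d a ∈ 𝒜 (n + 1)
  sq : ∀ a : A, d (d a) = 0
  leibniz : ∀ (n : ℕ) (a b : A), a ∈ 𝒜 n → d (a * b) = d a * b + (-1 : ℚ) ^ n • (a * d b)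

section Algebras

variable {V : Type u} [AddCommGroup V] [Module ℚ V]

/-- The filtration `V(0) = V ∩ ker d`, `V(n+1) = V ∩ d⁻¹(∧V(n))`. -/
def sullivanFiltration (𝒱 : ℕ → Submodule ℚ V) (d : FreeGCA 𝒱 →ₗ[ℚ] FreeGCA 𝒱) :
    ℕ → Submodule ℚ V
  | 0 => LinearMap.ker (d ∘ₗ FreeGCA.ι 𝒱)
  | n + 1 => (Subalgebra.toSubmodule (FreeGCA.sub 𝒱 (sullivanFiltration 𝒱 d n))).comap
      (d ∘ₗ FreeGCA.ι 𝒱)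

/-- A minimal Sullivan algebra `(∧V, d)`: `V = V^{≥ 1}`, the Sullivan condition `V = ⋃ V(n)` holds,
and `d : V → ∧^{≥ 2} V`. -/
structure MinimalSullivanAlgebra (𝒱 : ℕ → Submodule ℚ V) where
  /-- the differential -/
  d : FreeGCA 𝒱 →ₗ[ℚ] FreeGCA 𝒱
  isDifferential : IsDifferential (FreeGCA.gr 𝒱) d
  pos : 𝒱 0 = ⊥
  sullivan : ∀ v : V, ∃ n : ℕ, v ∈ sullivanFiltration 𝒱 d n
  minimal : ∀ v : V, d (FreeGCA.ι 𝒱 v) ∈ FreeGCA.wedgeGE 𝒱 2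

/-! ### The homotopy Lie algebra -/

/-- The component `(L_V)_p` of the homotopy Lie algebra. The suspension `s : (L_V)_p ≅ (V^{p+1})^∨`
is an identification: `x ∈ (L_V)_p` is stored as the linear form `sx` on `V`, which vanishes on `V^j`
for `j ≠ p + 1`, and `⟨v, sx⟩ = x v`. -/
def lie (𝒱 : ℕ → Submodule ℚ V) (p : ℕ) : Submodule ℚ (Module.Dual ℚ V) where
  carrier := {f | ∀ j : ℕ, j ≠ p + 1 → ∀ v ∈ 𝒱 j, f v = 0}
  add_mem' := by
    intro f g hf hg j hj v hv
    simp [hf j hj v hv, hg j hj v hv]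
  zero_mem' := by simp
  smul_mem' := by
    intro c f hf j hj v hv
    simp [hf j hj v hv]

variable {𝒱 : ℕ → Submodule ℚ V}

/-- Auxiliary to `pairing`. -/
def pairingMatrix (p q : ℕ) (x y : Module.Dual ℚ V) : V →ₗ[ℚ] Matrix (Fin 4) (Fin 4) ℚ where
  toFun v := !![0, x v, y v, 0; 0, 0, 0, (-1 : ℚ) ^ ((p + 1) * (q + 1)) * y v; 0, 0, 0, x v;
    0, 0, 0, 0]
  map_add' v w := by
    ext i j; fin_cases i <;> fin_cases j <;> simp [mul_add]
  map_smul' c v := by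
    ext i j; fin_cases i <;> fin_cases j <;> simp [mul_left_comm]

theorem pairingMatrix_comm {p q : ℕ} (x : lie 𝒱 p) (y : lie 𝒱 q) (i j : ℕ) (v w : V)
    (hv : v ∈ 𝒱 i) (hw : w ∈ 𝒱 j) :
    pairingMatrix p q x.1 y.1 v * pairingMatrix p q x.1 y.1 w =
      (-1 : ℚ) ^ (i * j) • (pairingMatrix p q x.1 y.1 w * pairingMatrix p q x.1 y.1 v) := by
  have key : x.1 v * ((-1 : ℚ) ^ ((p + 1) * (q + 1)) * y.1 w) + y.1 v * x.1 w =
      (-1 : ℚ) ^ (i * j) *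
        (x.1 w * ((-1 : ℚ) ^ ((p + 1) * (q + 1)) * y.1 v) + y.1 w * x.1 v) := by
    have e1 : x.1 v * y.1 w = (-1 : ℚ) ^ (i * j) * (-1 : ℚ) ^ ((p + 1) * (q + 1)) *
        (x.1 v * y.1 w) := by
      by_cases h : i = p + 1 ∧ j = q + 1
      · rw [h.1, h.2, ← mul_pow]; simp
      · rcases not_and_or.mp h with h | h
        · rw [x.2 i h v hv]; simp
        · rw [y.2 j h w hw]; simp
    have e2 : y.1 v * x.1 w = (-1 : ℚ) ^ (i * j) * (-1 : ℚ) ^ ((p + 1) * (q + 1)) *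
        (y.1 v * x.1 w) := by
      by_cases h : i = q + 1 ∧ j = p + 1
      · rw [h.1, h.2, mul_comm (q + 1), ← mul_pow]; simp
      · rcases not_and_or.mp h with h | h
        · rw [y.2 i h v hv]; simp
        · rw [x.2 j h w hw]; simp
    have e3 : (-1 : ℚ) ^ ((p + 1) * (q + 1)) * (-1 : ℚ) ^ ((p + 1) * (q + 1)) = 1 := by
      rw [← mul_pow]; simp
    linear_combination (-1 : ℚ) ^ ((p + 1) * (q + 1)) * e1 + e2 +
      (-1 : ℚ) ^ (i * j) * (x.1 v * y.1 w) * e3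
  ext a b
  fin_cases a <;> fin_cases b <;>
    simp [pairingMatrix, Matrix.mul_apply, Fin.sum_univ_four]
  simpa using key

/-- Auxiliary to `pairing`. -/
def pairingHom {p q : ℕ} (x : lie 𝒱 p) (y : lie 𝒱 q) :
    FreeGCA 𝒱 →ₐ[ℚ] Matrix (Fin 4) (Fin 4) ℚ :=
  FreeGCA.lift (pairingMatrix p q x.1 y.1) (pairingMatrix_comm x y)

/-- The linear form `Φ ↦ ⟨Φ, sx, sy⟩` on `∧V`, extended by `0` to `∧^p V` for `p ≠ 2`. On `∧^2 V` it
is given by the convention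
`⟨v w, sx, sy⟩ = ⟨v, sy⟩ ⟨w, sx⟩ + (-1)^{deg v deg w} ⟨w, sy⟩ ⟨v, sx⟩`
(see `pairing_ι_mul_ι`, `pairing_one`, `pairing_ι`, `pairing_ι_mul_ι_mul_ι_mul`). -/
def pairing {p q : ℕ} (x : lie 𝒱 p) (y : lie 𝒱 q) : FreeGCA 𝒱 →ₗ[ℚ] ℚ :=
  (Matrix.entryLinearMap ℚ ℚ 0 3).comp (pairingHom x y).toLinearMap

theorem pairing_ι_mul_ι {p q : ℕ} (x : lie 𝒱 p) (y : lie 𝒱 q) {i j : ℕ} {v w : V}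
    (hv : v ∈ 𝒱 i) (hw : w ∈ 𝒱 j) :
    pairing x y (FreeGCA.ι 𝒱 v * FreeGCA.ι 𝒱 w) =
      y.1 v * x.1 w + (-1 : ℚ) ^ (i * j) * (y.1 w * x.1 v) := by
  have e1 : (-1 : ℚ) ^ ((p + 1) * (q + 1)) * (y.1 w * x.1 v) =
      (-1 : ℚ) ^ (i * j) * (y.1 w * x.1 v) := by
    by_cases h : i = p + 1 ∧ j = q + 1
    · rw [h.1, h.2]
    · rcases not_and_or.mp h with h | h
      · rw [x.2 i h v hv]; simp
      · rw [y.2 j h w hw]; simp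
  rw [← e1]
  simp [pairing, pairingHom, pairingMatrix]
  ring

theorem pairing_one {p q : ℕ} (x : lie 𝒱 p) (y : lie 𝒱 q) : pairing x y 1 = 0 := by
  simp [pairing]

theorem pairing_ι {p q : ℕ} (x : lie 𝒱 p) (y : lie 𝒱 q) (v : V) :
    pairing x y (FreeGCA.ι 𝒱 v) = 0 := by
  simp [pairing, pairingHom, pairingMatrix]

theorem pairing_ι_mul_ι_mul_ι_mul {p q : ℕ} (x : lie 𝒱 p) (y : lie 𝒱 q) (v w z : V)
    (a : FreeGCA 𝒱) :
    pairing x y (FreeGCA.ι 𝒱 v * FreeGCA.ι 𝒱 w * FreeGCA.ι 𝒱 z * a) = 0 := by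
  have h : pairingMatrix p q x.1 y.1 v * pairingMatrix p q x.1 y.1 w *
      pairingMatrix p q x.1 y.1 z = 0 := by
    ext i j
    fin_cases i <;> fin_cases j <;> simp [pairingMatrix]
  simp [pairing, pairingHom, h]

theorem pairing_eq_zero {p q n : ℕ} (x : lie 𝒱 p) (y : lie 𝒱 q) {a : FreeGCA 𝒱}
    (ha : a ∈ FreeGCA.gr 𝒱 n) (hn : n ≠ p + q + 2) : pairing x y a = 0 := by
  have mono : ∀ (n : ℕ) (a : FreeGCA 𝒱), FreeGCA.IsMonomial 𝒱 n a →
      (n ≠ p + q + 2 → pairingHom x y a 0 3 = 0) ∧ (n ≠ q + 1 → pairingHom x y a 1 3 = 0) ∧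
      (n ≠ p + 1 → pairingHom x y a 2 3 = 0) ∧ (n ≠ 0 → pairingHom x y a 3 3 = 0) := by
    intro n a h
    induction h with
    | one => simp
    | @cons i n v a hv ha ih =>
      obtain ⟨h0, h1, h2, h3⟩ := ih
      have hx : i ≠ p + 1 → x.1 v = 0 := fun h => x.2 i h v hv
      have hy : i ≠ q + 1 → y.1 v = 0 := fun h => y.2 i h v hv
      have hm : pairingHom x y (FreeGCA.ι 𝒱 v) = pairingMatrix p q x.1 y.1 v := by
        simp [pairingHom]
      rw [map_mul, hm]
      simp only [Matrix.mul_apply, Fin.sum_univ_four, pairingMatrix]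
      refine ⟨fun h => ?_, fun h => ?_, fun h => ?_, fun h => ?_⟩
      · have A : x.1 v * pairingHom x y a 1 3 = 0 := by
          by_cases hi : i = p + 1
          · rw [h1 (by omega), mul_zero]
          · rw [hx hi, zero_mul]
        have B : y.1 v * pairingHom x y a 2 3 = 0 := by
          by_cases hi : i = q + 1
          · rw [h2 (by omega), mul_zero]
          · rw [hy hi, zero_mul]
        simp [A, B]
      · have A : y.1 v * pairingHom x y a 3 3 = 0 := by
          by_cases hi : i = q + 1
          · rw [h3 (by omega), mul_zero]
          · rw [hy hi, zero_mul]
        simp [mul_assoc, A]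
      · have A : x.1 v * pairingHom x y a 3 3 = 0 := by
          by_cases hi : i = p + 1
          · rw [h3 (by omega), mul_zero]
          · rw [hx hi, zero_mul]
        simp [A]
      · simp
  induction ha using Submodule.span_induction with
  | mem a ha => exact (mono n a ha).1 hn
  | zero => simp
  | add a b _ _ ha hb => rw [map_add, ha, hb, add_zero]
  | smul r a _ ha => rw [map_smul, ha, smul_zero]

namespace MinimalSullivanAlgebra

variable (S : MinimalSullivanAlgebra 𝒱)

/-- The Lie bracket `(L_V)_p × (L_V)_q → (L_V)_{p+q}`,
`⟨v, s[x,y]⟩ = (-1)^{deg y + 1} ⟨d₁ v, sx, sy⟩`, where `d₁ v` is the component of `d v` in `∧^2 V`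
(the pairing vanishes on the other components of `d v`). -/
def bracket {p q : ℕ} (x : lie 𝒱 p) (y : lie 𝒱 q) : lie 𝒱 (p + q) :=
  ⟨(-1 : ℚ) ^ (q + 1) • (pairing x y ∘ₗ S.d ∘ₗ FreeGCA.ι 𝒱), by
    intro j hj v hv
    have h := S.isDifferential.degree j _ (FreeGCA.ι_mem_gr hv)
    simp [pairing_eq_zero x y h (by omega)]⟩

/-! ### The Sullivan completion of the enveloping algebra -/

variable [DirectSum.Decomposition 𝒱]

/-- The index set `ℐ_V`: finite dimensional graded subspaces `V_α ⊆ V` such that `∧V_α` is preserved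
by `d`. -/
structure Index where
  /-- the subspace `V_α` -/
  space : Submodule ℚ V
  finite : FiniteDimensional ℚ space
  homogeneous : ∀ v ∈ space, ∀ i : ℕ, (DirectSum.decompose 𝒱 v i : V) ∈ space
  stable : ∀ a ∈ FreeGCA.sub 𝒱 space, S.d a ∈ FreeGCA.sub 𝒱 space

variable {S}

/-- The surjection `ρ_α : L_V → L_α`, `sL_α = V_α^∨`, dual to the inclusion `V_α → V`. -/
def Index.res (α : S.Index) : Module.Dual ℚ V →ₗ[ℚ] Module.Dual ℚ α.space := α.space.dualRestrict

/-- The defining relations `x y - (-1)^{deg x deg y} y x = [x, y]` of `UL_α`. Every homogeneous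
element of `L_α` has the form `ρ_α x`, and the bracket in the homotopy Lie algebra `L_α` of `∧V_α`
is `[ρ_α x, ρ_α y] = ρ_α [x, y]`, since `d₁ v ∈ ∧^2 V_α` for `v ∈ V_α`. -/
inductive Index.Rel (α : S.Index) :
    TensorAlgebra ℚ (Module.Dual ℚ α.space) → TensorAlgebra ℚ (Module.Dual ℚ α.space) → Prop
  | bracket {p q : ℕ} (x : lie 𝒱 p) (y : lie 𝒱 q) :
      Index.Rel α
        (TensorAlgebra.ι ℚ (α.res x.1) * TensorAlgebra.ι ℚ (α.res y.1))
        ((-1 : ℚ) ^ (p * q) • (TensorAlgebra.ι ℚ (α.res y.1) * TensorAlgebra.ι ℚ (α.res x.1)) +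
          TensorAlgebra.ι ℚ (α.res (S.bracket x y).1))

/-- The universal enveloping algebra `UL_α` of the graded Lie algebra `L_α`. -/
def Index.UL (α : S.Index) : Type u := RingQuot α.Rel

instance (α : S.Index) : Ring α.UL := inferInstanceAs (Ring (RingQuot α.Rel))

instance (α : S.Index) : Algebra ℚ α.UL := inferInstanceAs (Algebra ℚ (RingQuot α.Rel))

/-- The map `L_α → UL_α`. -/
def Index.toUL (α : S.Index) : Module.Dual ℚ α.space →ₗ[ℚ] α.UL :=
  (RingQuot.mkAlgHom ℚ α.Rel).toLinearMap ∘ₗ TensorAlgebra.ι ℚ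

theorem Index.toUL_mul (α : S.Index) {p q : ℕ} (x : lie 𝒱 p) (y : lie 𝒱 q) :
    α.toUL (α.res x.1) * α.toUL (α.res y.1) =
      (-1 : ℚ) ^ (p * q) • (α.toUL (α.res y.1) * α.toUL (α.res x.1)) +
        α.toUL (α.res (S.bracket x y).1) := by
  have h := RingQuot.mkAlgHom_rel ℚ (Index.Rel.bracket (α := α) x y)
  rw [map_mul, map_add, map_smul, map_mul] at h
  exact h

/-- The universal property of `UL_α`. -/
def Index.liftUL (α : S.Index) {A : Type*} [Ring A] [Algebra ℚ A]
    (f : Module.Dual ℚ α.space →ₗ[ℚ] A)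
    (hf : ∀ (p q : ℕ) (x : lie 𝒱 p) (y : lie 𝒱 q), f (α.res x.1) * f (α.res y.1) =
      (-1 : ℚ) ^ (p * q) • (f (α.res y.1) * f (α.res x.1)) + f (α.res (S.bracket x y).1)) :
    α.UL →ₐ[ℚ] A :=
  RingQuot.liftAlgHom ℚ ⟨TensorAlgebra.lift ℚ f, by
    rintro _ _ ⟨x, y⟩
    simpa using hf _ _ x y⟩

@[simp]
theorem Index.liftUL_toUL (α : S.Index) {A : Type*} [Ring A] [Algebra ℚ A]
    (f : Module.Dual ℚ α.space →ₗ[ℚ] A)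
    (hf : ∀ (p q : ℕ) (x : lie 𝒱 p) (y : lie 𝒱 q), f (α.res x.1) * f (α.res y.1) =
      (-1 : ℚ) ^ (p * q) • (f (α.res y.1) * f (α.res x.1)) + f (α.res (S.bracket x y).1))
    (z : Module.Dual ℚ α.space) : α.liftUL f hf (α.toUL z) = f z := by
  have h := RingQuot.liftAlgHom_mkAlgHom_apply ℚ (s := α.Rel) (TensorAlgebra.lift ℚ f) (by
    rintro _ _ ⟨x, y⟩
    simpa using hf _ _ x y) (TensorAlgebra.ι ℚ z)
  rw [TensorAlgebra.lift_ι_apply] at h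
  exact h

theorem Index.UL_hom_ext (α : S.Index) {A : Type*} [Ring A] [Algebra ℚ A] {f g : α.UL →ₐ[ℚ] A}
    (h : ∀ z, f (α.toUL z) = g (α.toUL z)) : f = g := by
  apply RingQuot.ringQuot_ext' ℚ
  apply TensorAlgebra.hom_ext
  ext z
  exact h z

/-- The augmentation `UL_α → ℚ`, vanishing on `L_α`. -/
def Index.augUL (α : S.Index) : α.UL →ₐ[ℚ] ℚ := α.liftUL 0 (by simp)

/-- The augmentation ideal `I_α` of `UL_α`. -/
def Index.I (α : S.Index) : Ideal α.UL := RingHom.ker α.augUL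

instance (α : S.Index) : α.I.IsTwoSided := inferInstanceAs (RingHom.ker α.augUL).IsTwoSided

/-- For `V_α ⊆ V_β`, the morphism `UL_β → UL_α` induced by the surjection `L_β → L_α` dual to the
inclusion. -/
def Index.mapUL {α β : S.Index} (h : α.space ≤ β.space) : β.UL →ₐ[ℚ] α.UL :=
  β.liftUL (α.toUL ∘ₗ (Submodule.inclusion h).dualMap) (by
    intro p q x y
    exact α.toUL_mul x y)

@[simp]
theorem Index.mapUL_toUL {α β : S.Index} (h : α.space ≤ β.space)
    (z : Module.Dual ℚ β.space) :
    Index.mapUL h (β.toUL z) = α.toUL ((Submodule.inclusion h).dualMap z) :=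
  β.liftUL_toUL _ _ z

theorem Index.augUL_mapUL {α β : S.Index} (h : α.space ≤ β.space) (a : β.UL) :
    α.augUL (Index.mapUL h a) = β.augUL a := by
  have : α.augUL.comp (Index.mapUL h) = β.augUL := by
    apply Index.UL_hom_ext
    intro z
    simp [Index.augUL]
  exact DFunLike.congr_fun this a

theorem pow_le_comap {A B : Type*} [Ring A] [Ring B] (f : A →+* B) (I : Ideal A) (J : Ideal B)
    [J.IsTwoSided] (h : I ≤ J.comap f) {m n : ℕ} (hmn : m ≤ n) : I ^ n ≤ (J ^ m).comap f := by
  have key : ∀ k : ℕ, I ^ k ≤ (J ^ k).comap f := by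
    intro k
    induction k with
    | zero => rw [Submodule.pow_zero, Submodule.pow_zero, Ideal.one_eq_top, Ideal.one_eq_top,
        Ideal.comap_top]
    | succ k ih =>
      rw [Submodule.pow_succ, Submodule.pow_succ, Ideal.mul_le]
      intro r hr s hs
      rw [Ideal.mem_comap, map_mul]
      exact Ideal.mul_mem_mul (ih hr) (h hs)
  exact (key n).trans (Ideal.comap_mono (Ideal.pow_le_pow_right hmn))

/-- The morphism `UL_β / I_β^n → UL_α / I_α^m` for `V_α ⊆ V_β` and `m ≤ n`. -/
def Index.transition {α β : S.Index} (h : α.space ≤ β.space) {m n : ℕ} (hmn : m ≤ n) :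
    β.UL ⧸ β.I ^ n →ₐ[ℚ] α.UL ⧸ α.I ^ m :=
  Ideal.quotientMapₐ (α.I ^ m) (Index.mapUL h)
    (pow_le_comap (Index.mapUL h : β.UL →+* α.UL) β.I α.I (by
      intro a ha
      have ha' : β.augUL a = 0 := ha
      exact (Index.augUL_mapUL h a).trans ha') hmn)

variable (S) in
/-- The Sullivan completion `lim_α lim_n UL_α / I_α^n` of `UL_V`, as the algebra of compatible
families in the product. -/
def completion : Subalgebra ℚ (∀ (α : S.Index) (n : ℕ), α.UL ⧸ α.I ^ n) where
  carrier := {a | ∀ (α β : S.Index) (h : α.space ≤ β.space) (m n : ℕ) (hmn : m ≤ n),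
    Index.transition h hmn (a β n) = a α m}
  mul_mem' := by
    intro a b ha hb α β h m n hmn
    simp only [Pi.mul_apply, map_mul, ha α β h m n hmn, hb α β h m n hmn]
  add_mem' := by
    intro a b ha hb α β h m n hmn
    simp only [Pi.add_apply, map_add, ha α β h m n hmn, hb α β h m n hmn]
  algebraMap_mem' := by
    intro r α β h m n hmn
    simp only [Pi.algebraMap_apply, AlgHom.commutes]

variable (S) in
/-- The canonical map from `L_V` to the Sullivan completion of `UL_V`. -/
def lieToCompletion : Module.Dual ℚ V →ₗ[ℚ] S.completion :=
  LinearMap.codRestrict (Subalgebra.toSubmodule S.completion)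
    (LinearMap.pi fun α => LinearMap.pi fun n =>
      (Ideal.Quotient.mkₐ ℚ (α.I ^ n)).toLinearMap ∘ₗ α.toUL ∘ₗ α.res)
    (by
      intro x α β h m n hmn
      change Ideal.Quotient.mk _ (Index.mapUL h (β.toUL (β.res x))) = _
      rw [Index.mapUL_toUL]
      rfl)

/-- Products `x₁ ⋯ x_k` in `UL_α` of homogeneous elements of `L_α` of total degree `n`. -/
inductive Index.IsMonomial (α : S.Index) : ℕ → α.UL → Prop
  | one : Index.IsMonomial α 0 1
  | cons {p n : ℕ} (x : lie 𝒱 p) {a : α.UL} (ha : Index.IsMonomial α n a) :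
      Index.IsMonomial α (p + n) (α.toUL (α.res x.1) * a)

/-- The component of degree `m` of `UL_α`. -/
def Index.grUL (α : S.Index) (m : ℕ) : Submodule ℚ α.UL :=
  Submodule.span ℚ {a | α.IsMonomial m a}

variable (S) in
/-- The component of degree `m` of the Sullivan completion of `UL_V`. -/
def completionGr (m : ℕ) : Submodule ℚ S.completion where
  carrier := {a | ∀ (α : S.Index) (n : ℕ),
    a.1 α n ∈ (α.grUL m).map (Ideal.Quotient.mkₐ ℚ (α.I ^ n)).toLinearMap}
  add_mem' ha hb := fun α n => add_mem (ha α n) (hb α n)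
  zero_mem' := fun _ _ => zero_mem _
  smul_mem' c _ ha := fun α n => Submodule.smul_mem _ c (ha α n)

/-! ### The degree involution `a ↦ (-1)^{deg a} a` of the Sullivan completion -/

variable (𝒱) in
/-- The map `v ↦ (-1)^{i+1} v`, `v ∈ V^i`; note that `V^i` is dual to `(L_V)_{i-1}`. -/
def degSign : V →ₗ[ℚ] V :=
  (DirectSum.toModule ℚ ℕ V fun i => (-1 : ℚ) ^ (i + 1) • (𝒱 i).subtype) ∘ₗ
    (DirectSum.decomposeLinearEquiv 𝒱).toLinearMap

theorem degSign_apply {i : ℕ} {v : V} (hv : v ∈ 𝒱 i) :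
    degSign 𝒱 v = (-1 : ℚ) ^ (i + 1) • v := by
  simp only [degSign, LinearMap.comp_apply, LinearEquiv.coe_coe,
    DirectSum.decomposeLinearEquiv_apply]
  rw [DirectSum.decompose_of_mem 𝒱 hv, ← DirectSum.lof_eq_of ℚ, DirectSum.toModule_lof]
  rfl

theorem Index.degSign_mem (α : S.Index) (v : V) (hv : v ∈ α.space) : degSign 𝒱 v ∈ α.space := by
  classical
  rw [← DirectSum.sum_support_decompose 𝒱 v, map_sum]
  refine Submodule.sum_mem _ fun i _ => ?_
  rw [degSign_apply (DirectSum.decompose 𝒱 v i).2]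
  exact Submodule.smul_mem _ _ (α.homogeneous v hv i)

/-- The map `x ↦ (-1)^{deg x} x` of `L_α`. -/
def Index.signLie (α : S.Index) : Module.Dual ℚ α.space →ₗ[ℚ] Module.Dual ℚ α.space :=
  ((degSign 𝒱).restrict α.degSign_mem).dualMap

theorem Index.signLie_res (α : S.Index) {p : ℕ} (x : lie 𝒱 p) :
    α.signLie (α.res x.1) = (-1 : ℚ) ^ p • α.res x.1 := by
  have key : ∀ v : V, x.1 (degSign 𝒱 v) = (-1 : ℚ) ^ p * x.1 v := by
    intro v
    induction v using DirectSum.Decomposition.inductionOn 𝒱 with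
    | zero => simp
    | @homogeneous i v =>
      rw [degSign_apply v.2, map_smul, smul_eq_mul]
      by_cases h : i = p + 1
      · have e : (-1 : ℚ) ^ (i + 1) = (-1 : ℚ) ^ p := by rw [h, pow_add, pow_add]; simp
        rw [e]
      · rw [x.2 i h v v.2]; simp
    | add v w hv hw => rw [map_add, map_add, hv, hw, map_add, mul_add]
  ext v
  exact key v

/-- The automorphism `a ↦ (-1)^{deg a} a` of `UL_α`. -/
def Index.signUL (α : S.Index) : α.UL →ₐ[ℚ] α.UL :=
  α.liftUL (α.toUL ∘ₗ α.signLie) (by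
    intro p q x y
    simp only [LinearMap.comp_apply, α.signLie_res, map_smul, smul_mul_smul_comm]
    rw [α.toUL_mul x y, smul_add, smul_comm, mul_comm ((-1 : ℚ) ^ p), pow_add,
      mul_comm ((-1 : ℚ) ^ p)])

theorem Index.augUL_signUL (α : S.Index) (a : α.UL) : α.augUL (α.signUL a) = α.augUL a := by
  have : α.augUL.comp α.signUL = α.augUL := by
    apply Index.UL_hom_ext
    intro z
    simp [Index.augUL, Index.signUL]
  exact DFunLike.congr_fun this a

theorem Index.signUL_mapUL {α β : S.Index} (h : α.space ≤ β.space) (a : β.UL) :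
    Index.mapUL h (β.signUL a) = α.signUL (Index.mapUL h a) := by
  have : (Index.mapUL h).comp β.signUL = α.signUL.comp (Index.mapUL h) := by
    apply Index.UL_hom_ext
    intro z
    simp only [AlgHom.comp_apply, Index.signUL, Index.mapUL_toUL, Index.liftUL_toUL,
      LinearMap.comp_apply]
    rfl
  exact DFunLike.congr_fun this a

theorem Index.signUL_apply (α : S.Index) {m : ℕ} {a : α.UL} (ha : a ∈ α.grUL m) :
    α.signUL a = (-1 : ℚ) ^ m • a := by
  induction ha using Submodule.span_induction with
  | mem a ha =>
    induction ha with
    | one => simp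
    | @cons p n x a ha ih =>
      rw [map_mul, ih, Index.signUL, Index.liftUL_toUL, LinearMap.comp_apply, α.signLie_res,
        map_smul, smul_mul_smul_comm, pow_add]
  | zero => simp
  | add a b _ _ ha hb => rw [map_add, ha, hb, smul_add]
  | smul r a _ ha => rw [map_smul, ha, smul_comm]

/-- The automorphism of `UL_α / I_α^n` induced by `signUL`. -/
def Index.signQuot (α : S.Index) (n : ℕ) : α.UL ⧸ α.I ^ n →ₐ[ℚ] α.UL ⧸ α.I ^ n :=
  Ideal.quotientMapₐ (α.I ^ n) α.signUL
    (pow_le_comap (α.signUL : α.UL →+* α.UL) α.I α.I (by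
      intro a ha
      have ha' : α.augUL a = 0 := ha
      exact (α.augUL_signUL a).trans ha') le_rfl)

variable (S) in
/-- The automorphism `a ↦ (-1)^{deg a} a` of the Sullivan completion (see `signCompletion_apply`). -/
def signCompletion : S.completion →ₐ[ℚ] S.completion where
  toFun a := ⟨fun α n => α.signQuot n (a.1 α n), by
    intro α β h m n hmn
    change Index.transition h hmn (β.signQuot n (a.1 β n)) = α.signQuot m (a.1 α m)
    rw [← a.2 α β h m n hmn]
    obtain ⟨b, hb⟩ := Ideal.Quotient.mk_surjective (a.1 β n)
    rw [← hb]
    change Ideal.Quotient.mk _ (Index.mapUL h (β.signUL b)) =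
      Ideal.Quotient.mk _ (α.signUL (Index.mapUL h b))
    rw [Index.signUL_mapUL]⟩
  map_one' := by ext α n; exact map_one (α.signQuot n)
  map_mul' a b := by ext α n; exact map_mul (α.signQuot n) _ _
  map_zero' := by ext α n; exact map_zero (α.signQuot n)
  map_add' a b := by ext α n; exact map_add (α.signQuot n) _ _
  commutes' r := by ext α n; exact (α.signQuot n).commutes r

theorem signCompletion_apply {m : ℕ} {a : S.completion} (ha : a ∈ S.completionGr m) :
    S.signCompletion a = (-1 : ℚ) ^ m • a := by
  ext α n
  obtain ⟨b, hb, hab⟩ := ha α n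
  change α.signQuot n (a.1 α n) = (-1 : ℚ) ^ m • a.1 α n
  rw [← hab]
  change Ideal.Quotient.mkₐ ℚ (α.I ^ n) (α.signUL b) = _
  rw [α.signUL_apply hb, map_smul]
  rfl

/-- The dual right representation `⟨m, f · a⟩ = (-1)^{deg a} ⟨a · m, f⟩` in `M^∨` of a representation
`ρ` of the Sullivan completion in `M`; a right representation is a representation of the opposite
algebra. -/
def dualRight {M : Type*} [AddCommGroup M] [Module ℚ M]
    (ρ : S.completion →ₐ[ℚ] Module.End ℚ M) :
    S.completionᵐᵒᵖ →ₐ[ℚ] Module.End ℚ (Module.Dual ℚ M) where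
  toFun a := (ρ (S.signCompletion a.unop)).dualMap
  map_one' := by ext f m; simp
  map_mul' a b := by ext f m; simp
  map_zero' := by ext f m; simp
  map_add' a b := by ext f m; simp
  commutes' r := by ext f m; simp [Algebra.algebraMap_eq_smul_one]

theorem dualRight_apply {M : Type*} [AddCommGroup M] [Module ℚ M]
    (ρ : S.completion →ₐ[ℚ] Module.End ℚ M) {n : ℕ} {a : S.completion}
    (ha : a ∈ S.completionGr n) (f : Module.Dual ℚ M) (m : M) :
    dualRight ρ (MulOpposite.op a) f m = (-1 : ℚ) ^ n * f (ρ a m) := by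
  change f (ρ (S.signCompletion a) m) = _
  rw [signCompletion_apply ha]
  simp

end MinimalSullivanAlgebra

/-! ### Acyclic closures and their holonomy representation -/

variable {U : Type v} [AddCommGroup U] [Module ℚ U] (𝒱) (𝒰 : ℕ → Submodule ℚ U)
  [DirectSum.Decomposition 𝒱] [DirectSum.Decomposition 𝒰]

/-- The graded algebra `∧V ⊗ ∧U`. -/
abbrev Extension : Type _ := FreeGCA.gr 𝒱 ᵍ⊗[ℚ] FreeGCA.gr 𝒰

/-- The component of degree `n` of `∧V ⊗ ∧U`. -/
def Extension.gr (n : ℕ) : Submodule ℚ (Extension 𝒱 𝒰) :=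
  Submodule.span ℚ {z | ∃ (i j : ℕ) (a : FreeGCA 𝒱) (b : FreeGCA 𝒰), i + j = n ∧
    a ∈ FreeGCA.gr 𝒱 i ∧ b ∈ FreeGCA.gr 𝒰 j ∧ z = a ᵍ⊗ₜ[ℚ] b}

/-- For a subspace `Z ⊆ U`, the subspace `∧V ⊗ ∧Z ⊆ ∧V ⊗ ∧U`. -/
def Extension.sub (Z : Submodule ℚ U) : Submodule ℚ (Extension 𝒱 𝒰) :=
  Submodule.span ℚ {z | ∃ (a : FreeGCA 𝒱) (b : FreeGCA 𝒰), b ∈ FreeGCA.sub 𝒰 Z ∧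
    z = a ᵍ⊗ₜ[ℚ] b}

/-- For a linear form `f` on `∧V`, the map `f ⊗ id : ∧V ⊗ ∧U → ∧U`. -/
def Extension.slant (f : FreeGCA 𝒱 →ₗ[ℚ] ℚ) : Extension 𝒱 𝒰 →ₗ[ℚ] FreeGCA 𝒰 :=
  (TensorProduct.lid ℚ (FreeGCA 𝒰)).toLinearMap ∘ₗ TensorProduct.map f LinearMap.id ∘ₗ
    (GradedTensorProduct.of ℚ (FreeGCA.gr 𝒱) (FreeGCA.gr 𝒰)).symm.toLinearMap

/-- The augmentation `ε : ∧V ⊗ ∧U → ℚ` sending `V` and `U` to `0`. -/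
def Extension.aug : Extension 𝒱 𝒰 →ₗ[ℚ] ℚ :=
  (FreeGCA.aug 𝒰).toLinearMap ∘ₗ Extension.slant 𝒱 𝒰 (FreeGCA.aug 𝒱).toLinearMap

variable {𝒱 𝒰}

/-- The linear map `Φ ↦ (f ⊗ id)(D(1 ⊗ Φ))` of `∧U`. For `f` the augmentation of `∧V` this is the
quotient differential in `∧U = ℚ ⊗_{∧V} (∧V ⊗ ∧U)`. -/
def Extension.component (D : Extension 𝒱 𝒰 →ₗ[ℚ] Extension 𝒱 𝒰) (f : FreeGCA 𝒱 →ₗ[ℚ] ℚ) :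
    FreeGCA 𝒰 →ₗ[ℚ] FreeGCA 𝒰 :=
  Extension.slant 𝒱 𝒰 f ∘ₗ D ∘ₗ
    (GradedTensorProduct.includeRight (FreeGCA.gr 𝒱) (FreeGCA.gr 𝒰)).toLinearMap

/-- The quotient differential in `∧U`. -/
def Extension.quotientDifferential (D : Extension 𝒱 𝒰 →ₗ[ℚ] Extension 𝒱 𝒰) : FreeGCA 𝒰 →ₗ[ℚ] FreeGCA 𝒰 :=
  Extension.component D (FreeGCA.aug 𝒱).toLinearMap

/-- The filtration `U(-1) = 0`, `U(k) = {u ∈ U : D(1 ⊗ u) ∈ ∧V ⊗ ∧U(k-1)}`, with the index shifted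
by one. -/
def Extension.filtration (D : Extension 𝒱 𝒰 →ₗ[ℚ] Extension 𝒱 𝒰) : ℕ → Submodule ℚ U
  | 0 => ⊥
  | k + 1 => (Extension.sub 𝒱 𝒰 (Extension.filtration D k)).comap (D ∘ₗ
      (GradedTensorProduct.includeRight (FreeGCA.gr 𝒱) (FreeGCA.gr 𝒰)).toLinearMap ∘ₗ
        FreeGCA.ι 𝒰)

/-- `(∧V ⊗ ∧U, D)` is the acyclic closure of the minimal Sullivan algebra `(∧V, d)`: a minimal
`Λ`-extension of `(∧V, d)` whose augmentation `ε` is a quasi-isomorphism to `ℚ`. -/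
structure IsAcyclicClosure (S : MinimalSullivanAlgebra 𝒱) (D : Extension 𝒱 𝒰 →ₗ[ℚ] Extension 𝒱 𝒰) :
    Prop where
  isDifferential : IsDifferential (Extension.gr 𝒱 𝒰) D
  base : ∀ a : FreeGCA 𝒱, D (a ᵍ⊗ₜ[ℚ] (1 : FreeGCA 𝒰)) = S.d a ᵍ⊗ₜ[ℚ] (1 : FreeGCA 𝒰)
  nilpotent : ∀ u : U, ∃ k : ℕ, u ∈ Extension.filtration D k
  minimal : ∀ u : U, Extension.quotientDifferential D (FreeGCA.ι 𝒰 u) ∈ FreeGCA.wedgeGE 𝒰 2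
  /-- `ε` induces a well-defined and injective map in cohomology, which is then bijective because
  `ε 1 = 1`. -/
  quasiIso : ∀ z : Extension 𝒱 𝒰, D z = 0 → (Extension.aug 𝒱 𝒰 z = 0 ↔ z ∈ LinearMap.range D)

/-- For `x ∈ L_V`, the operator `-∑ ⟨v_i, sx⟩ θ_i` in `∧U`, where
`D(1 ⊗ Φ) = 1 ⊗ D̄ Φ + ∑ v_i ⊗ θ_i Φ + Ω` with `v_i` a basis of `V` and `Ω ∈ ∧^{≥ 2} V ⊗ ∧U`. -/
def Extension.holonomyLie (D : Extension 𝒱 𝒰 →ₗ[ℚ] Extension 𝒱 𝒰) (x : Module.Dual ℚ V) :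
    FreeGCA 𝒰 →ₗ[ℚ] FreeGCA 𝒰 :=
  -Extension.component D (FreeGCA.ev 𝒱 x)

/-- `ρ` is the holonomy representation of the Sullivan completion of `UL_V` in `∧U`: it extends the
holonomy representation of `L_V`, and is the extension obtained through the quotients
`UL_α / I_α^n`, i.e. for each `Φ ∈ ∧U` the element `ρ(a) Φ` depends only on the component of `a` in one
of them. -/
structure IsHolonomy (S : MinimalSullivanAlgebra 𝒱) (D : Extension 𝒱 𝒰 →ₗ[ℚ] Extension 𝒱 𝒰)
    (ρ : S.completion →ₐ[ℚ] Module.End ℚ (FreeGCA 𝒰)) : Prop where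
  extends_lie : ∀ (p : ℕ) (x : lie 𝒱 p), ρ (S.lieToCompletion x.1) = Extension.holonomyLie D x.1
  locally : ∀ Φ : FreeGCA 𝒰, ∃ (α : S.Index) (n : ℕ), ∀ a : S.completion,
    a.1 α n = 0 → ρ a Φ = 0

/-- The component of degree `m` of `(∧U)^∨`, i.e. `((∧U)^m)^∨`. -/
def dualGr (𝒰 : ℕ → Submodule ℚ U) (m : ℕ) : Submodule ℚ (Module.Dual ℚ (FreeGCA 𝒰)) where
  carrier := {f | ∀ j : ℕ, j ≠ m → ∀ Φ ∈ FreeGCA.gr 𝒰 j, f Φ = 0}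
  add_mem' := by
    intro f g hf hg j hj v hv
    simp [hf j hj v hv, hg j hj v hv]
  zero_mem' := by simp
  smul_mem' := by
    intro c f hf j hj v hv
    simp [hf j hj v hv]

end Algebras

end Sullivan

end

/-! Think of `∧U` as the algebra of functions on the pro-unipotent group attached to `L_V`: the
holonomy operators `θ_x` are translations and `ε_U` is evaluation at the identity. A function is
determined by its Taylor coefficients `t ↦ ε_U(t · Φ)`, and the theorem amounts to the statement
that the forms on `UL_V` arising in this way are exactly those that factor through some `UL_α /
I_α^n`. Thus `∧U` is the directed union of the duals of these quotients. They are finite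
dimensional, so dualizing once more gives `(∧U)^∨ = lim UL_α / I_α^n`.

The linear part `δ : U → V` of `D` is bijective (`delta_bijective`). A contraction of the
augmentation ideal is used to build a homotopy of algebra morphisms from the augmentation to the
identity of `∧V ⊗ ∧U`. Integrating it over `[0, 1]` shows that the complex of indecomposables is
acyclic, and minimality leaves `δ` as its only differential.

The invariants of the operators `θ_x` are the scalars (`eq_zero_of_holonomyLie_eq_zero`). Composing
`D` with `δ⁻¹` gives an Euler derivation of `∧U`, built from the `θ_x`, which acts as `q` on the
`q`th layer of the word length filtration; an invariant of augmentation zero is therefore in every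
layer. This forces the quotient differential to vanish, since it (anti)commutes with the `θ_x`. The
component of `D² = 0` in `∧²V ⊗ ∧U` is then the bracket relation for the `θ_x`.

Each `Φ` lies in the subalgebra of a flag, a finite dimensional piece of `U` on which `L_V` acts
through a single `L_α`, and in some layer of the socle filtration, which `I_α^n` annihilates
(`exists_isGood`). Hence the completion acts. Computations use the free algebra `LieWord` on the
homogeneous elements of `L_V`, which maps onto every `UL_α` simultaneously.

Injectivity of `Φ ↦ ε_U(- · Φ)` is the statement on invariants, applied along the socle filtration.
Surjectivity (`exists_eq_wordPairing_of_vanishesOn`) is an induction along a flag which replaces the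
Poincaré-Birkhoff-Witt theorem: adjoining a generator `u` dual to `x`, one represents the form `c(x
-)` by some `g`, integrates `g` with respect to the derivation `del` with `del u = 1`, and is left
with a form that belongs to the smaller flag. -/

noncomputable section

namespace Sullivan

universe u v

set_option linter.unusedSectionVars false

/-! ### Ring and module structures on `∧V`. -/

section Instances

variable {V : Type u} [AddCommGroup V] [Module ℚ V] (𝒱 : ℕ → Submodule ℚ V)

scoped instance : Semiring (FreeGCA 𝒱) := inferInstance

scoped instance : AddCommGroup (FreeGCA 𝒱) := inferInstance

scoped instance : AddCommMonoid (FreeGCA 𝒱) := inferInstance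

scoped instance : Module ℚ (FreeGCA 𝒱) := inferInstance

end Instances

/-! ### Structure of `∧V`: signs, linear part, word length, graded subalgebras, derivations. -/

section FreeGCALemmas

variable {V : Type u} [AddCommGroup V] [Module ℚ V] {𝒱 : ℕ → Submodule ℚ V}

open MinimalSullivanAlgebra (degSign degSign_apply)

namespace FreeGCA

/-- Induction along monomials in homogeneous elements of `V`, with control of the degree. -/
@[elab_as_elim]
theorem gr_induction {p : ∀ (n : ℕ) (a : FreeGCA 𝒱), a ∈ gr 𝒱 n → Prop}
    (one : ∀ h, p 0 1 h) (zero : ∀ n h, p n 0 h)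
    (add : ∀ n a b ha hb h, p n a ha → p n b hb → p n (a + b) h)
    (smul : ∀ n (r : ℚ) a ha h, p n a ha → p n (r • a) h)
    (ι_mul : ∀ i n v a ha h, v ∈ 𝒱 i → p n a ha → p (i + n) (ι 𝒱 v * a) h)
    {n : ℕ} {a : FreeGCA 𝒱} (ha : a ∈ gr 𝒱 n) : p n a ha := by
  have mono : ∀ (n : ℕ) (a : FreeGCA 𝒱), IsMonomial 𝒱 n a → ∀ h, p n a h := by
    intro n a ha
    induction ha with
    | one => exact one
    | cons hv ha ih => exact fun h => ι_mul _ _ _ _ (Submodule.subset_span ha) h hv (ih _)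
  induction ha using Submodule.span_induction with
  | mem a ha => exact mono n a ha _
  | zero => exact zero n _
  | add a b _ _ h₁ h₂ => exact add _ _ _ _ _ _ h₁ h₂
  | smul r a _ h => exact smul _ _ _ _ _ h

theorem grade_induction [DirectSum.Decomposition 𝒱] {p : FreeGCA 𝒱 → Prop}
    (add : ∀ a b, p a → p b → p (a + b))
    (homog : ∀ n, ∀ a ∈ gr 𝒱 n, p a) (a : FreeGCA 𝒱) : p a := by
  induction a using DirectSum.Decomposition.inductionOn (gr 𝒱) with
  | zero => exact homog 0 0 (zero_mem _)
  | homogeneous a => exact homog _ _ a.2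
  | add a b h₁ h₂ => exact add _ _ h₁ h₂

/-- Induction along monomials in homogeneous elements of `V`. -/
theorem monomial_induction [DirectSum.Decomposition 𝒱] {p : FreeGCA 𝒱 → Prop}
    (one : p 1) (add : ∀ a b, p a → p b → p (a + b)) (smul : ∀ (r : ℚ) a, p a → p (r • a))
    (ι_mul : ∀ (i : ℕ) (v : V) (a : FreeGCA 𝒱), v ∈ 𝒱 i → p a → p (ι 𝒱 v * a))
    (a : FreeGCA 𝒱) : p a := by
  induction a using grade_induction with
  | add a b h₁ h₂ => exact add _ _ h₁ h₂
  | homog n a ha =>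
    induction ha using gr_induction with
    | one => exact one
    | zero => simpa using smul 0 1 one
    | add n a b _ _ _ h₁ h₂ => exact add _ _ h₁ h₂
    | smul n r a _ _ h => exact smul _ _ h
    | ι_mul i n v a _ _ hv h => exact ι_mul _ _ _ hv h

theorem aug_ι (v : V) : aug 𝒱 (ι 𝒱 v) = 0 := by simp [aug]

theorem aug_eq_zero {n : ℕ} (hn : n ≠ 0) {a : FreeGCA 𝒱} (ha : a ∈ gr 𝒱 n) : aug 𝒱 a = 0 := by
  induction ha using gr_induction with
  | one => exact absurd rfl hn
  | zero => simp
  | add n a b _ _ _ h₁ h₂ => rw [map_add, h₁ hn, h₂ hn, add_zero]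
  | smul n r a _ _ h => rw [map_smul, h hn, smul_zero]
  | ι_mul i n v a _ _ hv h => rw [map_mul, aug_ι, zero_mul]

/-! #### The sign automorphism -/

section Sign

variable [DirectSum.Decomposition 𝒱]

/-- `degSign` carries the parity of the dual element of the Lie algebra, whose degree is one less
than that of `v`; the minus sign undoes this shift. -/
theorem neg_degSign_apply {i : ℕ} {v : V} (hv : v ∈ 𝒱 i) :
    (-degSign 𝒱) v = (-1 : ℚ) ^ i • v := by
  rw [LinearMap.neg_apply, degSign_apply hv, pow_succ]
  simp

variable (𝒱) in
/-- The automorphism `a ↦ (-1)^{deg a} a` of `∧V`. -/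
def sgn : FreeGCA 𝒱 →ₐ[ℚ] FreeGCA 𝒱 :=
  lift (ι 𝒱 ∘ₗ (-degSign 𝒱)) (by
    intro i j v w hv hw
    rw [LinearMap.comp_apply, LinearMap.comp_apply, neg_degSign_apply hv, neg_degSign_apply hw,
      map_smul, map_smul, smul_mul_smul_comm, smul_mul_smul_comm, ι_mul_ι hv hw, smul_comm,
      mul_comm ((-1 : ℚ) ^ i)])

theorem sgn_ι {i : ℕ} {v : V} (hv : v ∈ 𝒱 i) : sgn 𝒱 (ι 𝒱 v) = (-1 : ℚ) ^ i • ι 𝒱 v := by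
  rw [sgn, lift_ι, LinearMap.comp_apply, neg_degSign_apply hv, map_smul]

theorem sgn_apply {n : ℕ} {a : FreeGCA 𝒱} (ha : a ∈ gr 𝒱 n) : sgn 𝒱 a = (-1 : ℚ) ^ n • a := by
  induction ha using gr_induction with
  | one => simp
  | zero => simp
  | add n a b _ _ _ h₁ h₂ => rw [map_add, h₁, h₂, smul_add]
  | smul n r a _ _ h => rw [map_smul, h, smul_comm]
  | ι_mul i n v a _ _ hv h => rw [map_mul, h, sgn_ι hv, smul_mul_smul_comm, pow_add]

/-- Powers of `sgn` turn the Koszul sign `(-1)^{p deg a}` into an algebra morphism, so that twisted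
Leibniz rules can be stated for inhomogeneous elements. -/
theorem sgn_pow_apply (p : ℕ) {n : ℕ} {a : FreeGCA 𝒱} (ha : a ∈ gr 𝒱 n) :
    (sgn 𝒱 ^ p) a = (-1 : ℚ) ^ (p * n) • a := by
  induction p with
  | zero => simp
  | succ p ih =>
    rw [pow_succ, AlgHom.mul_apply, sgn_apply ha, map_smul, ih, smul_smul]
    congr 1
    ring

theorem sgn_pow_mem (p : ℕ) {n : ℕ} {a : FreeGCA 𝒱} (ha : a ∈ gr 𝒱 n) :
    (sgn 𝒱 ^ p) a ∈ gr 𝒱 n := by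
  rw [sgn_pow_apply p ha]
  exact Submodule.smul_mem _ _ ha

theorem sgn_sgn (a : FreeGCA 𝒱) : sgn 𝒱 (sgn 𝒱 a) = a := by
  induction a using grade_induction with
  | add a b h₁ h₂ => rw [map_add, map_add, h₁, h₂]
  | homog n a ha => rw [sgn_apply ha, map_smul, sgn_apply ha, smul_smul, ← mul_pow]; simp

theorem sgn_mem {n : ℕ} {a : FreeGCA 𝒱} (ha : a ∈ gr 𝒱 n) : sgn 𝒱 a ∈ gr 𝒱 n := by
  simpa using sgn_pow_mem 1 ha

theorem sgn_sq : sgn 𝒱 ^ 2 = 1 := by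
  ext a
  exact sgn_sgn a

theorem sgn_pow_add_two (p : ℕ) : sgn 𝒱 ^ (p + 2) = sgn 𝒱 ^ p := by
  rw [pow_add, sgn_sq, mul_one]

theorem sgn_pow_two_mul_add (k p : ℕ) : sgn 𝒱 ^ (2 * k + p) = sgn 𝒱 ^ p := by
  rw [pow_add, pow_mul, sgn_sq, one_pow, one_mul]

theorem aug_sgn_pow (p : ℕ) (a : FreeGCA 𝒱) : aug 𝒱 ((sgn 𝒱 ^ p) a) = aug 𝒱 a := by
  induction a using grade_induction with
  | add a b h₁ h₂ => rw [map_add, map_add, h₁, h₂, map_add]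
  | homog n a ha =>
    rw [sgn_pow_apply p ha, map_smul]
    by_cases hn : n = 0
    · simp [hn]
    · simp [aug_eq_zero hn ha]

end Sign

/-- `∧V` is graded commutative. -/
theorem gr_mul_comm {i j : ℕ} {a b : FreeGCA 𝒱} (ha : a ∈ gr 𝒱 i) (hb : b ∈ gr 𝒱 j) :
    a * b = (-1 : ℚ) ^ (i * j) • (b * a) := by
  have key : ∀ (k : ℕ) (v : V), v ∈ 𝒱 k → ∀ (j : ℕ) (b : FreeGCA 𝒱), b ∈ gr 𝒱 j →
      ι 𝒱 v * b = (-1 : ℚ) ^ (k * j) • (b * ι 𝒱 v) := by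
    intro k v hv j b hb
    induction hb using gr_induction with
    | one => simp
    | zero => simp
    | add n a b _ _ _ h₁ h₂ => rw [mul_add, h₁, h₂, add_mul, smul_add]
    | smul n r a _ _ h => rw [mul_smul_comm, h, smul_mul_assoc, smul_comm]
    | ι_mul l n w b _ _ hw ih =>
      rw [← mul_assoc, ι_mul_ι hv hw, smul_mul_assoc, mul_assoc, ih,
        mul_smul_comm, smul_smul, mul_assoc, mul_add, pow_add]
  induction ha using gr_induction with
  | one => simp
  | zero => simp
  | add n a b _ _ _ h₁ h₂ => rw [mul_add, add_mul, smul_add, h₁, h₂]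
  | smul n r a _ _ h => rw [mul_smul_comm, smul_mul_assoc, smul_comm, ← h]
  | ι_mul k n v a _ _ hv ih =>
    rw [mul_assoc, ih, mul_smul_comm, ← mul_assoc, key k v hv j b hb,
      smul_mul_assoc, smul_smul, mul_assoc, add_mul, pow_add, mul_comm ((-1 : ℚ) ^ (k * j))]

/-! #### The linear part -/

variable (𝒱) in
/-- Auxiliary to `lin`. -/
def linHom : FreeGCA 𝒱 →ₐ[ℚ] Module.End ℚ (ℚ × V) :=
  lift
    { toFun := fun v => (LinearMap.inr ℚ ℚ V) ∘ₗ (LinearMap.toSpanSingleton ℚ V v) ∘ₗ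
        (LinearMap.fst ℚ ℚ V)
      map_add' := by intros; ext <;> simp
      map_smul' := by intros; ext <;> simp }
    (by
      intro i j v w hv hw
      ext <;> simp)

variable (𝒱) in
/-- The projection of `∧V` to `V = ∧^1 V`. -/
def lin : FreeGCA 𝒱 →ₗ[ℚ] V :=
  LinearMap.snd ℚ ℚ V ∘ₗ LinearMap.applyₗ ((1 : ℚ), (0 : V)) ∘ₗ (linHom 𝒱).toLinearMap

theorem linHom_ι_apply (v : V) (z : ℚ × V) : linHom 𝒱 (ι 𝒱 v) z = (0, z.1 • v) := by
  rw [linHom, lift_ι]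
  simp

/-- The representation `linHom` is multiplication on `∧V / ∧^{≥2}V ≅ ℚ × V`, with unit `(1, 0)`; the
formula is the product of this square-zero extension, and `lin_mul` is its second coordinate. -/
theorem linHom_apply [DirectSum.Decomposition 𝒱] (a : FreeGCA 𝒱) (z : ℚ × V) :
    linHom 𝒱 a z = (aug 𝒱 a * z.1, aug 𝒱 a • z.2 + z.1 • lin 𝒱 a) := by
  have h : ∀ a, lin 𝒱 a = (linHom 𝒱 a (1, 0)).2 := fun _ => rfl
  induction a using monomial_induction generalizing z with
  | one => simp [h]
  | add a b h₁ h₂ =>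
    rw [map_add, LinearMap.add_apply, h₁, h₂, map_add, map_add]
    ext
    · simp [add_mul]
    · simp only [Prod.mk_add_mk, add_smul, smul_add]; abel
  | smul r a ih =>
    rw [map_smul, LinearMap.smul_apply, ih, map_smul, map_smul]
    ext
    · simp [mul_assoc]
    · simp [smul_add, mul_smul, smul_comm r]
  | ι_mul i v a hv ih =>
    rw [h (ι 𝒱 v * a), map_mul, Module.End.mul_apply, linHom_ι_apply, Module.End.mul_apply,
      linHom_ι_apply, ih, ih, map_mul, aug_ι]
    simp [smul_smul, mul_comm]

theorem lin_mul [DirectSum.Decomposition 𝒱] (a b : FreeGCA 𝒱) :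
    lin 𝒱 (a * b) = aug 𝒱 a • lin 𝒱 b + aug 𝒱 b • lin 𝒱 a := by
  change (linHom 𝒱 (a * b) (1, 0)).2 = _
  rw [map_mul, Module.End.mul_apply, linHom_apply b, linHom_apply]
  simp

@[simp] theorem lin_ι (v : V) : lin 𝒱 (ι 𝒱 v) = v := by
  change (linHom 𝒱 (ι 𝒱 v) (1, 0)).2 = _
  simp [linHom_ι_apply]

@[simp] theorem lin_one : lin 𝒱 1 = 0 := by
  change (linHom 𝒱 1 (1, 0)).2 = _
  simp

theorem ev_eq [DirectSum.Decomposition 𝒱] (f : Module.Dual ℚ V) (a : FreeGCA 𝒱) :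
    ev 𝒱 f a = f (lin 𝒱 a) := by
  have e : ∀ (v : V) (a : FreeGCA 𝒱), ev 𝒱 f (ι 𝒱 v * a) = aug 𝒱 a * f v := by
    intro v a
    induction a using monomial_induction with
    | one => simp [ev_ι]
    | add a b h₁ h₂ => rw [mul_add, map_add, h₁, h₂, map_add, add_mul]
    | smul r a h => rw [mul_smul_comm, map_smul, h, map_smul, smul_eq_mul, smul_eq_mul, mul_assoc]
    | ι_mul i w a hw _ => rw [← mul_assoc, ev_ι_mul_ι_mul, map_mul, aug_ι]; simp
  induction a using monomial_induction with
  | one => simp [ev_one]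
  | add a b h₁ h₂ => simp [h₁, h₂]
  | smul r a ih => simp [ih]
  | ι_mul i v a hv ih =>
    rw [lin_mul, aug_ι, lin_ι, e]
    simp

theorem ev_mul [DirectSum.Decomposition 𝒱] (f : Module.Dual ℚ V) (a b : FreeGCA 𝒱) :
    ev 𝒱 f (a * b) = aug 𝒱 a * ev 𝒱 f b + aug 𝒱 b * ev 𝒱 f a := by
  simp [ev_eq, lin_mul]

theorem lin_mem [DirectSum.Decomposition 𝒱] {n : ℕ} {a : FreeGCA 𝒱} (ha : a ∈ gr 𝒱 n) :
    lin 𝒱 a ∈ 𝒱 n := by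
  induction ha using gr_induction with
  | one => simp
  | zero => simp
  | add n a b _ _ _ h₁ h₂ => rw [map_add]; exact add_mem h₁ h₂
  | smul n r a _ _ h => rw [map_smul]; exact Submodule.smul_mem _ _ h
  | ι_mul i n v a ha _ hv h =>
    rw [lin_mul, aug_ι, lin_ι, zero_smul, zero_add]
    by_cases hn : n = 0
    · exact hn ▸ Submodule.smul_mem _ _ hv
    · rw [aug_eq_zero hn ha, zero_smul]; exact zero_mem _

theorem ev_eq_zero [DirectSum.Decomposition 𝒱] {p n : ℕ} (x : lie 𝒱 p) {a : FreeGCA 𝒱}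
    (ha : a ∈ gr 𝒱 n) (hn : n ≠ p + 1) : ev 𝒱 x.1 a = 0 := by
  rw [ev_eq]
  exact x.2 n hn _ (lin_mem ha)

/-! #### Word length -/

theorem wedgeGE_zero [DirectSum.Decomposition 𝒱] : wedgeGE 𝒱 0 = ⊤ := by
  rw [eq_top_iff]
  rintro a -
  induction a using monomial_induction with
  | one =>
    exact Submodule.mem_iSup_of_mem 0 (Submodule.mem_iSup_of_mem le_rfl
      (by rw [wedge, pow_zero]; exact Submodule.one_le.mp le_rfl))
  | add a b h₁ h₂ => exact add_mem h₁ h₂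
  | smul r a h => exact Submodule.smul_mem _ _ h
  | ι_mul i v a hv h =>
    have : LinearMap.range (ι 𝒱) * wedgeGE 𝒱 0 ≤ wedgeGE 𝒱 0 := by
      rw [wedgeGE, Submodule.mul_iSup]
      refine iSup_le fun p => ?_
      rw [Submodule.mul_iSup]
      refine iSup_le fun _ => ?_
      rw [wedge, ← pow_succ']
      exact le_iSup₂_of_le (p + 1) (by omega) le_rfl
    exact this (Submodule.mul_mem_mul ⟨v, rfl⟩ h)

theorem wedge_le_wedgeGE {p k : ℕ} (h : k ≤ p) : wedge 𝒱 p ≤ wedgeGE 𝒱 k :=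
  le_iSup₂_of_le p h le_rfl

theorem wedgeGE_mul_le (k l : ℕ) : wedgeGE 𝒱 k * wedgeGE 𝒱 l ≤ wedgeGE 𝒱 (k + l) := by
  simp only [wedgeGE, Submodule.iSup_mul, Submodule.mul_iSup, iSup_le_iff]
  intro p hp q hq
  rw [wedge, wedge, ← pow_add]
  exact wedge_le_wedgeGE (by omega)

theorem mul_mem_wedgeGE {k l : ℕ} {a b : FreeGCA 𝒱} (ha : a ∈ wedgeGE 𝒱 k)
    (hb : b ∈ wedgeGE 𝒱 l) : a * b ∈ wedgeGE 𝒱 (k + l) :=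
  wedgeGE_mul_le k l (Submodule.mul_mem_mul ha hb)

theorem ι_mem_wedgeGE (v : V) : ι 𝒱 v ∈ wedgeGE 𝒱 1 :=
  wedge_le_wedgeGE le_rfl (by rw [wedge, pow_one]; exact ⟨v, rfl⟩)

variable (𝒱) in
/-- The algebra map `∧V → ∧V[t]`, `v ↦ v t`. -/
def lengthHom : FreeGCA 𝒱 →ₐ[ℚ] Polynomial (FreeGCA 𝒱) :=
  lift
    { toFun := fun v => Polynomial.monomial 1 (ι 𝒱 v)
      map_add' := fun v w => by rw [map_add, map_add]
      map_smul' := fun r v => by rw [map_smul, ← Polynomial.smul_monomial]; rfl }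
    (by
      intro i j v w hv hw
      change Polynomial.monomial 1 (ι 𝒱 v) * Polynomial.monomial 1 (ι 𝒱 w) =
        (-1 : ℚ) ^ (i * j) • (Polynomial.monomial 1 (ι 𝒱 w) * Polynomial.monomial 1 (ι 𝒱 v))
      rw [Polynomial.monomial_mul_monomial, Polynomial.monomial_mul_monomial, ι_mul_ι hv hw,
        Polynomial.smul_monomial])

theorem lengthHom_wedge {p : ℕ} {a : FreeGCA 𝒱} (ha : a ∈ wedge 𝒱 p) :
    lengthHom 𝒱 a = Polynomial.monomial p a := by
  induction p generalizing a with
  | zero =>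
    rw [wedge, pow_zero] at ha
    obtain ⟨r, rfl⟩ := Submodule.mem_one.mp ha
    rw [AlgHom.commutes]
    rfl
  | succ p ih =>
    rw [wedge, pow_succ'] at ha
    induction ha using Submodule.mul_induction_on' with
    | mem_mul_mem x hx y hy =>
      obtain ⟨v, rfl⟩ := hx
      rw [map_mul, ih hy, lengthHom, lift_ι]
      change Polynomial.monomial 1 (ι 𝒱 v) * Polynomial.monomial p y = _
      rw [Polynomial.monomial_mul_monomial, add_comm]
    | add x _ y _ h₁ h₂ => rw [map_add, h₁, h₂, map_add]

/-- Setting `t = 1` is a left inverse. -/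
theorem lengthHom_injective [DirectSum.Decomposition 𝒱] :
    Function.Injective (lengthHom 𝒱) := by
  have h : ∀ a : FreeGCA 𝒱, (Polynomial.lsum fun _ : ℕ => (LinearMap.id : FreeGCA 𝒱 →ₗ[ℚ] FreeGCA 𝒱)) (lengthHom 𝒱 a) = a := by
    intro a
    have ha : a ∈ wedgeGE 𝒱 0 := by rw [wedgeGE_zero]; trivial
    rw [wedgeGE] at ha
    simp only [Nat.zero_le, iSup_pos] at ha
    induction ha using Submodule.iSup_induction' with
    | mem p a ha =>
      rw [lengthHom_wedge ha]
      simp [Polynomial.lsum_apply, Polynomial.sum_monomial_index]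
    | zero => simp
    | add a b _ _ h₁ h₂ => rw [map_add, map_add, h₁, h₂]
  exact Function.LeftInverse.injective h

theorem coeff_lengthHom {k i : ℕ} (h : i < k) {a : FreeGCA 𝒱} (ha : a ∈ wedgeGE 𝒱 k) :
    (lengthHom 𝒱 a).coeff i = 0 := by
  rw [wedgeGE, iSup_subtype'] at ha
  induction ha using Submodule.iSup_induction' with
  | mem p a ha =>
    rw [lengthHom_wedge ha, Polynomial.coeff_monomial, if_neg]
    have := p.2
    omega
  | zero => simp
  | add a b _ _ h₁ h₂ => rw [map_add, Polynomial.coeff_add, h₁, h₂, add_zero]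

/-- Elements of `∧^{≥k}V` have no coefficient below `t^k` under `lengthHom`. This separatedness
concludes the Euler derivation argument on invariants. -/
theorem eq_zero_of_forall_mem_wedgeGE [DirectSum.Decomposition 𝒱] {a : FreeGCA 𝒱}
    (h : ∀ k, a ∈ wedgeGE 𝒱 k) : a = 0 := by
  apply lengthHom_injective
  ext i
  rw [coeff_lengthHom (Nat.lt_succ_self i) (h _)]
  simp

theorem wedgeGE_succ_le (k : ℕ) :
    wedgeGE 𝒱 (k + 1) ≤ LinearMap.range (ι 𝒱) * wedgeGE 𝒱 k := by
  refine iSup₂_le fun p hp => ?_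
  obtain ⟨q, rfl⟩ : ∃ q, p = q + 1 := ⟨p - 1, by omega⟩
  rw [wedge, pow_succ']
  exact mul_le_mul' le_rfl (wedge_le_wedgeGE (by omega))

/-- Induction on elements of `∧^{≥ k+1} V`. -/
@[elab_as_elim]
theorem wedgeGE_succ_induction {k : ℕ} {p : ∀ a, a ∈ wedgeGE 𝒱 (k + 1) → Prop}
    (add : ∀ a b ha hb h, p a ha → p b hb → p (a + b) h)
    (ι_mul : ∀ (v : V) (a : FreeGCA 𝒱) h, a ∈ wedgeGE 𝒱 k → p (ι 𝒱 v * a) h)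
    {a : FreeGCA 𝒱} (ha : a ∈ wedgeGE 𝒱 (k + 1)) : p a ha := by
  suffices ∃ h, p a h from this.2
  refine Submodule.mul_induction_on (wedgeGE_succ_le k ha) ?_ ?_
  · intro x hx y hy
    obtain ⟨v, rfl⟩ := hx
    have h : ι 𝒱 v * y ∈ wedgeGE 𝒱 (k + 1) := by
      rw [add_comm]; exact mul_mem_wedgeGE (ι_mem_wedgeGE v) hy
    exact ⟨h, ι_mul v y h hy⟩
  · exact fun x y h₁ h₂ => ⟨add_mem h₁.1 h₂.1, add _ _ _ _ _ h₁.2 h₂.2⟩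

theorem aug_of_mem_wedgeGE {k : ℕ} {a : FreeGCA 𝒱} (ha : a ∈ wedgeGE 𝒱 (k + 1)) :
    aug 𝒱 a = 0 := by
  induction ha using wedgeGE_succ_induction with
  | add a b _ _ _ h₁ h₂ => rw [map_add, h₁, h₂, add_zero]
  | ι_mul v a _ _ => rw [map_mul, aug_ι, zero_mul]

theorem mem_wedgeGE_one_of_aug [DirectSum.Decomposition 𝒱] (a : FreeGCA 𝒱) :
    a - algebraMap ℚ _ (aug 𝒱 a) ∈ wedgeGE 𝒱 1 := by
  induction a using monomial_induction with
  | one => simp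
  | add a b h₁ h₂ => 
    convert add_mem h₁ h₂ using 1
    simp only [map_add]; abel
  | smul r a h =>
    convert Submodule.smul_mem _ r h using 1
    simp [Algebra.smul_def, mul_sub]
  | ι_mul i v a hv h =>
    rw [map_mul, aug_ι, zero_mul, map_zero, sub_zero]
    exact mul_mem_wedgeGE (k := 1) (l := 0) (ι_mem_wedgeGE v) (by rw [wedgeGE_zero]; trivial)

theorem lin_of_mem_wedgeGE [DirectSum.Decomposition 𝒱] {k : ℕ} {a : FreeGCA 𝒱}
    (ha : a ∈ wedgeGE 𝒱 (k + 2)) : lin 𝒱 a = 0 := by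
  induction ha using wedgeGE_succ_induction with
  | add a b _ _ _ h₁ h₂ => rw [map_add, h₁, h₂, add_zero]
  | ι_mul v a _ ha => rw [lin_mul, aug_ι, aug_of_mem_wedgeGE ha]; simp

/-! #### Subalgebras generated by graded subspaces -/

section Sub

theorem ι_mem_sub {Z : Submodule ℚ V} {v : V} (hv : v ∈ Z) : ι 𝒱 v ∈ sub 𝒱 Z :=
  Algebra.subset_adjoin ⟨v, hv, rfl⟩

theorem sub_mono {Z Z' : Submodule ℚ V} (h : Z ≤ Z') : sub 𝒱 Z ≤ sub 𝒱 Z' :=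
  Algebra.adjoin_mono (Set.image_mono h)

variable [DirectSum.Decomposition 𝒱]

variable (𝒱) in
/-- Graded subspaces of `V`. -/
def IsGraded (Z : Submodule ℚ V) : Prop :=
  ∀ v ∈ Z, ∀ i : ℕ, (DirectSum.decompose 𝒱 v i : V) ∈ Z

/-- Induction on elements of the subalgebra generated by a graded subspace. -/
@[elab_as_elim]
theorem sub_induction {Z : Submodule ℚ V} (hZ : IsGraded 𝒱 Z) {p : ∀ a, a ∈ sub 𝒱 Z → Prop}
    (one : ∀ h, p 1 h) (add : ∀ a b ha hb h, p a ha → p b hb → p (a + b) h)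
    (smul : ∀ (r : ℚ) a ha h, p a ha → p (r • a) h)
    (ι_mul : ∀ (i : ℕ) (v : V) (a : FreeGCA 𝒱) ha h, v ∈ 𝒱 i → v ∈ Z → p a ha → p (ι 𝒱 v * a) h)
    {a : FreeGCA 𝒱} (ha : a ∈ sub 𝒱 Z) : p a ha := by
  suffices ∃ h, p a h from this.2
  have zero : ∃ h, p 0 h :=
    ⟨zero_mem _, by simpa using smul 0 1 (one_mem _) (by simp) (one _)⟩
  have add' : ∀ a b, (∃ h, p a h) → (∃ h, p b h) → ∃ h, p (a + b) h :=
    fun a b ⟨h₁, h₁'⟩ ⟨h₂, h₂'⟩ => ⟨add_mem h₁ h₂, add _ _ _ _ _ h₁' h₂'⟩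
  have ha' : a ∈ Subalgebra.toSubmodule (sub 𝒱 Z) := ha
  rw [sub, Algebra.adjoin_eq_span] at ha'
  clear ha
  induction ha' using Submodule.span_induction with
  | mem a ha' =>
    induction ha' using Submonoid.closure_induction_left with
    | one => exact ⟨one_mem _, one _⟩
    | mul_left x hx y hy ih =>
      obtain ⟨v, hv, rfl⟩ := hx
      obtain ⟨h, ih⟩ := ih
      classical
      rw [← DirectSum.sum_support_decompose 𝒱 v, map_sum, Finset.sum_mul]
      exact Finset.sum_induction _ (fun a => ∃ h, p a h) add' zero fun i _ =>
        ⟨mul_mem (ι_mem_sub (hZ v hv i)) h,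
          ι_mul i _ y h _ (DirectSum.decompose 𝒱 v i).2 (hZ v hv i) ih⟩
  | zero => exact zero
  | add a b _ _ h₁ h₂ => exact add' _ _ h₁ h₂
  | smul r a _ h => exact ⟨Subalgebra.smul_mem _ h.1 r, smul _ _ _ _ h.2⟩

theorem decompose_mem_sub {Z : Submodule ℚ V} (hZ : IsGraded 𝒱 Z) {a : FreeGCA 𝒱}
    (ha : a ∈ sub 𝒱 Z) (n : ℕ) : (DirectSum.decompose (gr 𝒱) a n : FreeGCA 𝒱) ∈ sub 𝒱 Z := by
  induction ha using sub_induction hZ generalizing n with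
  | one _ =>
    rw [DirectSum.decompose_of_mem (gr 𝒱) (SetLike.GradedOne.one_mem (A := gr 𝒱)),
      DirectSum.coe_of_apply]
    split_ifs
    · exact one_mem _
    · exact zero_mem _
  | add a b _ _ _ h₁ h₂ =>
    rw [DirectSum.decompose_add, DirectSum.add_apply, Submodule.coe_add]
    exact add_mem (h₁ n) (h₂ n)
  | smul r a _ _ h =>
    rw [DirectSum.decompose_smul, DirectSum.smul_apply, Submodule.coe_smul]
    exact Subalgebra.smul_mem _ (h n) r
  | ι_mul i v a _ _ hv hvZ h =>
    by_cases hin : i ≤ n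
    · rw [DirectSum.coe_decompose_mul_of_left_mem_of_le (gr 𝒱) (ι_mem_gr hv) hin]
      exact mul_mem (ι_mem_sub hvZ) (h _)
    · rw [DirectSum.coe_decompose_mul_of_left_mem_of_not_le (gr 𝒱) (ι_mem_gr hv) hin]
      exact zero_mem _

theorem isGraded_bot : IsGraded 𝒱 ⊥ := by
  intro v hv i
  rw [Submodule.mem_bot] at hv
  simp [hv]

theorem isGraded_sup {Z Z' : Submodule ℚ V} (hZ : IsGraded 𝒱 Z) (hZ' : IsGraded 𝒱 Z') :
    IsGraded 𝒱 (Z ⊔ Z') := by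
  intro v hv i
  obtain ⟨a, ha, b, hb, rfl⟩ := Submodule.mem_sup.mp hv
  rw [DirectSum.decompose_add, DirectSum.add_apply, Submodule.coe_add]
  exact add_mem (Submodule.mem_sup_left (hZ a ha i)) (Submodule.mem_sup_right (hZ' b hb i))

theorem isGraded_span_singleton {i : ℕ} {v : V} (hv : v ∈ 𝒱 i) :
    IsGraded 𝒱 (Submodule.span ℚ {v}) := by
  intro w hw j
  obtain ⟨r, rfl⟩ := Submodule.mem_span_singleton.mp hw
  rw [DirectSum.decompose_smul, DirectSum.smul_apply, Submodule.coe_smul,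
    DirectSum.decompose_of_mem 𝒱 hv, DirectSum.coe_of_apply]
  refine Submodule.smul_mem _ _ ?_
  split_ifs
  · exact Submodule.mem_span_singleton_self v
  · exact zero_mem _

/-- An element of the subalgebra generated by a directed union lies in one of its terms. -/
theorem exists_mem_sub {Z : Submodule ℚ V} {P : Submodule ℚ V → Prop} (bot : P ⊥)
    (directed : ∀ Y Y', P Y → P Y' → ∃ Y'', P Y'' ∧ Y ≤ Y'' ∧ Y' ≤ Y'')
    (h : ∀ v ∈ Z, ∃ Y, P Y ∧ v ∈ Y) {a : FreeGCA 𝒱} (ha : a ∈ sub 𝒱 Z) :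
    ∃ Y, P Y ∧ a ∈ sub 𝒱 Y := by
  induction ha using Algebra.adjoin_induction with
  | mem a ha =>
    obtain ⟨v, hv, rfl⟩ := ha
    obtain ⟨Y, hY, hvY⟩ := h v hv
    exact ⟨Y, hY, ι_mem_sub hvY⟩
  | algebraMap r => exact ⟨⊥, bot, Subalgebra.algebraMap_mem _ r⟩
  | add a b _ _ h₁ h₂ =>
    obtain ⟨Y, hY, h₁⟩ := h₁
    obtain ⟨Y', hY', h₂⟩ := h₂
    obtain ⟨Y'', hY'', l, l'⟩ := directed _ _ hY hY'
    exact ⟨Y'', hY'', add_mem (sub_mono l h₁) (sub_mono l' h₂)⟩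
  | mul a b _ _ h₁ h₂ =>
    obtain ⟨Y, hY, h₁⟩ := h₁
    obtain ⟨Y', hY', h₂⟩ := h₂
    obtain ⟨Y'', hY'', l, l'⟩ := directed _ _ hY hY'
    exact ⟨Y'', hY'', mul_mem (sub_mono l h₁) (sub_mono l' h₂)⟩

theorem sub_top : sub 𝒱 ⊤ = ⊤ := by
  rw [eq_top_iff]
  rintro a -
  induction a using monomial_induction with
  | one => exact one_mem _
  | add a b h₁ h₂ => exact add_mem h₁ h₂
  | smul r a h => exact Subalgebra.smul_mem _ h r
  | ι_mul i v a hv h => exact mul_mem (ι_mem_sub trivial) h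

end Sub

/-! #### Derivations with constant values on generators -/

section Derivation

variable [DirectSum.Decomposition 𝒱]

/-- A linear form `f` on `V^p` extends to a derivation of `∧V` of degree `-p`. -/
theorem exists_derivation (p : ℕ) (f : Module.Dual ℚ V) (hf : ∀ i ≠ p, ∀ v ∈ 𝒱 i, f v = 0) :
    ∃ del : FreeGCA 𝒱 →ₗ[ℚ] FreeGCA 𝒱, (∀ v, del (ι 𝒱 v) = algebraMap ℚ _ (f v)) ∧
      ∀ a b, del (a * b) = del a * b + (sgn 𝒱 ^ p) a * del b := by
  have hτ : ∀ {n : ℕ} {a : FreeGCA 𝒱}, a ∈ gr 𝒱 n → (sgn 𝒱 ^ p) a = (-1 : ℚ) ^ (p * n) • a :=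
    fun ha => sgn_pow_apply p ha
  generalize sgn 𝒱 ^ p = τ at hτ ⊢
  -- With the twist `τ` and the identity on the diagonal of an upper triangular matrix, the corner
  -- entry of a product obeys the twisted Leibniz rule; that entry is the derivation sought.
  let F : FreeGCA 𝒱 →ₐ[ℚ] Matrix (Fin 2) (Fin 2) (FreeGCA 𝒱) := lift
    { toFun := fun v => !![τ (ι 𝒱 v), algebraMap ℚ _ (f v); 0, ι 𝒱 v]
      map_add' := fun v w => by
        ext i j; fin_cases i <;> fin_cases j <;> simp
      map_smul' := fun r v => by
        ext i j; fin_cases i <;> fin_cases j <;> simp [Algebra.algebraMap_eq_smul_one, mul_smul] }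
    (by
      intro i j v w hv hw
      have key : τ (ι 𝒱 v) * algebraMap ℚ _ (f w) + algebraMap ℚ _ (f v) * ι 𝒱 w =
          (-1 : ℚ) ^ (i * j) • (τ (ι 𝒱 w) * algebraMap ℚ _ (f v) +
            algebraMap ℚ _ (f w) * ι 𝒱 v) := by
        rw [hτ (ι_mem_gr hv), hτ (ι_mem_gr hw)]
        -- Signs need to agree only where `f` can be nonzero, namely in degree `p`.
        have e1 : (-1 : ℚ) ^ (p * i) * f w = (-1 : ℚ) ^ (i * j) * f w := by
          by_cases h : j = p
          · rw [h, mul_comm p]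
          · rw [hf j h w hw]; simp
        have e2 : (-1 : ℚ) ^ (i * j) * (-1 : ℚ) ^ (p * j) * f v = f v := by
          by_cases h : i = p
          · rw [h, ← mul_pow]; simp
          · rw [hf i h v hv]; simp
        simp only [← Algebra.smul_def, ← Algebra.commutes (f v), ← Algebra.commutes (f w), smul_add,
          smul_smul]
        rw [mul_comm (f w), e1, mul_comm (f v), ← mul_assoc, e2, add_comm]
      ext a b
      fin_cases a <;> fin_cases b
      · simpa [Matrix.mul_apply] using congrArg τ (ι_mul_ι hv hw)
      · simpa [Matrix.mul_apply, Algebra.algebraMap_eq_smul_one] using key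
      · simp [Matrix.mul_apply]
      · simpa [Matrix.mul_apply] using ι_mul_ι hv hw)
  have hF : ∀ v, F (ι 𝒱 v) = !![τ (ι 𝒱 v), algebraMap ℚ _ (f v); 0, ι 𝒱 v] :=
    fun v => lift_ι _ _ v
  have h10 : ∀ a, F a 1 0 = 0 ∧ F a 1 1 = a ∧ F a 0 0 = τ a := by
    intro a
    induction a using monomial_induction with
    | one => simp
    | add a b h₁ h₂ => simp [h₁, h₂]
    | smul r a h => simp [h]
    | ι_mul i v a hv h => simp [h, hF, Matrix.mul_apply]
  refine ⟨Matrix.entryLinearMap ℚ (FreeGCA 𝒱) 0 1 ∘ₗ F.toLinearMap, fun v => ?_, fun a b => ?_⟩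
  · simp [hF]
  · simp [Matrix.mul_apply, h10, add_comm]

end Derivation

end FreeGCA
end FreeGCALemmas

/-! ### Ring and module structures on `∧V ⊗ ∧U`. -/

section Instances

variable {V : Type u} [AddCommGroup V] [Module ℚ V] (𝒱 : ℕ → Submodule ℚ V)
  {U : Type v} [AddCommGroup U] [Module ℚ U] (𝒰 : ℕ → Submodule ℚ U)
  [DirectSum.Decomposition 𝒱] [DirectSum.Decomposition 𝒰]

scoped instance : Ring (Extension 𝒱 𝒰) := inferInstance

scoped instance : Semiring (Extension 𝒱 𝒰) := inferInstance

scoped instance : AddCommGroup (Extension 𝒱 𝒰) := inferInstance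

scoped instance : AddCommMonoid (Extension 𝒱 𝒰) := inferInstance

scoped instance : Algebra ℚ (Extension 𝒱 𝒰) := inferInstance

scoped instance : Module ℚ (Extension 𝒱 𝒰) := inferInstance

end Instances

/-! ### The differential of `∧V` against the bracket pairing, and the components of `D` along `∧V`.
-/

section ExtensionLemmas

variable {V : Type u} [AddCommGroup V] [Module ℚ V] {𝒱 : ℕ → Submodule ℚ V}

open MinimalSullivanAlgebra (degSign degSign_apply)

/-! ### The differential of `∧V` and the pairing -/

section Pairing

variable [DirectSum.Decomposition 𝒱]

theorem IsDifferential.map_one {A : Type*} [Ring A] [Algebra ℚ A] {𝒜 : ℕ → Submodule ℚ A}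
    [SetLike.GradedMonoid 𝒜] {d : A →ₗ[ℚ] A} (hd : IsDifferential 𝒜 d) : d 1 = 0 := by
  have h := hd.leibniz 0 1 1 SetLike.GradedOne.one_mem
  simpa using h

/-- All entries being known functionals, multiplicativity of `pairingHom` becomes the product rule
`pairing_mul`, whose terms are the ways of distributing the two letters between the two factors. -/
theorem pairingHom_apply {p q : ℕ} (x : lie 𝒱 p) (y : lie 𝒱 q) (a : FreeGCA 𝒱) :
    pairingHom x y a = !![FreeGCA.aug 𝒱 a, FreeGCA.ev 𝒱 x.1 a, FreeGCA.ev 𝒱 y.1 a, pairing x y a;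
      0, FreeGCA.aug 𝒱 a, 0, (-1 : ℚ) ^ ((p + 1) * (q + 1)) * FreeGCA.ev 𝒱 y.1 a;
      0, 0, FreeGCA.aug 𝒱 a, FreeGCA.ev 𝒱 x.1 a; 0, 0, 0, FreeGCA.aug 𝒱 a] := by
  have h : ∀ a, pairing x y a = pairingHom x y a 0 3 := fun _ => rfl
  induction a using FreeGCA.monomial_induction with
  | one =>
    ext i j
    fin_cases i <;> fin_cases j <;> simp [h, FreeGCA.ev_one]
  | add a b h₁ h₂ =>
    rw [map_add, h₁, h₂]
    ext i j
    fin_cases i <;> fin_cases j <;> simp [mul_add]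
  | smul r a ih =>
    rw [map_smul, ih]
    ext i j
    fin_cases i <;> fin_cases j <;> simp [mul_left_comm]
  | ι_mul i v a hv ih =>
    have hm : pairingHom x y (FreeGCA.ι 𝒱 v) = pairingMatrix p q x.1 y.1 v := by
      simp [pairingHom]
    have e : pairingHom x y (FreeGCA.ι 𝒱 v * a) = pairingMatrix p q x.1 y.1 v *
      pairingHom x y a := by rw [map_mul, hm]
    have e' := e
    rw [ih] at e
    ext i j
    fin_cases i <;> fin_cases j <;>
      simp [h, e, Matrix.mul_apply, Fin.sum_univ_four, pairingMatrix, FreeGCA.ev_mul,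
        FreeGCA.ev_ι, FreeGCA.aug_ι] <;> ring

theorem pairing_mul {p q : ℕ} (x : lie 𝒱 p) (y : lie 𝒱 q) (a b : FreeGCA 𝒱) :
    pairing x y (a * b) = FreeGCA.aug 𝒱 a * pairing x y b +
      (-1 : ℚ) ^ ((p + 1) * (q + 1)) * FreeGCA.ev 𝒱 x.1 a * FreeGCA.ev 𝒱 y.1 b +
      FreeGCA.ev 𝒱 y.1 a * FreeGCA.ev 𝒱 x.1 b + pairing x y a * FreeGCA.aug 𝒱 b := by
  have h : pairing x y (a * b) = (pairingHom x y a * pairingHom x y b) 0 3 := by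
    rw [← map_mul]; rfl
  rw [h, pairingHom_apply, pairingHom_apply]
  simp [Matrix.mul_apply, Fin.sum_univ_four]
  ring

namespace MinimalSullivanAlgebra

variable (S : MinimalSullivanAlgebra 𝒱)

theorem d_ι_mul {i : ℕ} {v : V} (hv : v ∈ 𝒱 i) (a : FreeGCA 𝒱) :
    S.d (FreeGCA.ι 𝒱 v * a) = S.d (FreeGCA.ι 𝒱 v) * a + (-1 : ℚ) ^ i • (FreeGCA.ι 𝒱 v * S.d a) :=
  S.isDifferential.leibniz i _ _ (FreeGCA.ι_mem_gr hv)

theorem aug_d (a : FreeGCA 𝒱) : FreeGCA.aug 𝒱 (S.d a) = 0 := by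
  induction a using FreeGCA.monomial_induction with
  | one => rw [S.isDifferential.map_one, map_zero]
  | add a b h₁ h₂ => rw [map_add, map_add, h₁, h₂, add_zero]
  | smul r a h => rw [map_smul, map_smul, h, smul_zero]
  | ι_mul i v a hv h =>
    rw [S.d_ι_mul hv, map_add, map_mul, map_smul, map_mul,
      FreeGCA.aug_of_mem_wedgeGE (S.minimal v), h]
    simp

theorem lin_d (a : FreeGCA 𝒱) : FreeGCA.lin 𝒱 (S.d a) = 0 := by
  induction a using FreeGCA.monomial_induction with
  | one => rw [S.isDifferential.map_one, map_zero]
  | add a b h₁ h₂ => rw [map_add, map_add, h₁, h₂, add_zero]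
  | smul r a h => rw [map_smul, map_smul, h, smul_zero]
  | ι_mul i v a hv h =>
    rw [S.d_ι_mul hv, map_add, map_smul, FreeGCA.lin_mul, FreeGCA.lin_mul, h, S.aug_d, S.aug_d,
      FreeGCA.lin_of_mem_wedgeGE (S.minimal v), FreeGCA.aug_ι]
    simp

theorem ev_d (f : Module.Dual ℚ V) (a : FreeGCA 𝒱) : FreeGCA.ev 𝒱 f (S.d a) = 0 := by
  rw [FreeGCA.ev_eq, lin_d, map_zero]

/-- On generators this is the definition of the bracket. It propagates to products because `d` has
neither constant nor linear part, so that all cross terms of the Leibniz and product rules vanish.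
-/
theorem pairing_d {p q : ℕ} (x : lie 𝒱 p) (y : lie 𝒱 q) (a : FreeGCA 𝒱) :
    pairing x y (S.d a) = (-1 : ℚ) ^ (q + 1) * FreeGCA.ev 𝒱 (S.bracket x y).1 a := by
  induction a using FreeGCA.monomial_induction with
  | one => rw [S.isDifferential.map_one, map_zero, FreeGCA.ev_one, mul_zero]
  | add a b h₁ h₂ => rw [map_add, map_add, h₁, h₂, map_add, mul_add]
  | smul r a h => rw [map_smul, map_smul, h, map_smul, smul_eq_mul, smul_eq_mul, mul_left_comm]
  | ι_mul i v a hv h =>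
    have e : (-1 : ℚ) ^ (q + 1) * (-1 : ℚ) ^ (q + 1) = 1 := by rw [← mul_pow]; simp
    rw [S.d_ι_mul hv, map_add, map_smul, pairing_mul, pairing_mul, S.aug_d, S.aug_d, S.ev_d,
      S.ev_d, S.ev_d, S.ev_d, FreeGCA.aug_ι, FreeGCA.ev_mul, FreeGCA.ev_ι _ v, FreeGCA.ev_ι _ v,
      FreeGCA.ev_ι _ v, FreeGCA.aug_ι]
    change _ = (-1 : ℚ) ^ (q + 1) * (0 * _ + FreeGCA.aug 𝒱 a * ((-1 : ℚ) ^ (q + 1) *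
      pairing x y (S.d (FreeGCA.ι 𝒱 v))))
    simp only [zero_mul, mul_zero, zero_add, add_zero, smul_eq_mul]
    linear_combination (-pairing x y (S.d (FreeGCA.ι 𝒱 v)) * FreeGCA.aug 𝒱 a) * e

end MinimalSullivanAlgebra

end Pairing

/-! ### The algebra `∧V ⊗ ∧U` -/

variable {U : Type v} [AddCommGroup U] [Module ℚ U] {𝒰 : ℕ → Submodule ℚ U}
  [DirectSum.Decomposition 𝒱] [DirectSum.Decomposition 𝒰]

namespace Extension

theorem smul_tmul (r : ℚ) (a : FreeGCA 𝒱) (b : FreeGCA 𝒰) :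
    ((r • a) ᵍ⊗ₜ[ℚ] b : Extension 𝒱 𝒰) = r • (a ᵍ⊗ₜ[ℚ] b) := rfl

theorem tmul_smul (r : ℚ) (a : FreeGCA 𝒱) (b : FreeGCA 𝒰) :
    (a ᵍ⊗ₜ[ℚ] (r • b) : Extension 𝒱 𝒰) = r • (a ᵍ⊗ₜ[ℚ] b) :=
  TensorProduct.tmul_smul r a b

theorem tmul_add (a : FreeGCA 𝒱) (b b' : FreeGCA 𝒰) :
    (a ᵍ⊗ₜ[ℚ] (b + b') : Extension 𝒱 𝒰) = a ᵍ⊗ₜ[ℚ] b + a ᵍ⊗ₜ[ℚ] b' :=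
  TensorProduct.tmul_add a b b'

theorem add_tmul (a a' : FreeGCA 𝒱) (b : FreeGCA 𝒰) :
    ((a + a') ᵍ⊗ₜ[ℚ] b : Extension 𝒱 𝒰) = a ᵍ⊗ₜ[ℚ] b + a' ᵍ⊗ₜ[ℚ] b :=
  TensorProduct.add_tmul a a' b

theorem tmul_mul_tmul {i j : ℕ} (a a' : FreeGCA 𝒱) (b b' : FreeGCA 𝒰) (hb : b ∈ FreeGCA.gr 𝒰 j)
    (ha' : a' ∈ FreeGCA.gr 𝒱 i) : (a ᵍ⊗ₜ[ℚ] b * a' ᵍ⊗ₜ[ℚ] b' : Extension 𝒱 𝒰) =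
      (-1 : ℚ) ^ (j * i) • ((a * a') ᵍ⊗ₜ[ℚ] (b * b')) := by
  have h := GradedTensorProduct.tmul_coe_mul_coe_tmul (R := ℚ) (FreeGCA.gr 𝒱) (FreeGCA.gr 𝒰) a
    ⟨b, hb⟩ ⟨a', ha'⟩ b'
  rw [h, Units.smul_def, ← Int.cast_smul_eq_zsmul ℚ]
  congr 1
  simp

theorem tmul_mul_one_tmul (a : FreeGCA 𝒱) (b b' : FreeGCA 𝒰) :
    (a ᵍ⊗ₜ[ℚ] b * 1 ᵍ⊗ₜ[ℚ] b' : Extension 𝒱 𝒰) = a ᵍ⊗ₜ[ℚ] (b * b') := by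
  induction b using FreeGCA.grade_induction with
  | add b c h₁ h₂ => rw [tmul_add, add_mul, h₁, h₂, add_mul, tmul_add]
  | homog n b hb =>
    exact GradedTensorProduct.tmul_coe_mul_one_tmul (R := ℚ) (FreeGCA.gr 𝒱) (FreeGCA.gr 𝒰) a
      ⟨b, hb⟩ b'

theorem tmul_one_mul_tmul (a a' : FreeGCA 𝒱) (b' : FreeGCA 𝒰) :
    (a ᵍ⊗ₜ[ℚ] 1 * a' ᵍ⊗ₜ[ℚ] b' : Extension 𝒱 𝒰) = (a * a') ᵍ⊗ₜ[ℚ] b' := by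
  induction a' using FreeGCA.grade_induction with
  | add b c h₁ h₂ => rw [add_tmul, mul_add, h₁, h₂, mul_add, add_tmul]
  | homog n b hb =>
    exact GradedTensorProduct.tmul_one_mul_coe_tmul (R := ℚ) (FreeGCA.gr 𝒱) (FreeGCA.gr 𝒰) a
      ⟨b, hb⟩ b'

theorem tmul_eq_mul (a : FreeGCA 𝒱) (b : FreeGCA 𝒰) :
    (a ᵍ⊗ₜ[ℚ] b : Extension 𝒱 𝒰) = a ᵍ⊗ₜ[ℚ] 1 * 1 ᵍ⊗ₜ[ℚ] b := by
  rw [tmul_mul_one_tmul, one_mul]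

/-- Induction on pure tensors. -/
@[elab_as_elim]
theorem tmul_induction {p : Extension 𝒱 𝒰 → Prop} (add : ∀ z w, p z → p w → p (z + w))
    (tmul : ∀ (a : FreeGCA 𝒱) (b : FreeGCA 𝒰), p (a ᵍ⊗ₜ[ℚ] b)) (z : Extension 𝒱 𝒰) : p z :=
  TensorProduct.induction_on (motive := fun z => p (GradedTensorProduct.of ℚ _ _ z))
    ((GradedTensorProduct.of ℚ (FreeGCA.gr 𝒱) (FreeGCA.gr 𝒰)).symm z)
    (by have h := tmul 0 0; rwa [GradedTensorProduct.tmul, TensorProduct.zero_tmul] at h) tmul (fun z w => add _ _)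

/-- Induction on homogeneous pure tensors. -/
@[elab_as_elim]
theorem homog_induction {p : Extension 𝒱 𝒰 → Prop} (add : ∀ z w, p z → p w → p (z + w))
    (tmul : ∀ (i j : ℕ) (a : FreeGCA 𝒱) (b : FreeGCA 𝒰), a ∈ FreeGCA.gr 𝒱 i → b ∈ FreeGCA.gr 𝒰 j →
      p (a ᵍ⊗ₜ[ℚ] b)) (z : Extension 𝒱 𝒰) : p z := by
  induction z using tmul_induction with
  | add z w h₁ h₂ => exact add _ _ h₁ h₂
  | tmul a b =>
    induction a using FreeGCA.grade_induction with
    | add a a' h₁ h₂ => rw [add_tmul]; exact add _ _ h₁ h₂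
    | homog n a ha =>
      induction b using FreeGCA.grade_induction with
      | add a a' h₁ h₂ => rw [tmul_add]; exact add _ _ h₁ h₂
      | homog m b hb => exact tmul _ _ _ _ ha hb

theorem tmul_mem_gr {i j : ℕ} {a : FreeGCA 𝒱} {b : FreeGCA 𝒰} (ha : a ∈ FreeGCA.gr 𝒱 i)
    (hb : b ∈ FreeGCA.gr 𝒰 j) : (a ᵍ⊗ₜ[ℚ] b : Extension 𝒱 𝒰) ∈ gr 𝒱 𝒰 (i + j) :=
  Submodule.subset_span ⟨i, j, a, b, rfl, ha, hb, rfl⟩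

theorem one_tmul_mem_gr {j : ℕ} {b : FreeGCA 𝒰}
    (hb : b ∈ FreeGCA.gr 𝒰 j) : (1 ᵍ⊗ₜ[ℚ] b : Extension 𝒱 𝒰) ∈ gr 𝒱 𝒰 j := by
  simpa using tmul_mem_gr (SetLike.GradedOne.one_mem (A := FreeGCA.gr 𝒱)) hb

theorem tmul_one_mem_gr {i : ℕ} {a : FreeGCA 𝒱}
    (ha : a ∈ FreeGCA.gr 𝒱 i) : (a ᵍ⊗ₜ[ℚ] 1 : Extension 𝒱 𝒰) ∈ gr 𝒱 𝒰 i := by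
  simpa using tmul_mem_gr ha (SetLike.GradedOne.one_mem (A := FreeGCA.gr 𝒰))

/-! #### The sign automorphism -/

variable (𝒱 𝒰) in
/-- The automorphism `z ↦ (-1)^{deg z} z` of `∧V ⊗ ∧U`. -/
def sgn : Extension 𝒱 𝒰 →ₐ[ℚ] Extension 𝒱 𝒰 :=
  GradedTensorProduct.lift _ _
    ((GradedTensorProduct.includeLeft (FreeGCA.gr 𝒱) (FreeGCA.gr 𝒰)).comp (FreeGCA.sgn 𝒱))
    ((GradedTensorProduct.includeRight (FreeGCA.gr 𝒱) (FreeGCA.gr 𝒰)).comp (FreeGCA.sgn 𝒰)) (by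
    rintro i j ⟨a, ha⟩ ⟨b, hb⟩
    change (FreeGCA.sgn 𝒱 a) ᵍ⊗ₜ[ℚ] 1 * 1 ᵍ⊗ₜ[ℚ] (FreeGCA.sgn 𝒰 b) = (-1 : ℤˣ) ^ (j * i) •
      (1 ᵍ⊗ₜ[ℚ] (FreeGCA.sgn 𝒰 b) * (FreeGCA.sgn 𝒱 a) ᵍ⊗ₜ[ℚ] 1)
    rw [tmul_mul_tmul _ _ _ _ (FreeGCA.sgn_mem hb) (FreeGCA.sgn_mem ha), ← tmul_eq_mul,
      Units.smul_def, ← Int.cast_smul_eq_zsmul ℚ, smul_smul]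
    simp [← mul_pow])

theorem sgn_tmul (a : FreeGCA 𝒱) (b : FreeGCA 𝒰) :
    sgn 𝒱 𝒰 (a ᵍ⊗ₜ[ℚ] b) = (FreeGCA.sgn 𝒱 a) ᵍ⊗ₜ[ℚ] (FreeGCA.sgn 𝒰 b) := by
  rw [sgn, GradedTensorProduct.lift_tmul]
  exact (tmul_eq_mul _ _).symm

theorem sgn_apply {n : ℕ} {z : Extension 𝒱 𝒰} (hz : z ∈ gr 𝒱 𝒰 n) :
    sgn 𝒱 𝒰 z = (-1 : ℚ) ^ n • z := by
  induction hz using Submodule.span_induction with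
  | mem z hz =>
    obtain ⟨i, j, a, b, rfl, ha, hb, rfl⟩ := hz
    rw [sgn_tmul, FreeGCA.sgn_apply ha, FreeGCA.sgn_apply hb, smul_tmul, tmul_smul, smul_smul,
      pow_add]
  | zero => simp
  | add z w _ _ h₁ h₂ => rw [map_add, h₁, h₂, smul_add]
  | smul r z _ h => rw [map_smul, h, smul_comm]

theorem sgn_sgn (z : Extension 𝒱 𝒰) : sgn 𝒱 𝒰 (sgn 𝒱 𝒰 z) = z := by
  induction z using tmul_induction with
  | add z w h₁ h₂ => rw [map_add, map_add, h₁, h₂]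
  | tmul a b => rw [sgn_tmul, sgn_tmul, FreeGCA.sgn_sgn, FreeGCA.sgn_sgn]

theorem leibniz {D : Extension 𝒱 𝒰 →ₗ[ℚ] Extension 𝒱 𝒰} (hD : IsDifferential (gr 𝒱 𝒰) D)
    (z w : Extension 𝒱 𝒰) : D (z * w) = D z * w + sgn 𝒱 𝒰 z * D w := by
  induction z using homog_induction with
  | add z z' h₁ h₂ => rw [add_mul, map_add, h₁, h₂, map_add, map_add, add_mul, add_mul]; abel
  | tmul i j a b ha hb =>
    rw [hD.leibniz _ _ _ (tmul_mem_gr ha hb), sgn_apply (tmul_mem_gr ha hb), smul_mul_assoc]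

theorem D_sgn {D : Extension 𝒱 𝒰 →ₗ[ℚ] Extension 𝒱 𝒰} (hD : IsDifferential (gr 𝒱 𝒰) D)
    (z : Extension 𝒱 𝒰) : D (sgn 𝒱 𝒰 z) = -sgn 𝒱 𝒰 (D z) := by
  induction z using homog_induction with
  | add z z' h₁ h₂ => rw [map_add, map_add, h₁, h₂, map_add, map_add]; abel
  | tmul i j a b ha hb =>
    rw [sgn_apply (tmul_mem_gr ha hb), sgn_apply (hD.degree _ _ (tmul_mem_gr ha hb)), map_smul,
      pow_succ]
    simp

/-! #### Slant products -/

theorem slant_tmul (f : FreeGCA 𝒱 →ₗ[ℚ] ℚ) (a : FreeGCA 𝒱) (b : FreeGCA 𝒰) :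
    slant 𝒱 𝒰 f (a ᵍ⊗ₜ[ℚ] b) = f a • b := rfl

theorem slant_mul_one_tmul (f : FreeGCA 𝒱 →ₗ[ℚ] ℚ) (z : Extension 𝒱 𝒰) (b : FreeGCA 𝒰) :
    slant 𝒱 𝒰 f (z * 1 ᵍ⊗ₜ[ℚ] b) = slant 𝒱 𝒰 f z * b := by
  induction z using tmul_induction with
  | add z w h₁ h₂ => rw [add_mul, map_add, h₁, h₂, map_add, add_mul]
  | tmul a c => rw [tmul_mul_one_tmul, slant_tmul, slant_tmul, smul_mul_assoc]

/-- Linear forms on `∧V` which vanish outside degree `i`. -/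
def IsConcentrated (f : FreeGCA 𝒱 →ₗ[ℚ] ℚ) (i : ℕ) : Prop :=
  ∀ n ≠ i, ∀ a ∈ FreeGCA.gr 𝒱 n, f a = 0

theorem isConcentrated_aug : IsConcentrated (FreeGCA.aug 𝒱).toLinearMap 0 :=
  fun _ hn _ ha => FreeGCA.aug_eq_zero hn ha

theorem isConcentrated_ev {p : ℕ} (x : lie 𝒱 p) : IsConcentrated (FreeGCA.ev 𝒱 x.1) (p + 1) :=
  fun _ hn _ ha => FreeGCA.ev_eq_zero x ha hn

/-- Only the part of `z` of degree `i` in `∧V` contributes, and moving `b` past it costs `(-1)^{i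
deg b}`. -/
theorem slant_one_tmul_mul {f : FreeGCA 𝒱 →ₗ[ℚ] ℚ} {i : ℕ} (hf : IsConcentrated f i)
    (b : FreeGCA 𝒰) (z : Extension 𝒱 𝒰) :
    slant 𝒱 𝒰 f (1 ᵍ⊗ₜ[ℚ] b * z) = (FreeGCA.sgn 𝒰 ^ i) b * slant 𝒱 𝒰 f z := by
  induction z using homog_induction with
  | add z w h₁ h₂ => rw [mul_add, map_add, h₁, h₂, map_add, mul_add]
  | tmul k j a c ha hc =>
    induction b using FreeGCA.grade_induction with
    | add b b' h₁ h₂ => rw [tmul_add, add_mul, map_add, h₁, h₂, map_add, add_mul]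
    | homog n b hb =>
      rw [tmul_mul_tmul _ _ _ _ hb ha, map_smul, slant_tmul, slant_tmul, one_mul]
      by_cases h : k = i
      · rw [h, FreeGCA.sgn_pow_apply i hb, smul_mul_assoc, mul_smul_comm, mul_comm n]
      · rw [hf k h a ha]; simp

theorem slant_mem_gr {f : FreeGCA 𝒱 →ₗ[ℚ] ℚ} {i : ℕ} (hf : IsConcentrated f i) {n : ℕ}
    {z : Extension 𝒱 𝒰} (hz : z ∈ gr 𝒱 𝒰 (i + n)) : slant 𝒱 𝒰 f z ∈ FreeGCA.gr 𝒰 n := by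
  induction hz using Submodule.span_induction with
  | mem z hz =>
    obtain ⟨k, j, a, b, hkj, ha, hb, rfl⟩ := hz
    rw [slant_tmul]
    by_cases h : k = i
    · obtain rfl : j = n := by omega
      exact Submodule.smul_mem _ _ hb
    · rw [hf k h a ha, zero_smul]; exact zero_mem _
  | zero => rw [map_zero]; exact zero_mem _
  | add z w _ _ h₁ h₂ => rw [map_add]; exact add_mem h₁ h₂
  | smul r z _ h => rw [map_smul]; exact Submodule.smul_mem _ _ h

theorem slant_eq_zero {f : FreeGCA 𝒱 →ₗ[ℚ] ℚ} {i : ℕ} (hf : IsConcentrated f i) {n : ℕ}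
    (hn : n < i) {z : Extension 𝒱 𝒰} (hz : z ∈ gr 𝒱 𝒰 n) : slant 𝒱 𝒰 f z = 0 := by
  induction hz using Submodule.span_induction with
  | mem z hz =>
    obtain ⟨k, j, a, b, hkj, ha, hb, rfl⟩ := hz
    rw [slant_tmul, hf k (by omega) a ha, zero_smul]
  | zero => rw [map_zero]
  | add z w _ _ h₁ h₂ => rw [map_add, h₁, h₂, add_zero]
  | smul r z _ h => rw [map_smul, h, smul_zero]

theorem slant_mem_sub (f : FreeGCA 𝒱 →ₗ[ℚ] ℚ) {Z : Submodule ℚ U} {z : Extension 𝒱 𝒰}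
    (hz : z ∈ sub 𝒱 𝒰 Z) : slant 𝒱 𝒰 f z ∈ FreeGCA.sub 𝒰 Z := by
  induction hz using Submodule.span_induction with
  | mem z hz =>
    obtain ⟨a, b, hb, rfl⟩ := hz
    exact Subalgebra.smul_mem _ hb _
  | zero => rw [map_zero]; exact zero_mem _
  | add z w _ _ h₁ h₂ => rw [map_add]; exact add_mem h₁ h₂
  | smul r z _ h => rw [map_smul]; exact Subalgebra.smul_mem _ h _

theorem slant_aug_tmul_one_mul (a : FreeGCA 𝒱) (z : Extension 𝒱 𝒰) :
    slant 𝒱 𝒰 (FreeGCA.aug 𝒱).toLinearMap (a ᵍ⊗ₜ[ℚ] 1 * z) =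
      FreeGCA.aug 𝒱 a • slant 𝒱 𝒰 (FreeGCA.aug 𝒱).toLinearMap z := by
  induction z using tmul_induction with
  | add z w h₁ h₂ => rw [mul_add, map_add, h₁, h₂, map_add, smul_add]
  | tmul a' b => rw [tmul_one_mul_tmul, slant_tmul, slant_tmul, smul_smul]; simp

theorem slant_ev_tmul_one_mul (f : Module.Dual ℚ V) (a : FreeGCA 𝒱) (z : Extension 𝒱 𝒰) :
    slant 𝒱 𝒰 (FreeGCA.ev 𝒱 f) (a ᵍ⊗ₜ[ℚ] 1 * z) =
      FreeGCA.aug 𝒱 a • slant 𝒱 𝒰 (FreeGCA.ev 𝒱 f) z +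
      FreeGCA.ev 𝒱 f a • slant 𝒱 𝒰 (FreeGCA.aug 𝒱).toLinearMap z := by
  induction z using tmul_induction with
  | add z w h₁ h₂ => rw [mul_add, map_add, h₁, h₂, map_add, map_add]; simp only [smul_add]; abel
  | tmul a' b =>
    rw [tmul_one_mul_tmul, slant_tmul, slant_tmul, slant_tmul, smul_smul, smul_smul,
      FreeGCA.ev_mul, add_smul, mul_comm (FreeGCA.aug 𝒱 a')]
    rfl

theorem slant_pairing_tmul_one_mul {p q : ℕ} (x : lie 𝒱 p) (y : lie 𝒱 q) (a : FreeGCA 𝒱)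
    (z : Extension 𝒱 𝒰) : slant 𝒱 𝒰 (pairing x y) (a ᵍ⊗ₜ[ℚ] 1 * z) =
      FreeGCA.aug 𝒱 a • slant 𝒱 𝒰 (pairing x y) z +
      ((-1 : ℚ) ^ ((p + 1) * (q + 1)) * FreeGCA.ev 𝒱 x.1 a) • slant 𝒱 𝒰 (FreeGCA.ev 𝒱 y.1) z +
      FreeGCA.ev 𝒱 y.1 a • slant 𝒱 𝒰 (FreeGCA.ev 𝒱 x.1) z +
      pairing x y a • slant 𝒱 𝒰 (FreeGCA.aug 𝒱).toLinearMap z := by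
  induction z using tmul_induction with
  | add z w h₁ h₂ =>
    rw [mul_add, map_add, h₁, h₂, map_add, map_add, map_add, map_add]; simp only [smul_add]; abel
  | tmul a' b =>
    simp only [tmul_one_mul_tmul, slant_tmul, smul_smul]
    rw [pairing_mul, add_smul, add_smul, add_smul]
    rfl

/-! #### The components of the differential -/

section Component

variable {S : MinimalSullivanAlgebra 𝒱} {D : Extension 𝒱 𝒰 →ₗ[ℚ] Extension 𝒱 𝒰}

theorem component_apply (f : FreeGCA 𝒱 →ₗ[ℚ] ℚ) (Φ : FreeGCA 𝒰) :
    component D f Φ = slant 𝒱 𝒰 f (D (1 ᵍ⊗ₜ[ℚ] Φ)) := rfl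

theorem quotientDifferential_apply (Φ : FreeGCA 𝒰) :
    quotientDifferential D Φ = slant 𝒱 𝒰 (FreeGCA.aug 𝒱).toLinearMap (D (1 ᵍ⊗ₜ[ℚ] Φ)) := rfl

theorem one_tmul_mul (b b' : FreeGCA 𝒰) :
    (1 ᵍ⊗ₜ[ℚ] (b * b') : Extension 𝒱 𝒰) = 1 ᵍ⊗ₜ[ℚ] b * 1 ᵍ⊗ₜ[ℚ] b' :=
  (tmul_mul_one_tmul _ _ _).symm

theorem D_one_tmul_mul (hD : IsDifferential (gr 𝒱 𝒰) D) (Φ Ψ : FreeGCA 𝒰) :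
    D (1 ᵍ⊗ₜ[ℚ] (Φ * Ψ)) = D (1 ᵍ⊗ₜ[ℚ] Φ) * 1 ᵍ⊗ₜ[ℚ] Ψ +
      1 ᵍ⊗ₜ[ℚ] (FreeGCA.sgn 𝒰 Φ) * D (1 ᵍ⊗ₜ[ℚ] Ψ) := by
  rw [one_tmul_mul, leibniz hD, sgn_tmul, map_one]

/-- One sign comes from `D` passing `Φ`, and `i` more from `Φ` passing the factor in `∧V`; hence the
exponent `i + 1`. -/
theorem component_mul (hD : IsDifferential (gr 𝒱 𝒰) D) {f : FreeGCA 𝒱 →ₗ[ℚ] ℚ} {i : ℕ}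
    (hf : IsConcentrated f i) (Φ Ψ : FreeGCA 𝒰) :
    component D f (Φ * Ψ) =
      component D f Φ * Ψ + (FreeGCA.sgn 𝒰 ^ (i + 1)) Φ * component D f Ψ := by
  rw [component_apply, D_one_tmul_mul hD, map_add, slant_mul_one_tmul, slant_one_tmul_mul hf,
    pow_succ]
  rfl

theorem component_mem_gr (hD : IsDifferential (gr 𝒱 𝒰) D) {f : FreeGCA 𝒱 →ₗ[ℚ] ℚ} {i : ℕ}
    (hf : IsConcentrated f i) {n m : ℕ} (h : n + 1 = i + m) {Φ : FreeGCA 𝒰}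
    (hΦ : Φ ∈ FreeGCA.gr 𝒰 n) : component D f Φ ∈ FreeGCA.gr 𝒰 m :=
  slant_mem_gr hf (h ▸ hD.degree _ _ (one_tmul_mem_gr hΦ))

theorem component_eq_zero (hD : IsDifferential (gr 𝒱 𝒰) D) {f : FreeGCA 𝒱 →ₗ[ℚ] ℚ} {i : ℕ}
    (hf : IsConcentrated f i) {n : ℕ} (h : n + 1 < i) {Φ : FreeGCA 𝒰}
    (hΦ : Φ ∈ FreeGCA.gr 𝒰 n) : component D f Φ = 0 :=
  slant_eq_zero hf h (hD.degree _ _ (one_tmul_mem_gr hΦ))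

theorem D_tmul (hD : IsAcyclicClosure S D) (a : FreeGCA 𝒱) (b : FreeGCA 𝒰) :
    D (a ᵍ⊗ₜ[ℚ] b) = S.d a ᵍ⊗ₜ[ℚ] b + (FreeGCA.sgn 𝒱 a) ᵍ⊗ₜ[ℚ] 1 * D (1 ᵍ⊗ₜ[ℚ] b) := by
  rw [tmul_eq_mul, leibniz hD.isDifferential, hD.base, ← tmul_eq_mul, sgn_tmul, map_one]

theorem slant_aug_D (hD : IsAcyclicClosure S D) (z : Extension 𝒱 𝒰) :
    slant 𝒱 𝒰 (FreeGCA.aug 𝒱).toLinearMap (D z) =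
      quotientDifferential D (slant 𝒱 𝒰 (FreeGCA.aug 𝒱).toLinearMap z) := by
  induction z using tmul_induction with
  | add z w h₁ h₂ => simp only [map_add, h₁, h₂]
  | tmul a b =>
    rw [D_tmul hD, map_add, slant_tmul, slant_tmul, slant_aug_tmul_one_mul, map_smul,
      quotientDifferential_apply]
    have h1 := S.aug_d a
    have h2 := FreeGCA.aug_sgn_pow 1 a
    rw [pow_one] at h2
    simp [h1, h2]

theorem ev_sgn {p : ℕ} (x : lie 𝒱 p) (a : FreeGCA 𝒱) :
    FreeGCA.ev 𝒱 x.1 (FreeGCA.sgn 𝒱 a) = (-1 : ℚ) ^ (p + 1) * FreeGCA.ev 𝒱 x.1 a := by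
  induction a using FreeGCA.grade_induction with
  | add a b h₁ h₂ => rw [map_add, map_add, h₁, h₂, map_add, mul_add]
  | homog n a ha =>
    rw [FreeGCA.sgn_apply ha, map_smul, smul_eq_mul]
    by_cases h : n = p + 1
    · rw [h]
    · rw [FreeGCA.ev_eq_zero x ha h]; simp

/-- A linear form on `V` does not see `d`, which has no linear part. For `z = D(1 ⊗ Φ)` and `D² = 0`
the identity says that the quotient differential commutes with `θ_x` up to sign. -/
theorem slant_ev_D (hD : IsAcyclicClosure S D) {p : ℕ} (x : lie 𝒱 p) (z : Extension 𝒱 𝒰) :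
    slant 𝒱 𝒰 (FreeGCA.ev 𝒱 x.1) (D z) =
      component D (FreeGCA.ev 𝒱 x.1) (slant 𝒱 𝒰 (FreeGCA.aug 𝒱).toLinearMap z) +
      (-1 : ℚ) ^ (p + 1) • quotientDifferential D (slant 𝒱 𝒰 (FreeGCA.ev 𝒱 x.1) z) := by
  induction z using tmul_induction with
  | add z w h₁ h₂ => simp only [map_add, h₁, h₂, smul_add]; abel
  | tmul a b =>
    rw [D_tmul hD, map_add, slant_tmul, slant_tmul, slant_tmul, slant_ev_tmul_one_mul, map_smul,
      map_smul, S.ev_d, ev_sgn, component_apply, quotientDifferential_apply, zero_smul, zero_add,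
      smul_smul]
    have h2 := FreeGCA.aug_sgn_pow 1 a
    rw [pow_one] at h2
    rw [h2]
    rfl

/-- The pairing sees `d` through the bracket, by `pairing_d`; otherwise its two letters are
distributed between `z` and `D`. For `z = D(1 ⊗ Φ)` this becomes the bracket relation for the
holonomy operators. -/
theorem slant_pairing_D (hD : IsAcyclicClosure S D) (h0 : quotientDifferential D = 0) {p q : ℕ}
    (x : lie 𝒱 p) (y : lie 𝒱 q) (z : Extension 𝒱 𝒰) :
    slant 𝒱 𝒰 (pairing x y) (D z) =
      (-1 : ℚ) ^ (q + 1) • slant 𝒱 𝒰 (FreeGCA.ev 𝒱 (S.bracket x y).1) z +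
      component D (pairing x y) (slant 𝒱 𝒰 (FreeGCA.aug 𝒱).toLinearMap z) +
      ((-1 : ℚ) ^ ((p + 1) * (q + 1)) * (-1 : ℚ) ^ (p + 1)) •
        component D (FreeGCA.ev 𝒱 y.1) (slant 𝒱 𝒰 (FreeGCA.ev 𝒱 x.1) z) +
      (-1 : ℚ) ^ (q + 1) •
        component D (FreeGCA.ev 𝒱 x.1) (slant 𝒱 𝒰 (FreeGCA.ev 𝒱 y.1) z) := by
  induction z using tmul_induction with
  | add z w h₁ h₂ => simp only [map_add, h₁, h₂, smul_add]; abel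
  | tmul a b =>
    have h2 := FreeGCA.aug_sgn_pow 1 a
    rw [pow_one] at h2
    have h3 : slant 𝒱 𝒰 (FreeGCA.aug 𝒱).toLinearMap (D (1 ᵍ⊗ₜ[ℚ] b)) = 0 := by
      rw [← quotientDifferential_apply, h0, LinearMap.zero_apply]
    rw [D_tmul hD, map_add, slant_pairing_tmul_one_mul, h2, h3, ev_sgn, ev_sgn]
    simp only [slant_tmul, map_smul, S.pairing_d, smul_smul, component_apply, smul_zero, add_zero,
      AlgHom.toLinearMap_apply, mul_assoc, add_assoc]

end Component

end Extension
end ExtensionLemmas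

/-! ### The complex of indecomposables of `∧V ⊗ ∧U` and the map `δ : U → V`. -/

section Linear

variable {V : Type u} [AddCommGroup V] [Module ℚ V] {𝒱 : ℕ → Submodule ℚ V}
  {U : Type v} [AddCommGroup U] [Module ℚ U] {𝒰 : ℕ → Submodule ℚ U}
  [DirectSum.Decomposition 𝒱] [DirectSum.Decomposition 𝒰]

namespace Extension

/-! ### The linear part of the differential of `∧V ⊗ ∧U` -/

theorem aug_tmul (a : FreeGCA 𝒱) (b : FreeGCA 𝒰) :
    aug 𝒱 𝒰 (a ᵍ⊗ₜ[ℚ] b) = FreeGCA.aug 𝒱 a * FreeGCA.aug 𝒰 b := by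
  change FreeGCA.aug 𝒰 (FreeGCA.aug 𝒱 a • b) = _
  rw [map_smul, smul_eq_mul]

theorem one_eq : (1 : Extension 𝒱 𝒰) = 1 ᵍ⊗ₜ[ℚ] 1 := rfl

theorem aug_one : aug 𝒱 𝒰 1 = 1 := by rw [one_eq, aug_tmul]; simp

theorem aug_mul (z w : Extension 𝒱 𝒰) : aug 𝒱 𝒰 (z * w) = aug 𝒱 𝒰 z * aug 𝒱 𝒰 w := by
  induction z using homog_induction with
  | add z z' h₁ h₂ => rw [add_mul, map_add, h₁, h₂, map_add, add_mul]
  | tmul i j a b ha hb =>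
    induction w using homog_induction with
    | add z z' h₁ h₂ => rw [mul_add, map_add, h₁, h₂, map_add, mul_add]
    | tmul i' j' a' b' ha' hb' =>
      rw [tmul_mul_tmul _ _ _ _ hb ha', map_smul, aug_tmul, aug_tmul, aug_tmul, map_mul, map_mul,
        smul_eq_mul]
      by_cases h : j = 0
      · rw [h]; ring
      · rw [FreeGCA.aug_eq_zero h hb]; ring

variable (𝒱 𝒰) in
/-- The augmentation of `∧V ⊗ ∧U` as a morphism of algebras. -/
def augHom : Extension 𝒱 𝒰 →ₐ[ℚ] ℚ := AlgHom.ofLinearMap (aug 𝒱 𝒰) aug_one aug_mul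

@[simp] theorem augHom_apply (z : Extension 𝒱 𝒰) : augHom 𝒱 𝒰 z = aug 𝒱 𝒰 z := rfl

variable (𝒱 𝒰) in
/-- The projection of `∧V ⊗ ∧U` to `V`. -/
def linV : Extension 𝒱 𝒰 →ₗ[ℚ] V :=
  (TensorProduct.rid ℚ V).toLinearMap ∘ₗ
    TensorProduct.map (FreeGCA.lin 𝒱) (FreeGCA.aug 𝒰).toLinearMap ∘ₗ
    (GradedTensorProduct.of ℚ (FreeGCA.gr 𝒱) (FreeGCA.gr 𝒰)).symm.toLinearMap

variable (𝒱 𝒰) in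
/-- The projection of `∧V ⊗ ∧U` to `U`. -/
def linU : Extension 𝒱 𝒰 →ₗ[ℚ] U :=
  FreeGCA.lin 𝒰 ∘ₗ slant 𝒱 𝒰 (FreeGCA.aug 𝒱).toLinearMap

theorem linV_tmul (a : FreeGCA 𝒱) (b : FreeGCA 𝒰) :
    linV 𝒱 𝒰 (a ᵍ⊗ₜ[ℚ] b) = FreeGCA.aug 𝒰 b • FreeGCA.lin 𝒱 a := rfl

theorem linU_tmul (a : FreeGCA 𝒱) (b : FreeGCA 𝒰) :
    linU 𝒱 𝒰 (a ᵍ⊗ₜ[ℚ] b) = FreeGCA.aug 𝒱 a • FreeGCA.lin 𝒰 b := by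
  rw [linU, LinearMap.comp_apply, slant_tmul, map_smul]
  rfl

theorem linV_mul (z w : Extension 𝒱 𝒰) : linV 𝒱 𝒰 (z * w) =
    aug 𝒱 𝒰 z • linV 𝒱 𝒰 w + aug 𝒱 𝒰 w • linV 𝒱 𝒰 z := by
  induction z using homog_induction with
  | add z z' h₁ h₂ => rw [add_mul, map_add, h₁, h₂, map_add, map_add]; simp only [add_smul, smul_add]; abel
  | tmul i j a b ha hb =>
    induction w using homog_induction with
    | add z z' h₁ h₂ => rw [mul_add, map_add, h₁, h₂, map_add, map_add]; simp only [add_smul, smul_add]; abel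
    | tmul i' j' a' b' ha' hb' =>
      rw [tmul_mul_tmul _ _ _ _ hb ha', map_smul, aug_tmul, aug_tmul, linV_tmul, linV_tmul,
        linV_tmul, map_mul, FreeGCA.lin_mul]
      by_cases h : j = 0
      · rw [h]; simp only [zero_mul, pow_zero, smul_add, smul_smul]
        congr 2 <;> ring
      · rw [FreeGCA.aug_eq_zero h hb]; simp

theorem linU_mul (z w : Extension 𝒱 𝒰) : linU 𝒱 𝒰 (z * w) =
    aug 𝒱 𝒰 z • linU 𝒱 𝒰 w + aug 𝒱 𝒰 w • linU 𝒱 𝒰 z := by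
  induction z using homog_induction with
  | add z z' h₁ h₂ => rw [add_mul, map_add, h₁, h₂, map_add, map_add]; simp only [add_smul, smul_add]; abel
  | tmul i j a b ha hb =>
    induction w using homog_induction with
    | add z z' h₁ h₂ => rw [mul_add, map_add, h₁, h₂, map_add, map_add]; simp only [add_smul, smul_add]; abel
    | tmul i' j' a' b' ha' hb' =>
      rw [tmul_mul_tmul _ _ _ _ hb ha', map_smul, aug_tmul, aug_tmul, linU_tmul, linU_tmul,
        linU_tmul, map_mul, FreeGCA.lin_mul]
      by_cases h : i' = 0
      · rw [h]; simp only [mul_zero, pow_zero, smul_add, smul_smul]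
        congr 2 <;> ring
      · rw [FreeGCA.aug_eq_zero h ha']; simp

theorem ev_linV (f : Module.Dual ℚ V) (z : Extension 𝒱 𝒰) :
    FreeGCA.aug 𝒰 (slant 𝒱 𝒰 (FreeGCA.ev 𝒱 f) z) = f (linV 𝒱 𝒰 z) := by
  induction z using tmul_induction with
  | add z w h₁ h₂ => simp only [map_add, h₁, h₂]
  | tmul a b =>
    rw [slant_tmul, linV_tmul, map_smul, map_smul, FreeGCA.ev_eq, smul_eq_mul, smul_eq_mul, mul_comm]

/-- Induction along products of generators. -/
@[elab_as_elim]
theorem generator_induction {p : Extension 𝒱 𝒰 → Prop} (one : p 1)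
    (add : ∀ z w, p z → p w → p (z + w)) (smul : ∀ (r : ℚ) z, p z → p (r • z))
    (ιV_mul : ∀ (v : V) z, p z → p (FreeGCA.ι 𝒱 v ᵍ⊗ₜ[ℚ] 1 * z))
    (ιU_mul : ∀ (u : U) z, p z → p (1 ᵍ⊗ₜ[ℚ] FreeGCA.ι 𝒰 u * z)) (z : Extension 𝒱 𝒰) : p z := by
  induction z using tmul_induction with
  | add z w h₁ h₂ => exact add _ _ h₁ h₂
  | tmul a b =>
    rw [tmul_eq_mul]
    have hb : p (1 ᵍ⊗ₜ[ℚ] b) := by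
      induction b using FreeGCA.monomial_induction with
      | one => exact one
      | add a b h₁ h₂ => rw [tmul_add]; exact add _ _ h₁ h₂
      | smul r a h => rw [tmul_smul]; exact smul _ _ h
      | ι_mul i u b _ h => rw [one_tmul_mul]; exact ιU_mul _ _ h
    induction a using FreeGCA.monomial_induction with
    | one => rw [← one_eq, one_mul]; exact hb
    | add a b h₁ h₂ => rw [add_tmul, add_mul]; exact add _ _ h₁ h₂
    | smul r a h => rw [smul_tmul, smul_mul_assoc]; exact smul _ _ h
    | ι_mul i v a _ h => rw [← tmul_one_mul_tmul, mul_assoc]; exact ιV_mul _ _ h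

theorem hom_ext {A : Type*} [Semiring A] [Algebra ℚ A] {f g : Extension 𝒱 𝒰 →ₐ[ℚ] A}
    (hV : ∀ v, f (FreeGCA.ι 𝒱 v ᵍ⊗ₜ[ℚ] 1) = g (FreeGCA.ι 𝒱 v ᵍ⊗ₜ[ℚ] 1))
    (hU : ∀ u, f (1 ᵍ⊗ₜ[ℚ] FreeGCA.ι 𝒰 u) = g (1 ᵍ⊗ₜ[ℚ] FreeGCA.ι 𝒰 u)) : f = g := by
  ext z
  induction z using generator_induction with
  | one => rw [map_one, map_one]
  | add z w h₁ h₂ => rw [map_add, map_add, h₁, h₂]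
  | smul r z h => rw [map_smul, map_smul, h]
  | ιV_mul v z h => rw [map_mul, map_mul, h, hV]
  | ιU_mul v z h => rw [map_mul, map_mul, h, hU]

variable {S : MinimalSullivanAlgebra 𝒱} {D : Extension 𝒱 𝒰 →ₗ[ℚ] Extension 𝒱 𝒰}

variable (D) in
/-- The linear part `U → V` of the differential. -/
def delta : U →ₗ[ℚ] V :=
  linV 𝒱 𝒰 ∘ₗ D ∘ₗ (GradedTensorProduct.includeRight (FreeGCA.gr 𝒱) (FreeGCA.gr 𝒰)).toLinearMap ∘ₗ
    FreeGCA.ι 𝒰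

theorem delta_apply (u : U) : delta D u = linV 𝒱 𝒰 (D (1 ᵍ⊗ₜ[ℚ] FreeGCA.ι 𝒰 u)) := rfl

theorem apply_delta (f : Module.Dual ℚ V) (u : U) :
    f (delta D u) = FreeGCA.aug 𝒰 (component D (FreeGCA.ev 𝒱 f) (FreeGCA.ι 𝒰 u)) := by
  rw [delta_apply, component_apply, ev_linV]

theorem quotientDifferential_mul (hD : IsDifferential (gr 𝒱 𝒰) D) (Φ Ψ : FreeGCA 𝒰) :
    quotientDifferential D (Φ * Ψ) =
      quotientDifferential D Φ * Ψ + FreeGCA.sgn 𝒰 Φ * quotientDifferential D Ψ := by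
  have h := component_mul hD isConcentrated_aug Φ Ψ
  rwa [zero_add, pow_one] at h

theorem quotientDifferential_one (hD : IsDifferential (gr 𝒱 𝒰) D) :
    quotientDifferential D 1 = 0 := by
  have h := quotientDifferential_mul hD 1 1
  simpa using h

theorem aug_sgn (a : FreeGCA 𝒰) : FreeGCA.aug 𝒰 (FreeGCA.sgn 𝒰 a) = FreeGCA.aug 𝒰 a := by
  simpa using FreeGCA.aug_sgn_pow 1 a

theorem aug_quotientDifferential (hD : IsAcyclicClosure S D) (Φ : FreeGCA 𝒰) :
    FreeGCA.aug 𝒰 (quotientDifferential D Φ) = 0 := by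
  induction Φ using FreeGCA.monomial_induction with
  | one => rw [quotientDifferential_one hD.isDifferential, map_zero]
  | add a b h₁ h₂ => rw [map_add, map_add, h₁, h₂, add_zero]
  | smul r a h => rw [map_smul, map_smul, h, smul_zero]
  | ι_mul i u a hu h =>
    rw [quotientDifferential_mul hD.isDifferential, map_add, map_mul, map_mul,
      FreeGCA.aug_of_mem_wedgeGE (hD.minimal u), h]
    simp

theorem lin_quotientDifferential (hD : IsAcyclicClosure S D) (Φ : FreeGCA 𝒰) :
    FreeGCA.lin 𝒰 (quotientDifferential D Φ) = 0 := by
  induction Φ using FreeGCA.monomial_induction with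
  | one => rw [quotientDifferential_one hD.isDifferential, map_zero]
  | add a b h₁ h₂ => rw [map_add, map_add, h₁, h₂, add_zero]
  | smul r a h => rw [map_smul, map_smul, h, smul_zero]
  | ι_mul i u a hu h =>
    rw [quotientDifferential_mul hD.isDifferential, map_add, FreeGCA.lin_mul, FreeGCA.lin_mul, h,
      aug_quotientDifferential hD, aug_quotientDifferential hD,
      FreeGCA.lin_of_mem_wedgeGE (hD.minimal u)]
    simp

theorem aug_D (hD : IsAcyclicClosure S D) (z : Extension 𝒱 𝒰) : aug 𝒱 𝒰 (D z) = 0 := by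
  change FreeGCA.aug 𝒰 (slant 𝒱 𝒰 (FreeGCA.aug 𝒱).toLinearMap (D z)) = 0
  rw [slant_aug_D hD, aug_quotientDifferential hD]

theorem linU_D (hD : IsAcyclicClosure S D) (z : Extension 𝒱 𝒰) : linU 𝒱 𝒰 (D z) = 0 := by
  rw [linU, LinearMap.comp_apply, slant_aug_D hD, lin_quotientDifferential hD]

theorem D_ιV (hD : IsAcyclicClosure S D) (v : V) :
    D (FreeGCA.ι 𝒱 v ᵍ⊗ₜ[ℚ] 1) = S.d (FreeGCA.ι 𝒱 v) ᵍ⊗ₜ[ℚ] 1 := hD.base _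

/-- Minimality of `d` leaves `δ` as the only part of the differential of indecomposables with values
in `V`; `linU_D` shows that there is none with values in `U`. -/
theorem linV_D (hD : IsAcyclicClosure S D) (z : Extension 𝒱 𝒰) :
    linV 𝒱 𝒰 (D z) = delta D (linU 𝒱 𝒰 z) := by
  have haug : ∀ z, aug 𝒱 𝒰 (sgn 𝒱 𝒰 z) = aug 𝒱 𝒰 z := by
    intro z
    induction z using tmul_induction with
    | add z w h₁ h₂ => simp only [map_add, h₁, h₂]
    | tmul a b => rw [sgn_tmul, aug_tmul, aug_tmul, aug_sgn, aug_sgn]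
  induction z using generator_induction with
  | one =>
    have h1 : D 1 = 0 := by
      have := leibniz hD.isDifferential 1 1
      simpa using this
    rw [h1, one_eq, linU_tmul]
    simp
  | add z w h₁ h₂ => simp only [map_add, h₁, h₂]
  | smul r z h => simp only [map_smul, h]
  | ιV_mul v z h =>
    rw [leibniz hD.isDifferential, D_ιV hD, map_add, linV_mul, linV_mul, aug_D hD, haug, aug_tmul,
      aug_tmul, linV_tmul, linU_mul, aug_tmul, linU_tmul, S.lin_d, S.aug_d, FreeGCA.aug_ι]
    simp
  | ιU_mul u z h =>
    rw [leibniz hD.isDifferential, map_add, linV_mul, linV_mul, aug_D hD, aug_D hD, haug, aug_tmul,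
      linU_mul, aug_tmul, linU_tmul, FreeGCA.aug_ι, ← delta_apply]
    simp

end Extension
end Linear

/-! ### Matrices over graded commutative algebras

An element `a + dt b` of `A ⊗ ∧(dt)` is represented by the matrix with rows `(σ a, b)` and `(0, a)`,
where `σ` is the degree involution. -/

section PathMatrix

variable {A : Type*} [Ring A] [Algebra ℚ A] (σ : A →ₐ[ℚ] A)

/-- The matrices of the elements `a + dt b` of parity `k`. -/
def pathMatrix (k : ℕ) : Submodule ℚ (Matrix (Fin 2) (Fin 2) A) where
  carrier := {M | M 1 0 = 0 ∧ M 0 0 = σ (M 1 1) ∧ σ (M 1 1) = (-1 : ℚ) ^ k • M 1 1 ∧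
    σ (M 0 1) = -(-1 : ℚ) ^ k • M 0 1}
  add_mem' := by
    rintro M N ⟨h1, h2, h3, h4⟩ ⟨k1, k2, k3, k4⟩
    refine ⟨by simp [h1, k1], by simp [h2, k2], ?_, ?_⟩
    · simp only [Matrix.add_apply, map_add, h3, k3, smul_add]
    · simp only [Matrix.add_apply, map_add, h4, k4, smul_add]
  zero_mem' := by simp
  smul_mem' := by
    rintro r M ⟨h1, h2, h3, h4⟩
    refine ⟨by simp [h1], by simp [h2], ?_, ?_⟩
    · simp only [Matrix.smul_apply, map_smul, h3, smul_comm r]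
    · simp only [Matrix.smul_apply, map_smul, h4, smul_comm r]

variable {σ}

theorem one_mem_pathMatrix : (1 : Matrix (Fin 2) (Fin 2) A) ∈ pathMatrix σ 0 := by
  refine ⟨?_, ?_, ?_, ?_⟩ <;> simp

theorem mul_mem_pathMatrix {i j : ℕ} {M N : Matrix (Fin 2) (Fin 2) A} (hM : M ∈ pathMatrix σ i)
    (hN : N ∈ pathMatrix σ j) : M * N ∈ pathMatrix σ (i + j) := by
  obtain ⟨h1, h2, h3, h4⟩ := hM
  obtain ⟨k1, k2, k3, k4⟩ := hN
  refine ⟨?_, ?_, ?_, ?_⟩ <;> simp only [Matrix.mul_apply, Fin.sum_univ_two]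
  · simp [h1, k1]
  · simp [h1, h2, k1, k2]
  · simp only [h1, zero_mul, zero_add, map_mul, h3, k3, smul_mul_smul_comm, pow_add]
  · rw [h2, h3, map_add, map_mul, map_mul, map_smul, h3, h4, k3, k4]
    simp only [smul_mul_assoc, mul_smul_comm, smul_smul, smul_add, pow_add]
    congr 2 <;> ring

/-- Adjoining an odd element `dt` of square zero preserves graded commutativity: each entry reduces
to commuting elements of parities `i` or `i + 1` with elements of parities `j` or `j + 1`. -/
theorem pathMatrix_mul_comm
    (hσ : ∀ (i j : ℕ) (a b : A), σ a = (-1 : ℚ) ^ i • a → σ b = (-1 : ℚ) ^ j • b →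
      a * b = (-1 : ℚ) ^ (i * j) • (b * a)) {i j : ℕ} {M N : Matrix (Fin 2) (Fin 2) A}
    (hM : M ∈ pathMatrix σ i) (hN : N ∈ pathMatrix σ j) :
    M * N = (-1 : ℚ) ^ (i * j) • (N * M) := by
  obtain ⟨h1, h2, h3, h4⟩ := hM
  obtain ⟨k1, k2, k3, k4⟩ := hN
  have h4' : σ (M 0 1) = (-1 : ℚ) ^ (i + 1) • M 0 1 := by rw [h4, pow_succ]; simp
  have k4' : σ (N 0 1) = (-1 : ℚ) ^ (j + 1) • N 0 1 := by rw [k4, pow_succ]; simp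
  have e1 := hσ i j _ _ h3 k3
  have e2 := hσ i (j + 1) _ _ h3 k4'
  have e3 := hσ (i + 1) j _ _ h4' k3
  have sq : ∀ n : ℕ, (-1 : ℚ) ^ n * (-1 : ℚ) ^ n = 1 := fun n => by rw [← mul_pow]; simp
  ext a b
  fin_cases a <;> fin_cases b <;>
    simp only [Matrix.mul_apply, Fin.sum_univ_two, Matrix.smul_apply, Fin.zero_eta, Fin.mk_one,
      h1, k1, h2, k2, mul_zero, zero_mul, add_zero, zero_add, smul_zero]
  · rw [← map_mul, e1, map_smul, map_mul]
  · rw [h3, k3, smul_mul_assoc, e2, e3, smul_mul_assoc, smul_add, smul_smul, smul_smul, add_comm]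
    congr 2
    · ring
    · rw [mul_add, pow_add, mul_one, mul_left_comm, sq, mul_one]
  · exact e1

end PathMatrix

/-! ### Algebra morphisms into `(∧V ⊗ ∧U) ⊗ ∧(t, dt)` with prescribed end points. -/

section Path

variable {V : Type u} [AddCommGroup V] [Module ℚ V] {𝒱 : ℕ → Submodule ℚ V}
  {U : Type v} [AddCommGroup U] [Module ℚ U] {𝒰 : ℕ → Submodule ℚ U}
  [DirectSum.Decomposition 𝒱] [DirectSum.Decomposition 𝒰]

namespace Extension

/-- Graded commutativity without homogeneity: `w + sgn w` and `w - sgn w` are twice the even and odd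
parts of `w`. Being bilinear, the identity passes to coefficients in `ℚ[t]`. -/
theorem two_smul_mul (z w : Extension 𝒱 𝒰) : (2 : ℚ) • (z * w) =
    (w + sgn 𝒱 𝒰 w) * z + (w - sgn 𝒱 𝒰 w) * sgn 𝒱 𝒰 z := by
  induction z using homog_induction with
  | add z z' h₁ h₂ =>
    rw [add_mul, smul_add, h₁, h₂, map_add, mul_add, mul_add]; abel
  | tmul i j a b ha hb =>
    induction w using homog_induction with
    | add z z' h₁ h₂ =>
      rw [mul_add, smul_add, h₁, h₂, map_add]
      simp only [add_mul, sub_mul]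
      abel
    | tmul i' j' a' b' ha' hb' =>
      have e : (a ᵍ⊗ₜ[ℚ] b * a' ᵍ⊗ₜ[ℚ] b' : Extension 𝒱 𝒰) =
          (-1 : ℚ) ^ ((i + j) * (i' + j')) • (a' ᵍ⊗ₜ[ℚ] b' * a ᵍ⊗ₜ[ℚ] b) := by
        rw [tmul_mul_tmul _ _ _ _ hb ha', tmul_mul_tmul _ _ _ _ hb' ha,
          FreeGCA.gr_mul_comm ha ha', FreeGCA.gr_mul_comm hb hb', smul_tmul, tmul_smul]
        simp only [smul_smul]
        congr 1
        have e : (-1 : ℚ) ^ (j' * i) * (-1 : ℚ) ^ (j' * i) = 1 := by rw [← mul_pow]; simp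
        simp only [add_mul, mul_add, pow_add, mul_comm j' i]
        rw [mul_comm j' i] at e
        linear_combination (-(-1 : ℚ) ^ (i * i') * (-1 : ℚ) ^ (j * i') * (-1 : ℚ) ^ (j * j')) * e
      rw [e, sgn_apply (tmul_mem_gr ha hb), sgn_apply (tmul_mem_gr ha' hb')]
      clear e
      generalize i + j = m
      generalize i' + j' = n
      simp only [add_mul, sub_mul, smul_mul_assoc, mul_smul_comm, smul_smul]
      generalize (a' ᵍ⊗ₜ[ℚ] b' * a ᵍ⊗ₜ[ℚ] b : Extension 𝒱 𝒰) = x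
      rcases Nat.even_or_odd m with h | h <;> rcases Nat.even_or_odd n with h' | h' <;>
        simp [h.neg_one_pow, h'.neg_one_pow, pow_mul, two_smul]

variable (𝒱 𝒰) in
/-- The algebra `(∧V ⊗ ∧U)[t]`. -/
abbrev Poly : Type _ := Extension 𝒱 𝒰 ⊗[ℚ] Polynomial ℚ

variable (𝒱 𝒰) in
/-- The degree involution of `(∧V ⊗ ∧U)[t]`. -/
def sgnPoly : Poly 𝒱 𝒰 →ₐ[ℚ] Poly 𝒱 𝒰 :=
  Algebra.TensorProduct.map (sgn 𝒱 𝒰) (AlgHom.id ℚ (Polynomial ℚ))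

variable (𝒱 𝒰) in
/-- The augmentation `(∧V ⊗ ∧U)[t] → ℚ[t]`. -/
def augPoly : Poly 𝒱 𝒰 →ₐ[ℚ] Polynomial ℚ :=
  (Algebra.TensorProduct.lid ℚ (Polynomial ℚ)).toAlgHom.comp
    (Algebra.TensorProduct.map (augHom 𝒱 𝒰) (AlgHom.id ℚ (Polynomial ℚ)))

variable (𝒱 𝒰) in
/-- The evaluation `(∧V ⊗ ∧U)[t] → ∧V ⊗ ∧U` at `t = c`. -/
def evalPoly (c : ℚ) : Poly 𝒱 𝒰 →ₐ[ℚ] Extension 𝒱 𝒰 :=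
  (Algebra.TensorProduct.rid ℚ ℚ (Extension 𝒱 𝒰)).toAlgHom.comp
    (Algebra.TensorProduct.map (AlgHom.id ℚ (Extension 𝒱 𝒰)) (Polynomial.aeval c))

theorem sgnPoly_tmul (z : Extension 𝒱 𝒰) (f : Polynomial ℚ) :
    sgnPoly 𝒱 𝒰 (z ⊗ₜ f) = sgn 𝒱 𝒰 z ⊗ₜ f := rfl

theorem augPoly_tmul (z : Extension 𝒱 𝒰) (f : Polynomial ℚ) :
    augPoly 𝒱 𝒰 (z ⊗ₜ f) = aug 𝒱 𝒰 z • f := rfl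

theorem evalPoly_tmul (c : ℚ) (z : Extension 𝒱 𝒰) (f : Polynomial ℚ) :
    evalPoly 𝒱 𝒰 c (z ⊗ₜ f) = f.eval c • z := by
  change Polynomial.aeval c f • z = _
  rw [Polynomial.coe_aeval_eq_eval]

theorem sgnPoly_sgnPoly (p : Poly 𝒱 𝒰) : sgnPoly 𝒱 𝒰 (sgnPoly 𝒱 𝒰 p) = p := by
  induction p using TensorProduct.induction_on with
  | zero => simp
  | tmul z f => rw [sgnPoly_tmul, sgnPoly_tmul, sgn_sgn]
  | add p q h₁ h₂ => rw [map_add, map_add, h₁, h₂]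

theorem two_smul_mul_poly (p q : Poly 𝒱 𝒰) : (2 : ℚ) • (p * q) =
    (q + sgnPoly 𝒱 𝒰 q) * p + (q - sgnPoly 𝒱 𝒰 q) * sgnPoly 𝒱 𝒰 p := by
  induction p using TensorProduct.induction_on with
  | zero => simp
  | add p p' h₁ h₂ => rw [add_mul, smul_add, h₁, h₂, map_add, mul_add, mul_add]; abel
  | tmul z f =>
    induction q using TensorProduct.induction_on with
    | zero => simp
    | add p p' h₁ h₂ =>
      rw [mul_add, smul_add, h₁, h₂, map_add]
      simp only [add_mul, sub_mul]
      abel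
    | tmul w g =>
      rw [sgnPoly_tmul, sgnPoly_tmul, ← TensorProduct.add_tmul, ← TensorProduct.sub_tmul,
        Algebra.TensorProduct.tmul_mul_tmul, Algebra.TensorProduct.tmul_mul_tmul,
        Algebra.TensorProduct.tmul_mul_tmul, mul_comm g, ← TensorProduct.add_tmul, ← two_smul_mul]
      rfl

theorem poly_mul_comm (i j : ℕ) (p q : Poly 𝒱 𝒰) (hp : sgnPoly 𝒱 𝒰 p = (-1 : ℚ) ^ i • p)
    (hq : sgnPoly 𝒱 𝒰 q = (-1 : ℚ) ^ j • q) : p * q = (-1 : ℚ) ^ (i * j) • (q * p) := by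
  have h := two_smul_mul_poly p q
  have e : (2 : ℚ) • (p * q) = (2 : ℚ) • ((-1 : ℚ) ^ (i * j) • (q * p)) := by
    rw [h, hp, hq]
    simp only [add_mul, sub_mul, smul_mul_assoc, mul_smul_comm, smul_smul]
    generalize q * p = x
    rcases Nat.even_or_odd i with h | h <;> rcases Nat.even_or_odd j with h' | h' <;>
      simp [h.neg_one_pow, h'.neg_one_pow, pow_mul, two_smul]
  exact smul_right_injective _ (two_ne_zero' ℚ) e

/-- Morphisms `H₀ + dt H₁ : ∧V ⊗ ∧U → (∧V ⊗ ∧U) ⊗ ∧(t, dt)` which preserve augmentations and connect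
the augmentation (at `t = 0`) with the identity (at `t = 1`). -/
structure IsPath (H₀ : Extension 𝒱 𝒰 →ₐ[ℚ] Poly 𝒱 𝒰) (H₁ : Extension 𝒱 𝒰 →ₗ[ℚ] Poly 𝒱 𝒰) :
    Prop where
  mul : ∀ z w, H₁ (z * w) = sgnPoly 𝒱 𝒰 (H₀ z) * H₁ w + H₁ z * H₀ w
  sgn₀ : ∀ z, H₀ (sgn 𝒱 𝒰 z) = sgnPoly 𝒱 𝒰 (H₀ z)
  sgn₁ : ∀ z, H₁ (sgn 𝒱 𝒰 z) = -sgnPoly 𝒱 𝒰 (H₁ z)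
  aug₀ : ∀ z, augPoly 𝒱 𝒰 (H₀ z) = algebraMap ℚ _ (aug 𝒱 𝒰 z)
  aug₁ : ∀ z, augPoly 𝒱 𝒰 (H₁ z) = 0
  eval₀ : ∀ z, evalPoly 𝒱 𝒰 0 (H₀ z) = algebraMap ℚ _ (aug 𝒱 𝒰 z)
  eval₁ : ∀ z, evalPoly 𝒱 𝒰 1 (H₀ z) = z

theorem IsPath.map_one {H₀ : Extension 𝒱 𝒰 →ₐ[ℚ] Poly 𝒱 𝒰} {H₁ : Extension 𝒱 𝒰 →ₗ[ℚ] Poly 𝒱 𝒰}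
    (h : IsPath H₀ H₁) : H₁ 1 = 0 := by
  simpa using h.mul 1 1

theorem aug_ι_tmul_one (v : V) : aug 𝒱 𝒰 (FreeGCA.ι 𝒱 v ᵍ⊗ₜ[ℚ] 1) = 0 := by
  rw [aug_tmul, FreeGCA.aug_ι, zero_mul]

theorem aug_one_tmul_ι (u : U) : aug 𝒱 𝒰 (1 ᵍ⊗ₜ[ℚ] FreeGCA.ι 𝒰 u) = 0 := by
  rw [aug_tmul, FreeGCA.aug_ι, mul_zero]

/-- A path is prescribed by its values on generators. -/
theorem exists_isPath (F₀ F₁ : Extension 𝒱 𝒰 →ₗ[ℚ] Poly 𝒱 𝒰)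
    (hs₀ : ∀ z, F₀ (sgn 𝒱 𝒰 z) = sgnPoly 𝒱 𝒰 (F₀ z))
    (hs₁ : ∀ z, F₁ (sgn 𝒱 𝒰 z) = -sgnPoly 𝒱 𝒰 (F₁ z))
    (ha₀ : ∀ z, aug 𝒱 𝒰 z = 0 → augPoly 𝒱 𝒰 (F₀ z) = 0)
    (ha₁ : ∀ z, aug 𝒱 𝒰 z = 0 → augPoly 𝒱 𝒰 (F₁ z) = 0)
    (he₀ : ∀ z, aug 𝒱 𝒰 z = 0 → evalPoly 𝒱 𝒰 0 (F₀ z) = 0)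
    (he₁ : ∀ z, aug 𝒱 𝒰 z = 0 → evalPoly 𝒱 𝒰 1 (F₀ z) = z) :
    ∃ H₀ H₁, IsPath (𝒱 := 𝒱) (𝒰 := 𝒰) H₀ H₁ ∧
      (∀ v, H₀ (FreeGCA.ι 𝒱 v ᵍ⊗ₜ[ℚ] 1) = F₀ (FreeGCA.ι 𝒱 v ᵍ⊗ₜ[ℚ] 1)) ∧
      (∀ v, H₁ (FreeGCA.ι 𝒱 v ᵍ⊗ₜ[ℚ] 1) = F₁ (FreeGCA.ι 𝒱 v ᵍ⊗ₜ[ℚ] 1)) ∧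
      (∀ u, H₀ (1 ᵍ⊗ₜ[ℚ] FreeGCA.ι 𝒰 u) = F₀ (1 ᵍ⊗ₜ[ℚ] FreeGCA.ι 𝒰 u)) ∧
      (∀ u, H₁ (1 ᵍ⊗ₜ[ℚ] FreeGCA.ι 𝒰 u) = F₁ (1 ᵍ⊗ₜ[ℚ] FreeGCA.ι 𝒰 u)) := by
  let F : Extension 𝒱 𝒰 →ₗ[ℚ] Matrix (Fin 2) (Fin 2) (Poly 𝒱 𝒰) :=
    { toFun := fun z => !![sgnPoly 𝒱 𝒰 (F₀ z), F₁ z; 0, F₀ z]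
      map_add' := fun z w => by ext i j; fin_cases i <;> fin_cases j <;> simp
      map_smul' := fun r z => by ext i j; fin_cases i <;> fin_cases j <;> simp }
  have hF : ∀ {n : ℕ} {z : Extension 𝒱 𝒰}, z ∈ gr 𝒱 𝒰 n → F z ∈ pathMatrix (sgnPoly 𝒱 𝒰) n := by
    intro n z hz
    refine ⟨rfl, rfl, ?_, ?_⟩
    · change sgnPoly 𝒱 𝒰 (F₀ z) = (-1 : ℚ) ^ n • F₀ z
      rw [← hs₀, sgn_apply hz, map_smul]
    · change sgnPoly 𝒱 𝒰 (F₁ z) = -(-1 : ℚ) ^ n • F₁ z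
      rw [← neg_eq_iff_eq_neg.mpr (hs₁ z), sgn_apply hz, map_smul, neg_smul]
  let HV : FreeGCA 𝒱 →ₐ[ℚ] Matrix (Fin 2) (Fin 2) (Poly 𝒱 𝒰) :=
    FreeGCA.lift (F ∘ₗ (GradedTensorProduct.includeLeft (FreeGCA.gr 𝒱) (FreeGCA.gr 𝒰)).toLinearMap ∘ₗ
      FreeGCA.ι 𝒱) (fun i j v w hv hw => pathMatrix_mul_comm poly_mul_comm
        (hF (tmul_one_mem_gr (FreeGCA.ι_mem_gr hv))) (hF (tmul_one_mem_gr (FreeGCA.ι_mem_gr hw))))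
  let HU : FreeGCA 𝒰 →ₐ[ℚ] Matrix (Fin 2) (Fin 2) (Poly 𝒱 𝒰) :=
    FreeGCA.lift (F ∘ₗ (GradedTensorProduct.includeRight (FreeGCA.gr 𝒱) (FreeGCA.gr 𝒰)).toLinearMap ∘ₗ
      FreeGCA.ι 𝒰) (fun i j v w hv hw => pathMatrix_mul_comm poly_mul_comm
        (hF (one_tmul_mem_gr (FreeGCA.ι_mem_gr hv))) (hF (one_tmul_mem_gr (FreeGCA.ι_mem_gr hw))))
  have hV : ∀ v, HV (FreeGCA.ι 𝒱 v) = F (FreeGCA.ι 𝒱 v ᵍ⊗ₜ[ℚ] 1) := fun v => FreeGCA.lift_ι _ _ v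
  have hU : ∀ u, HU (FreeGCA.ι 𝒰 u) = F (1 ᵍ⊗ₜ[ℚ] FreeGCA.ι 𝒰 u) := fun u => FreeGCA.lift_ι _ _ u
  have hVm : ∀ {n : ℕ} {a : FreeGCA 𝒱}, a ∈ FreeGCA.gr 𝒱 n →
      HV a ∈ pathMatrix (sgnPoly 𝒱 𝒰) n := by
    intro n a ha
    induction ha using FreeGCA.gr_induction with
    | one => rw [_root_.map_one]; exact one_mem_pathMatrix
    | zero => rw [map_zero]; exact zero_mem _
    | add n a b _ _ _ h₁ h₂ => rw [map_add]; exact add_mem h₁ h₂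
    | smul n r a _ _ h => rw [map_smul]; exact Submodule.smul_mem _ _ h
    | ι_mul i n v a _ _ hv h =>
      rw [map_mul, hV]
      exact mul_mem_pathMatrix (hF (tmul_one_mem_gr (FreeGCA.ι_mem_gr hv))) h
  have hUm : ∀ {n : ℕ} {a : FreeGCA 𝒰}, a ∈ FreeGCA.gr 𝒰 n →
      HU a ∈ pathMatrix (sgnPoly 𝒱 𝒰) n := by
    intro n a ha
    induction ha using FreeGCA.gr_induction with
    | one => rw [_root_.map_one]; exact one_mem_pathMatrix
    | zero => rw [map_zero]; exact zero_mem _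
    | add n a b _ _ _ h₁ h₂ => rw [map_add]; exact add_mem h₁ h₂
    | smul n r a _ _ h => rw [map_smul]; exact Submodule.smul_mem _ _ h
    | ι_mul i n v a _ _ hv h =>
      rw [map_mul, hU]
      exact mul_mem_pathMatrix (hF (one_tmul_mem_gr (FreeGCA.ι_mem_gr hv))) h
  -- The values on `∧V` and on `∧U` commute up to the Koszul sign, so they combine to a morphism of
  -- the graded tensor product.
  let H : Extension 𝒱 𝒰 →ₐ[ℚ] Matrix (Fin 2) (Fin 2) (Poly 𝒱 𝒰) :=
    GradedTensorProduct.lift _ _ HV HU (by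
      rintro i j ⟨a, ha⟩ ⟨b, hb⟩
      rw [pathMatrix_mul_comm poly_mul_comm (hVm ha) (hUm hb), Units.smul_def,
        ← Int.cast_smul_eq_zsmul ℚ, mul_comm i]
      simp)
  have hH : ∀ a b, H (a ᵍ⊗ₜ[ℚ] b) = HV a * HU b := fun a b => rfl
  have hHV : ∀ v, H (FreeGCA.ι 𝒱 v ᵍ⊗ₜ[ℚ] 1) = F (FreeGCA.ι 𝒱 v ᵍ⊗ₜ[ℚ] 1) := by
    intro v; rw [hH, _root_.map_one, mul_one, hV]
  have hHU : ∀ u, H (1 ᵍ⊗ₜ[ℚ] FreeGCA.ι 𝒰 u) = F (1 ᵍ⊗ₜ[ℚ] FreeGCA.ι 𝒰 u) := by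
    intro v; rw [hH, _root_.map_one, one_mul, hU]
  -- Membership in `pathMatrix` is known for homogeneous elements; written with `sgn` the conditions
  -- become linear in `z` and so hold for all elements.
  have form : ∀ z, H z 1 0 = 0 ∧ H z 0 0 = sgnPoly 𝒱 𝒰 (H z 1 1) ∧
      H (sgn 𝒱 𝒰 z) 1 1 = sgnPoly 𝒱 𝒰 (H z 1 1) ∧
      H (sgn 𝒱 𝒰 z) 0 1 = -sgnPoly 𝒱 𝒰 (H z 0 1) := by
    intro z
    induction z using homog_induction with
    | add z w h₁ h₂ =>
      obtain ⟨h1, h2, h3, h4⟩ := h₁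
      obtain ⟨k1, k2, k3, k4⟩ := h₂
      simp only [map_add, Matrix.add_apply, h1, h2, h3, h4, k1, k2, k3, k4]
      refine ⟨by simp, trivial, trivial, by abel⟩
    | tmul i j a b ha hb =>
      obtain ⟨h1, h2, h3, h4⟩ : H (a ᵍ⊗ₜ[ℚ] b) ∈ pathMatrix (sgnPoly 𝒱 𝒰) (i + j) := by
        rw [hH]; exact mul_mem_pathMatrix (hVm ha) (hUm hb)
      refine ⟨h1, h2, ?_, ?_⟩
      · rw [h3, sgn_apply (tmul_mem_gr ha hb), map_smul, Matrix.smul_apply]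
      · rw [h4, sgn_apply (tmul_mem_gr ha hb), map_smul, Matrix.smul_apply, neg_smul, neg_neg]
  let H₀ : Extension 𝒱 𝒰 →ₐ[ℚ] Poly 𝒱 𝒰 :=
    AlgHom.ofLinearMap (Matrix.entryLinearMap ℚ (Poly 𝒱 𝒰) 1 1 ∘ₗ H.toLinearMap) (by simp) (by
      intro z w
      simp [Matrix.mul_apply, (form z).1])
  let H₁ : Extension 𝒱 𝒰 →ₗ[ℚ] Poly 𝒱 𝒰 :=
    Matrix.entryLinearMap ℚ (Poly 𝒱 𝒰) 0 1 ∘ₗ H.toLinearMap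
  have e0 : ∀ z, H₀ z = H z 1 1 := fun z => rfl
  have e1 : ∀ z, H₁ z = H z 0 1 := fun z => rfl
  have hV₀ : ∀ v, H₀ (FreeGCA.ι 𝒱 v ᵍ⊗ₜ[ℚ] 1) = F₀ (FreeGCA.ι 𝒱 v ᵍ⊗ₜ[ℚ] 1) := by
    intro v; rw [e0, hHV]; rfl
  have hV₁ : ∀ v, H₁ (FreeGCA.ι 𝒱 v ᵍ⊗ₜ[ℚ] 1) = F₁ (FreeGCA.ι 𝒱 v ᵍ⊗ₜ[ℚ] 1) := by
    intro v; rw [e1, hHV]; rfl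
  have hU₀ : ∀ v, H₀ (1 ᵍ⊗ₜ[ℚ] FreeGCA.ι 𝒰 v) = F₀ (1 ᵍ⊗ₜ[ℚ] FreeGCA.ι 𝒰 v) := by
    intro v; rw [e0, hHU]; rfl
  have hU₁ : ∀ v, H₁ (1 ᵍ⊗ₜ[ℚ] FreeGCA.ι 𝒰 v) = F₁ (1 ᵍ⊗ₜ[ℚ] FreeGCA.ι 𝒰 v) := by
    intro v; rw [e1, hHU]; rfl
  have hmul : ∀ z w, H₁ (z * w) = sgnPoly 𝒱 𝒰 (H₀ z) * H₁ w + H₁ z * H₀ w := by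
    intro z w
    simp only [e0, e1, map_mul, Matrix.mul_apply, Fin.sum_univ_two, (form z).2.1]
  refine ⟨H₀, H₁, ⟨hmul, fun z => (form z).2.2.1, fun z => (form z).2.2.2, ?_, ?_, ?_, ?_⟩, hV₀, hV₁,
    hU₀, hU₁⟩
  · intro z
    have : (augPoly 𝒱 𝒰).comp H₀ = (Algebra.ofId ℚ (Polynomial ℚ)).comp (augHom 𝒱 𝒰) := by
      refine hom_ext (fun v => ?_) (fun u => ?_)
      · simp [hV₀, ha₀ _ (aug_ι_tmul_one v), aug_ι_tmul_one v]
      · simp [hU₀, ha₀ _ (aug_one_tmul_ι u), aug_one_tmul_ι u]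
    exact DFunLike.congr_fun this z
  · intro z
    induction z using generator_induction with
    | one =>
      have : H₁ 1 = 0 := by simpa using hmul 1 1
      rw [this, map_zero]
    | add z w h₁ h₂ => rw [map_add, map_add, h₁, h₂, add_zero]
    | smul r z h => rw [map_smul, map_smul, h, smul_zero]
    | ιV_mul v z h =>
      rw [hmul, map_add, map_mul, map_mul, h, hV₁, ha₁ _ (aug_ι_tmul_one v)]
      simp
    | ιU_mul u z h =>
      rw [hmul, map_add, map_mul, map_mul, h, hU₁, ha₁ _ (aug_one_tmul_ι u)]
      simp
  · intro z
    have : (evalPoly 𝒱 𝒰 0).comp H₀ =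
        (Algebra.ofId ℚ (Extension 𝒱 𝒰)).comp (augHom 𝒱 𝒰) := by
      refine hom_ext (fun v => ?_) (fun u => ?_)
      · simp [hV₀, he₀ _ (aug_ι_tmul_one v), aug_ι_tmul_one v]
      · simp [hU₀, he₀ _ (aug_one_tmul_ι u), aug_one_tmul_ι u]
    exact DFunLike.congr_fun this z
  · intro z
    have : (evalPoly 𝒱 𝒰 1).comp H₀ = AlgHom.id ℚ _ := by
      refine hom_ext (fun v => ?_) (fun u => ?_)
      · simp [hV₀, he₁ _ (aug_ι_tmul_one v)]
      · simp [hU₀, he₁ _ (aug_one_tmul_ι u)]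
    exact DFunLike.congr_fun this z

end Extension
end Path

/-! ### Contraction, homotopy of the augmentation with the identity, and bijectivity of `δ`. -/

section Linearization

variable {V : Type u} [AddCommGroup V] [Module ℚ V] {𝒱 : ℕ → Submodule ℚ V}
  {U : Type v} [AddCommGroup U] [Module ℚ U] {𝒰 : ℕ → Submodule ℚ U}
  [DirectSum.Decomposition 𝒱] [DirectSum.Decomposition 𝒰]
  {S : MinimalSullivanAlgebra 𝒱} {D : Extension 𝒱 𝒰 →ₗ[ℚ] Extension 𝒱 𝒰}

namespace Extension

/-- A contraction of the augmentation ideal of `∧V ⊗ ∧U`. -/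
structure IsContraction (D s : Extension 𝒱 𝒰 →ₗ[ℚ] Extension 𝒱 𝒰) : Prop where
  homotopy : ∀ z, aug 𝒱 𝒰 z = 0 → D (s z) + s (D z) = z
  aug_eq : ∀ z, aug 𝒱 𝒰 (s z) = 0
  sgn_eq : ∀ z, s (sgn 𝒱 𝒰 z) = -sgn 𝒱 𝒰 (s z)

theorem augHom_sgn (z : Extension 𝒱 𝒰) : aug 𝒱 𝒰 (sgn 𝒱 𝒰 z) = aug 𝒱 𝒰 z := by
  induction z using tmul_induction with
  | add z w h₁ h₂ => simp only [map_add, h₁, h₂]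
  | tmul a b => rw [sgn_tmul, aug_tmul, aug_tmul, aug_sgn, aug_sgn]

theorem D_one (hD : IsAcyclicClosure S D) : D 1 = 0 := by
  rw [one_eq, hD.base, S.isDifferential.map_one]
  exact TensorProduct.zero_tmul _ _

/-- Over a field `D` has a linear section `t` on its image, and acyclicity makes `t ∘ (id - t D)`
contract the augmentation ideal. -/
theorem exists_isContraction (hD : IsAcyclicClosure S D) : ∃ s, IsContraction D s := by
  obtain ⟨r₀, hr₀⟩ := D.rangeRestrict.exists_rightInverse_of_surjective (by simp)
  obtain ⟨r, hr⟩ := LinearMap.exists_extend r₀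
  have hDr : ∀ z, D (r (D z)) = D z := by
    intro z
    have h1 : r (D z) = r₀ ⟨D z, z, rfl⟩ := LinearMap.congr_fun hr ⟨D z, z, rfl⟩
    have h2 := LinearMap.congr_fun hr₀ ⟨D z, z, rfl⟩
    rw [h1]
    exact congrArg Subtype.val h2
  -- Subtracting constants, which `D` kills, moves the section into the augmentation ideal.
  let t : Extension 𝒱 𝒰 →ₗ[ℚ] Extension 𝒱 𝒰 :=
    r - (LinearMap.toSpanSingleton ℚ _ (1 : Extension 𝒱 𝒰)) ∘ₗ aug 𝒱 𝒰 ∘ₗ r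
  have ht : ∀ z, t z = r z - aug 𝒱 𝒰 (r z) • (1 : Extension 𝒱 𝒰) := fun z => rfl
  have haug : ∀ z, aug 𝒱 𝒰 (t z) = 0 := by
    intro z; rw [ht, map_sub, map_smul, aug_one, smul_eq_mul, mul_one, sub_self]
  have hDt : ∀ z, D (t (D z)) = D z := by
    intro z; rw [ht, map_sub, map_smul, D_one hD, smul_zero, sub_zero, hDr]
  let s : Extension 𝒱 𝒰 →ₗ[ℚ] Extension 𝒱 𝒰 := t ∘ₗ (LinearMap.id - t ∘ₗ D)
  have hs : ∀ z, s z = t (z - t (D z)) := fun z => rfl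
  have hom : ∀ z, aug 𝒱 𝒰 z = 0 → D (s z) + s (D z) = z := by
    intro z hz
    -- This cycle has augmentation zero, so it is a boundary, and `D t` fixes boundaries.
    have h1 : D (z - t (D z)) = 0 := by rw [map_sub, hDt, sub_self]
    obtain ⟨y, hy⟩ := (hD.quasiIso _ h1).mp (by rw [map_sub, hz, haug, sub_zero])
    rw [hs, ← hy, hDt, hy, hs, hD.isDifferential.sq, map_zero, sub_zero, sub_add_cancel]
  -- Averaging against the degree involution makes the contraction odd, as the sign conditions on
  -- paths require.
  let s' : Extension 𝒱 𝒰 →ₗ[ℚ] Extension 𝒱 𝒰 :=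
    (1 / 2 : ℚ) • (s - (sgn 𝒱 𝒰).toLinearMap ∘ₗ s ∘ₗ (sgn 𝒱 𝒰).toLinearMap)
  have hs' : ∀ z, s' z = (1 / 2 : ℚ) • (s z - sgn 𝒱 𝒰 (s (sgn 𝒱 𝒰 z))) := fun z => rfl
  refine ⟨s', fun z hz => ?_, fun z => ?_, fun z => ?_⟩
  · have h1 := hom z hz
    have h2 := congrArg (sgn 𝒱 𝒰) (hom (sgn 𝒱 𝒰 z) (by rw [augHom_sgn, hz]))
    rw [sgn_sgn, map_add, D_sgn hD.isDifferential, map_neg, map_neg] at h2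
    rw [hs', hs', map_smul, map_sub, D_sgn hD.isDifferential, ← smul_add]
    have h3 : D (s z) - -sgn 𝒱 𝒰 (D (s (sgn 𝒱 𝒰 z))) + (s (D z) - sgn 𝒱 𝒰 (s (sgn 𝒱 𝒰 (D z)))) =
        (2 : ℚ) • z := by
      rw [two_smul]
      refine Eq.trans ?_ (congrArg₂ (· + ·) h1 h2)
      abel
    rw [h3, smul_smul]; norm_num
  · rw [hs', map_smul, map_sub, augHom_sgn, hs, hs, haug, haug, sub_zero, smul_zero]
  · rw [hs', hs', map_smul, sgn_sgn, ← smul_neg, map_sub, sgn_sgn, neg_sub]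

/-- The extension of an endomorphism of `∧V ⊗ ∧U` to `(∧V ⊗ ∧U)[t]`. -/
def polyMap (f : Extension 𝒱 𝒰 →ₗ[ℚ] Extension 𝒱 𝒰) : Poly 𝒱 𝒰 →ₗ[ℚ] Poly 𝒱 𝒰 :=
  LinearMap.rTensor (Polynomial ℚ) f

theorem polyMap_tmul (f : Extension 𝒱 𝒰 →ₗ[ℚ] Extension 𝒱 𝒰) (z : Extension 𝒱 𝒰)
    (p : Polynomial ℚ) : polyMap f (z ⊗ₜ p) = f z ⊗ₜ p := rfl

variable (𝒱 𝒰) in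
/-- The derivative with respect to `t`. -/
def polyDeriv : Poly 𝒱 𝒰 →ₗ[ℚ] Poly 𝒱 𝒰 :=
  LinearMap.lTensor (Extension 𝒱 𝒰) Polynomial.derivative

theorem polyDeriv_tmul (z : Extension 𝒱 𝒰) (p : Polynomial ℚ) :
    polyDeriv 𝒱 𝒰 (z ⊗ₜ p) = z ⊗ₜ Polynomial.derivative p := rfl

theorem polyDeriv_polyMap (f : Extension 𝒱 𝒰 →ₗ[ℚ] Extension 𝒱 𝒰) (p : Poly 𝒱 𝒰) :
    polyDeriv 𝒱 𝒰 (polyMap f p) = polyMap f (polyDeriv 𝒱 𝒰 p) := by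
  induction p using TensorProduct.induction_on with
  | zero => simp
  | tmul z f => rfl
  | add p q h₁ h₂ => simp only [map_add, h₁, h₂]

theorem polyDeriv_mul (p q : Poly 𝒱 𝒰) :
    polyDeriv 𝒱 𝒰 (p * q) = polyDeriv 𝒱 𝒰 p * q + p * polyDeriv 𝒱 𝒰 q := by
  induction p using TensorProduct.induction_on with
  | zero => simp
  | add p p' h₁ h₂ => rw [add_mul, map_add, h₁, h₂, map_add, add_mul, add_mul]; abel
  | tmul z f =>
    induction q using TensorProduct.induction_on with
    | zero => simp
    | add p p' h₁ h₂ => rw [mul_add, map_add, h₁, h₂, map_add, mul_add, mul_add]; abel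
    | tmul w g =>
      rw [polyDeriv_tmul, polyDeriv_tmul, Algebra.TensorProduct.tmul_mul_tmul,
        Algebra.TensorProduct.tmul_mul_tmul, Algebra.TensorProduct.tmul_mul_tmul, polyDeriv_tmul,
        Polynomial.derivative_mul, TensorProduct.tmul_add]

theorem polyMap_D_mul (hD : IsDifferential (gr 𝒱 𝒰) D) (p q : Poly 𝒱 𝒰) :
    polyMap D (p * q) = polyMap D p * q + sgnPoly 𝒱 𝒰 p * polyMap D q := by
  induction p using TensorProduct.induction_on with
  | zero => simp
  | add p p' h₁ h₂ => rw [add_mul, map_add, h₁, h₂, map_add, map_add, add_mul, add_mul]; abel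
  | tmul z f =>
    induction q using TensorProduct.induction_on with
    | zero => simp
    | add p p' h₁ h₂ => rw [mul_add, map_add, h₁, h₂, map_add, mul_add, mul_add]; abel
    | tmul w g =>
      rw [polyMap_tmul, polyMap_tmul, Algebra.TensorProduct.tmul_mul_tmul, sgnPoly_tmul,
        Algebra.TensorProduct.tmul_mul_tmul, Algebra.TensorProduct.tmul_mul_tmul, polyMap_tmul,
        leibniz hD, TensorProduct.add_tmul]

theorem polyMap_sgnPoly {f : Extension 𝒱 𝒰 →ₗ[ℚ] Extension 𝒱 𝒰}
    (hf : ∀ z, f (sgn 𝒱 𝒰 z) = -sgn 𝒱 𝒰 (f z)) (p : Poly 𝒱 𝒰) :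
    polyMap f (sgnPoly 𝒱 𝒰 p) = -sgnPoly 𝒱 𝒰 (polyMap f p) := by
  induction p using TensorProduct.induction_on with
  | zero => simp
  | tmul z g => rw [sgnPoly_tmul, polyMap_tmul, polyMap_tmul, sgnPoly_tmul, hf, TensorProduct.neg_tmul]
  | add p q h₁ h₂ => simp only [map_add, h₁, h₂, neg_add]

theorem augPoly_sgnPoly (p : Poly 𝒱 𝒰) : augPoly 𝒱 𝒰 (sgnPoly 𝒱 𝒰 p) = augPoly 𝒱 𝒰 p := by
  induction p using TensorProduct.induction_on with
  | zero => simp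
  | tmul z g => rw [sgnPoly_tmul, augPoly_tmul, augPoly_tmul, augHom_sgn]
  | add p q h₁ h₂ => simp only [map_add, h₁, h₂]

theorem evalPoly_polyMap (c : ℚ) (f : Extension 𝒱 𝒰 →ₗ[ℚ] Extension 𝒱 𝒰) (p : Poly 𝒱 𝒰) :
    evalPoly 𝒱 𝒰 c (polyMap f p) = f (evalPoly 𝒱 𝒰 c p) := by
  induction p using TensorProduct.induction_on with
  | zero => simp
  | tmul z g => rw [polyMap_tmul, evalPoly_tmul, evalPoly_tmul, map_smul]
  | add p q h₁ h₂ => simp only [map_add, h₁, h₂]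

theorem IsContraction.augPoly_eq {s : Extension 𝒱 𝒰 →ₗ[ℚ] Extension 𝒱 𝒰} (hs : IsContraction D s)
    (p : Poly 𝒱 𝒰) : augPoly 𝒱 𝒰 (polyMap s p) = 0 := by
  induction p using TensorProduct.induction_on with
  | zero => simp
  | tmul z g => rw [polyMap_tmul, augPoly_tmul, hs.aug_eq, zero_smul]
  | add p q h₁ h₂ => simp only [map_add, h₁, h₂, add_zero]

/-- The contraction identity holds coefficientwise in `t`. To argue by linearity on pure tensors,
the identity is first proved for all `p`, with the terms coming from the constants `augPoly p`
included. -/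
theorem IsContraction.poly_homotopy {s : Extension 𝒱 𝒰 →ₗ[ℚ] Extension 𝒱 𝒰}
    (hs : IsContraction D s) (hD : IsAcyclicClosure S D) {p : Poly 𝒱 𝒰} (hp : augPoly 𝒱 𝒰 p = 0) :
    polyMap D (polyMap s p) + polyMap s (polyMap D p) = p := by
  have key : ∀ p : Poly 𝒱 𝒰, polyMap D (polyMap s p) + polyMap s (polyMap D p) =
      p - 1 ⊗ₜ augPoly 𝒱 𝒰 p + polyMap D (polyMap s (1 ⊗ₜ augPoly 𝒱 𝒰 p)) := by
    intro p
    induction p using TensorProduct.induction_on with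
    | zero => simp
    | tmul z g =>
      have h := hs.homotopy (z - aug 𝒱 𝒰 z • 1) (by
        rw [map_sub, map_smul, aug_one, smul_eq_mul, mul_one, sub_self])
      simp only [map_sub, map_smul, D_one hD, smul_zero, sub_zero] at h
      have h' : D (s z) + s (D z) = z - aug 𝒱 𝒰 z • 1 + aug 𝒱 𝒰 z • D (s 1) := by
        rw [← h]; abel
      rw [augPoly_tmul, TensorProduct.tmul_smul, map_smul, map_smul]
      simp only [polyMap_tmul]
      rw [← TensorProduct.add_tmul, h', TensorProduct.add_tmul, TensorProduct.sub_tmul]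
      rfl
    | add p q h₁ h₂ =>
      simp only [map_add, TensorProduct.tmul_add] at h₁ h₂ ⊢
      rw [add_add_add_comm, h₁, h₂]; abel
  rw [key, hp]; simp

/-- The generators of `∧V ⊗ ∧U`. -/
inductive IsGenerator : Extension 𝒱 𝒰 → Prop
  | V (v : V) : IsGenerator (FreeGCA.ι 𝒱 v ᵍ⊗ₜ[ℚ] 1)
  | U (u : U) : IsGenerator (1 ᵍ⊗ₜ[ℚ] FreeGCA.ι 𝒰 u)

theorem IsGenerator.aug_eq {w : Extension 𝒱 𝒰} (hw : IsGenerator w) : aug 𝒱 𝒰 w = 0 := by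
  cases hw with
  | V v => exact aug_ι_tmul_one v
  | U u => exact aug_one_tmul_ι u

/-- The path `w ↦ w t` on generators, without `dt` part. It need not respect differentials and only
starts the iteration. -/
theorem exists_isPath_base : ∃ H₀ H₁, IsPath (𝒱 := 𝒱) (𝒰 := 𝒰) H₀ H₁ := by
  obtain ⟨H₀, H₁, h, -⟩ := exists_isPath (𝒱 := 𝒱) (𝒰 := 𝒰)
    ((TensorProduct.mk ℚ _ (Polynomial ℚ)).flip Polynomial.X) 0
    (fun z => by simp [sgnPoly_tmul]) (fun z => by simp)
    (fun z hz => by simp [augPoly_tmul, hz]) (fun z hz => by simp)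
    (fun z hz => by simp [evalPoly_tmul]) (fun z hz => by simp [evalPoly_tmul])
  exact ⟨H₀, H₁, h⟩

/-- The chain equations at a generator `w` are solved by contracting the data at `D w`. The
correction to `w t` vanishes at `t = 0` and `t = 1`, where `H₀(D w)` and `D w t` agree, so the end
points are kept. -/
theorem IsPath.exists_next {s : Extension 𝒱 𝒰 →ₗ[ℚ] Extension 𝒱 𝒰} (hs : IsContraction D s)
    (hD : IsAcyclicClosure S D) {H₀ : Extension 𝒱 𝒰 →ₐ[ℚ] Poly 𝒱 𝒰}
    {H₁ : Extension 𝒱 𝒰 →ₗ[ℚ] Poly 𝒱 𝒰} (h : IsPath H₀ H₁) :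
    ∃ H₀' H₁', IsPath (𝒱 := 𝒱) (𝒰 := 𝒰) H₀' H₁' ∧ ∀ w, IsGenerator w →
      H₀' w = w ⊗ₜ Polynomial.X + polyMap s (H₀ (D w) - D w ⊗ₜ Polynomial.X) ∧
      H₁' w = polyMap s (w ⊗ₜ 1 - H₁ (D w)) := by
  let X : Extension 𝒱 𝒰 →ₗ[ℚ] Poly 𝒱 𝒰 := (TensorProduct.mk ℚ _ (Polynomial ℚ)).flip Polynomial.X
  let C : Extension 𝒱 𝒰 →ₗ[ℚ] Poly 𝒱 𝒰 := (TensorProduct.mk ℚ _ (Polynomial ℚ)).flip 1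
  let F₀ : Extension 𝒱 𝒰 →ₗ[ℚ] Poly 𝒱 𝒰 := X + polyMap s ∘ₗ (H₀.toLinearMap - X) ∘ₗ D
  let F₁ : Extension 𝒱 𝒰 →ₗ[ℚ] Poly 𝒱 𝒰 := polyMap s ∘ₗ (C - H₁ ∘ₗ D)
  have hF₀ : ∀ w, F₀ w = w ⊗ₜ Polynomial.X + polyMap s (H₀ (D w) - D w ⊗ₜ Polynomial.X) :=
    fun w => rfl
  have hF₁ : ∀ w, F₁ w = polyMap s (w ⊗ₜ 1 - H₁ (D w)) := fun w => rfl
  have hDs := D_sgn hD.isDifferential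
  obtain ⟨H₀', H₁', h', e1, e2, e3, e4⟩ := exists_isPath F₀ F₁
    (fun z => by
      have e : H₀ (D (sgn 𝒱 𝒰 z)) - D (sgn 𝒱 𝒰 z) ⊗ₜ Polynomial.X =
          -sgnPoly 𝒱 𝒰 (H₀ (D z) - D z ⊗ₜ Polynomial.X) := by
        rw [hDs, map_neg, h.sgn₀, map_sub, sgnPoly_tmul, TensorProduct.neg_tmul]; abel
      rw [hF₀, hF₀, e, map_neg, polyMap_sgnPoly hs.sgn_eq, neg_neg, map_add, sgnPoly_tmul])
    (fun z => by
      have e : sgn 𝒱 𝒰 z ⊗ₜ 1 - H₁ (D (sgn 𝒱 𝒰 z)) = sgnPoly 𝒱 𝒰 (z ⊗ₜ 1 - H₁ (D z)) := by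
        rw [hDs, map_neg, h.sgn₁, map_sub, sgnPoly_tmul, neg_neg]
      rw [hF₁, hF₁, e, polyMap_sgnPoly hs.sgn_eq])
    (fun z hz => by rw [hF₀, map_add, hs.augPoly_eq, augPoly_tmul, hz, zero_smul, zero_add])
    (fun z hz => by rw [hF₁, hs.augPoly_eq])
    (fun z hz => by
      rw [hF₀, map_add, evalPoly_tmul, evalPoly_polyMap, map_sub, h.eval₀, evalPoly_tmul,
        aug_D hD]
      simp)
    (fun z hz => by
      rw [hF₀, map_add, evalPoly_tmul, evalPoly_polyMap, map_sub, h.eval₁, evalPoly_tmul]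
      simp)
  refine ⟨H₀', H₁', h', fun w hw => ?_⟩
  cases hw with
  | V v => exact ⟨e1 v, e2 v⟩
  | U u => exact ⟨e3 u, e4 u⟩

/-- `H` is compatible with the differentials at `z`. -/
def IsChainAt (D : Extension 𝒱 𝒰 →ₗ[ℚ] Extension 𝒱 𝒰) (H₀ : Extension 𝒱 𝒰 →ₐ[ℚ] Poly 𝒱 𝒰)
    (H₁ : Extension 𝒱 𝒰 →ₗ[ℚ] Poly 𝒱 𝒰) (z : Extension 𝒱 𝒰) : Prop :=
  polyMap D (H₀ z) = H₀ (D z) ∧ polyDeriv 𝒱 𝒰 (H₀ z) = H₁ (D z) + polyMap D (H₁ z)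

theorem poly_neg_mul (p q : Poly 𝒱 𝒰) : -p * q = -(p * q) := neg_mul p q

/-- A multiplicative map that intertwines two derivations on the factors intertwines them on the
product; the proof is the bookkeeping of signs. -/
theorem IsPath.isChainAt_mul (hD : IsAcyclicClosure S D) {H₀ : Extension 𝒱 𝒰 →ₐ[ℚ] Poly 𝒱 𝒰}
    {H₁ : Extension 𝒱 𝒰 →ₗ[ℚ] Poly 𝒱 𝒰} (h : IsPath H₀ H₁) {z w : Extension 𝒱 𝒰}
    (hz : IsChainAt D H₀ H₁ z) (hw : IsChainAt D H₀ H₁ w) : IsChainAt D H₀ H₁ (z * w) := by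
  have hDs := D_sgn hD.isDifferential
  constructor
  · rw [map_mul, polyMap_D_mul hD.isDifferential, leibniz hD.isDifferential, map_add, map_mul,
      map_mul, h.sgn₀, hz.1, hw.1]
  · rw [map_mul, polyDeriv_mul, leibniz hD.isDifferential, map_add, h.mul, h.mul, h.mul, map_add,
      polyMap_D_mul hD.isDifferential, polyMap_D_mul hD.isDifferential, polyMap_sgnPoly hDs,
      h.sgn₀, h.sgn₁, sgnPoly_sgnPoly, hz.1, hw.1, hz.2, hw.2, poly_neg_mul, poly_neg_mul]
    simp only [add_mul, mul_add]
    abel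

theorem exists_isPath_seq {s : Extension 𝒱 𝒰 →ₗ[ℚ] Extension 𝒱 𝒰} (hs : IsContraction D s)
    (hD : IsAcyclicClosure S D) : ∃ (H₀ : ℕ → Extension 𝒱 𝒰 →ₐ[ℚ] Poly 𝒱 𝒰)
      (H₁ : ℕ → Extension 𝒱 𝒰 →ₗ[ℚ] Poly 𝒱 𝒰), (∀ n, IsPath (H₀ n) (H₁ n)) ∧
      ∀ n w, IsGenerator w →
        H₀ (n + 1) w = w ⊗ₜ Polynomial.X + polyMap s (H₀ n (D w) - D w ⊗ₜ Polynomial.X) ∧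
        H₁ (n + 1) w = polyMap s (w ⊗ₜ 1 - H₁ n (D w)) := by
  obtain ⟨B₀, B₁, hB⟩ := exists_isPath_base (𝒱 := 𝒱) (𝒰 := 𝒰)
  let P := {p : (Extension 𝒱 𝒰 →ₐ[ℚ] Poly 𝒱 𝒰) × (Extension 𝒱 𝒰 →ₗ[ℚ] Poly 𝒱 𝒰) // IsPath p.1 p.2}
  have hnext : ∀ p : P, ∃ q : P, ∀ w, IsGenerator w →
      q.1.1 w = w ⊗ₜ Polynomial.X + polyMap s (p.1.1 (D w) - D w ⊗ₜ Polynomial.X) ∧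
      q.1.2 w = polyMap s (w ⊗ₜ 1 - p.1.2 (D w)) := by
    rintro ⟨⟨p₀, p₁⟩, hp⟩
    obtain ⟨q₀, q₁, hq, h⟩ := hp.exists_next hs hD
    exact ⟨⟨⟨q₀, q₁⟩, hq⟩, h⟩
  choose next hn using hnext
  let H : ℕ → P := fun n => Nat.rec ⟨⟨B₀, B₁⟩, hB⟩ (fun _ p => next p) n
  exact ⟨fun n => (H n).1.1, fun n => (H n).1.2, fun n => (H n).2, fun n => hn (H n)⟩

/-- The recursion at `w` involves only `D w`, and both `V` and `U` are exhausted by filtrations that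
`D` lowers. Hence at each element the sequence of paths is eventually constant, and its eventual
value satisfies the chain equations. -/
theorem exists_isChainAt (hD : IsAcyclicClosure S D) {w : Extension 𝒱 𝒰} (hw : IsGenerator w) :
    ∃ H₀ H₁, IsPath (𝒱 := 𝒱) (𝒰 := 𝒰) H₀ H₁ ∧ IsChainAt D H₀ H₁ w := by
  obtain ⟨s, hs⟩ := exists_isContraction hD
  obtain ⟨H₀, H₁, hpath, hnext⟩ := exists_isPath_seq hs hD
  let Good : Extension 𝒱 𝒰 → Prop := fun z => ∃ m, ∀ m' ≥ m, H₀ m' z = H₀ m z ∧ H₁ m' z = H₁ m z ∧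
    IsChainAt D (H₀ m') (H₁ m') z
  have hone : Good 1 := ⟨0, fun m' _ => by
    refine ⟨by simp, by rw [(hpath _).map_one, (hpath _).map_one], ?_, ?_⟩
    · rw [map_one, D_one hD, map_zero, Algebra.TensorProduct.one_def, polyMap_tmul, D_one hD,
        TensorProduct.zero_tmul]
    · rw [map_one, D_one hD, map_zero, Algebra.TensorProduct.one_def, polyDeriv_tmul,
        (hpath _).map_one, Polynomial.derivative_one, TensorProduct.tmul_zero, map_zero, add_zero]⟩
  have hadd : ∀ z w, Good z → Good w → Good (z + w) := by
    rintro z w ⟨m, hm⟩ ⟨n, hn⟩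
    refine ⟨max m n, fun k hk => ?_⟩
    obtain ⟨a1, a2, a3, a4⟩ := hm k (le_trans (le_max_left _ _) hk)
    obtain ⟨b1, b2, b3, b4⟩ := hn k (le_trans (le_max_right _ _) hk)
    obtain ⟨c1, c2, -⟩ := hm _ (le_max_left m n)
    obtain ⟨d1, d2, -⟩ := hn _ (le_max_right m n)
    refine ⟨?_, ?_, ?_, ?_⟩
    · rw [map_add, map_add, a1, b1, c1, d1]
    · rw [map_add, map_add, a2, b2, c2, d2]
    · simp only [map_add, a3, b3]
    · simp only [map_add, a4, b4]; abel
  have hsmul : ∀ (r : ℚ) z, Good z → Good (r • z) := by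
    rintro r z ⟨m, hm⟩
    refine ⟨m, fun k hk => ?_⟩
    obtain ⟨a1, a2, a3, a4⟩ := hm k hk
    refine ⟨?_, ?_, ?_, ?_⟩
    · rw [map_smul, map_smul, a1]
    · rw [map_smul, map_smul, a2]
    · simp only [map_smul, a3]
    · simp only [map_smul, a4, smul_add]
  have hzero : Good 0 := by
    have := hsmul 0 _ hone
    rwa [zero_smul] at this
  have tz : (0 : FreeGCA 𝒱) ᵍ⊗ₜ[ℚ] (1 : FreeGCA 𝒰) = (0 : Extension 𝒱 𝒰) :=
    TensorProduct.zero_tmul _ _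
  have tz' : (1 : FreeGCA 𝒱) ᵍ⊗ₜ[ℚ] (0 : FreeGCA 𝒰) = (0 : Extension 𝒱 𝒰) :=
    TensorProduct.tmul_zero _ _
  have hmul : ∀ z w, Good z → Good w → Good (z * w) := by
    rintro z w ⟨m, hm⟩ ⟨n, hn⟩
    refine ⟨max m n, fun k hk => ?_⟩
    obtain ⟨a1, a2, a3⟩ := hm k (le_trans (le_max_left _ _) hk)
    obtain ⟨b1, b2, b3⟩ := hn k (le_trans (le_max_right _ _) hk)
    obtain ⟨c1, c2, -⟩ := hm _ (le_max_left m n)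
    obtain ⟨d1, d2, -⟩ := hn _ (le_max_right m n)
    refine ⟨?_, ?_, (hpath k).isChainAt_mul hD a3 b3⟩
    · rw [map_mul, map_mul, a1, b1, c1, d1]
    · rw [(hpath k).mul, (hpath _).mul, a1, a2, b1, b2, c1, d1, c2, d2]
  -- Stage `k + 1` at `w` is computed from stage `k` at `D w`, so stability reaches `w` one stage
  -- later. As `D² = 0`, the homotopy identity of `s` converts the recursion into the chain
  -- equations.
  have hgen : ∀ w, IsGenerator w → Good (D w) → Good w := by
    rintro w hw ⟨m, hm⟩
    refine ⟨m + 1, fun m' hm' => ?_⟩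
    obtain ⟨k, rfl⟩ : ∃ k, m' = k + 1 := ⟨m' - 1, by omega⟩
    obtain ⟨a1, a2, a3, a4⟩ := hm k (by omega)
    obtain ⟨b1, b2, -⟩ := hm (k + 1) (by omega)
    rw [hD.isDifferential.sq, map_zero] at a3
    rw [hD.isDifferential.sq, map_zero, zero_add] at a4
    obtain ⟨n1, n2⟩ := hnext k w hw
    refine ⟨?_, ?_, ?_, ?_⟩
    · rw [n1, (hnext m w hw).1, a1]
    · rw [n2, (hnext m w hw).2, a2]
    · have h := hs.poly_homotopy hD (p := H₀ k (D w) - D w ⊗ₜ Polynomial.X) (by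
        rw [map_sub, (hpath k).aug₀, augPoly_tmul, aug_D hD]; simp)
      rw [map_sub (polyMap D), a3, polyMap_tmul, hD.isDifferential.sq, TensorProduct.zero_tmul,
        sub_zero, map_zero, add_zero] at h
      rw [n1, map_add, h, polyMap_tmul, b1, a1]; abel
    · have h := hs.poly_homotopy hD (p := w ⊗ₜ 1 - H₁ k (D w)) (by
        rw [map_sub, (hpath k).aug₁, augPoly_tmul, hw.aug_eq]; simp)
      rw [← n2, ← eq_sub_iff_add_eq] at h
      rw [h, b2, a2, n1, map_add, polyDeriv_tmul, polyDeriv_polyMap, map_sub, a4, polyDeriv_tmul,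
        Polynomial.derivative_X, map_sub, a2, map_sub, polyMap_tmul, map_sub]
      abel
  have hV : ∀ n, ∀ v ∈ sullivanFiltration 𝒱 S.d n, Good (FreeGCA.ι 𝒱 v ᵍ⊗ₜ[ℚ] 1) := by
    intro n
    induction n with
    | zero =>
      intro v hv
      apply hgen _ (.V v)
      have hv' : S.d (FreeGCA.ι 𝒱 v) = 0 := hv
      rw [D_ιV hD, hv', tz]
      exact hzero
    | succ n ih =>
      intro v hv
      apply hgen _ (.V v)
      rw [D_ιV hD]
      have hv' : S.d (FreeGCA.ι 𝒱 v) ∈ FreeGCA.sub 𝒱 (sullivanFiltration 𝒱 S.d n) := hv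
      generalize S.d (FreeGCA.ι 𝒱 v) = y at hv'
      induction hv' using Algebra.adjoin_induction with
      | mem x hx => obtain ⟨w, hw, rfl⟩ := hx; exact ih w hw
      | algebraMap r => rw [Algebra.algebraMap_eq_smul_one, smul_tmul]; exact hsmul _ _ hone
      | add a b _ _ h₁ h₂ => rw [add_tmul]; exact hadd _ _ h₁ h₂
      | mul a b _ _ h₁ h₂ => rw [← tmul_one_mul_tmul]; exact hmul _ _ h₁ h₂
  have hV' : ∀ a : FreeGCA 𝒱, Good (a ᵍ⊗ₜ[ℚ] 1) := by
    intro a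
    induction a using FreeGCA.monomial_induction with
    | one => exact hone
    | add a b h₁ h₂ => rw [add_tmul]; exact hadd _ _ h₁ h₂
    | smul r a h => rw [smul_tmul]; exact hsmul _ _ h
    | ι_mul i v a hv h =>
      rw [← tmul_one_mul_tmul]
      obtain ⟨n, hn⟩ := S.sullivan v
      exact hmul _ _ (hV n v hn) h
  have hU : ∀ n, ∀ u ∈ filtration D n, Good (1 ᵍ⊗ₜ[ℚ] FreeGCA.ι 𝒰 u) := by
    intro n
    induction n with
    | zero =>
      intro u hu
      have hu' : u = 0 := hu
      rw [hu', map_zero, tz']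
      exact hzero
    | succ n ih =>
      intro u hu
      apply hgen _ (.U u)
      have hu' : D (1 ᵍ⊗ₜ[ℚ] FreeGCA.ι 𝒰 u) ∈ sub 𝒱 𝒰 (filtration D n) := hu
      generalize D (1 ᵍ⊗ₜ[ℚ] FreeGCA.ι 𝒰 u) = y at hu' ⊢
      induction hu' using Submodule.span_induction with
      | mem z hz =>
        obtain ⟨a, b, hb, rfl⟩ := hz
        rw [tmul_eq_mul]
        refine hmul _ _ (hV' a) ?_
        induction hb using Algebra.adjoin_induction with
        | mem x hx => obtain ⟨w, hw, rfl⟩ := hx; exact ih w hw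
        | algebraMap r => rw [Algebra.algebraMap_eq_smul_one, tmul_smul]; exact hsmul _ _ hone
        | add a b _ _ h₁ h₂ => rw [tmul_add]; exact hadd _ _ h₁ h₂
        | mul a b _ _ h₁ h₂ => rw [one_tmul_mul]; exact hmul _ _ h₁ h₂
      | zero => exact hzero
      | add a b _ _ h₁ h₂ => exact hadd _ _ h₁ h₂
      | smul r a _ h => exact hsmul _ _ h
  obtain ⟨m, hm⟩ : Good w := by
    cases hw with
    | V v => exact hV' _
    | U u =>
      obtain ⟨k, hk⟩ := hD.nilpotent u
      exact hU k u hk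
  exact ⟨H₀ m, H₁ m, hpath m, (hm m le_rfl).2.2⟩

/-- The integral of a polynomial over `[0, 1]`. -/
def polyIntegral : Polynomial ℚ →ₗ[ℚ] ℚ :=
  Polynomial.lsum fun n => ((n : ℚ) + 1)⁻¹ • LinearMap.id

theorem polyIntegral_derivative (p : Polynomial ℚ) :
    polyIntegral (Polynomial.derivative p) = p.eval 1 - p.eval 0 := by
  induction p using Polynomial.induction_on' with
  | add p q h₁ h₂ => simp only [map_add, h₁, h₂, Polynomial.eval_add]; ring
  | monomial n a =>
    rw [Polynomial.derivative_monomial, polyIntegral, Polynomial.lsum_apply]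
    rcases n with _ | n
    · simp
    · rw [Polynomial.sum_monomial_index _ _ (by simp)]
      simp only [Nat.add_sub_cancel, LinearMap.smul_apply, LinearMap.id_apply, smul_eq_mul,
        Polynomial.eval_monomial]
      have : (n : ℚ) + 1 ≠ 0 := by positivity
      push_cast
      field_simp
      simp

variable (𝒱 𝒰) in
/-- Integration over `[0, 1]`. -/
def integral : Poly 𝒱 𝒰 →ₗ[ℚ] Extension 𝒱 𝒰 :=
  (TensorProduct.rid ℚ (Extension 𝒱 𝒰)).toLinearMap ∘ₗ LinearMap.lTensor _ polyIntegral

theorem integral_tmul (z : Extension 𝒱 𝒰) (p : Polynomial ℚ) :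
    integral 𝒱 𝒰 (z ⊗ₜ p) = polyIntegral p • z := rfl

theorem integral_polyMap (f : Extension 𝒱 𝒰 →ₗ[ℚ] Extension 𝒱 𝒰) (p : Poly 𝒱 𝒰) :
    integral 𝒱 𝒰 (polyMap f p) = f (integral 𝒱 𝒰 p) := by
  induction p using TensorProduct.induction_on with
  | zero => simp
  | tmul z g => rw [polyMap_tmul, integral_tmul, integral_tmul, map_smul]
  | add p q h₁ h₂ => simp only [map_add, h₁, h₂]

theorem integral_polyDeriv (p : Poly 𝒱 𝒰) :
    integral 𝒱 𝒰 (polyDeriv 𝒱 𝒰 p) = evalPoly 𝒱 𝒰 1 p - evalPoly 𝒱 𝒰 0 p := by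
  induction p using TensorProduct.induction_on with
  | zero => simp
  | tmul z g =>
    rw [polyDeriv_tmul, integral_tmul, polyIntegral_derivative, evalPoly_tmul, evalPoly_tmul,
      sub_smul]
  | add p q h₁ h₂ => simp only [map_add, h₁, h₂]; abel

section

variable {M : Type*} [AddCommGroup M] [Module ℚ M] {l : Extension 𝒱 𝒰 →ₗ[ℚ] M}

/-- Such an `l` kills products of two elements of the augmentation ideal; this holds coefficientwise
in `t`, hence after integration. -/
theorem apply_integral_mul (hl : ∀ z w, l (z * w) = aug 𝒱 𝒰 z • l w + aug 𝒱 𝒰 w • l z)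
    {p q : Poly 𝒱 𝒰} (hp : augPoly 𝒱 𝒰 p = 0) (hq : augPoly 𝒱 𝒰 q = 0) :
    l (integral 𝒱 𝒰 (p * q)) = 0 := by
  have key : ∀ p q : Poly 𝒱 𝒰,
      l (integral 𝒱 𝒰 ((p - 1 ⊗ₜ augPoly 𝒱 𝒰 p) * (q - 1 ⊗ₜ augPoly 𝒱 𝒰 q))) = 0 := by
    intro p q
    induction p using TensorProduct.induction_on with
    | zero => simp
    | add p p' h₁ h₂ =>
      rw [map_add, TensorProduct.tmul_add, add_sub_add_comm, add_mul, map_add, map_add, h₁, h₂,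
        add_zero]
    | tmul z f =>
      induction q using TensorProduct.induction_on with
      | zero => simp
      | add p p' h₁ h₂ =>
        rw [map_add, TensorProduct.tmul_add, add_sub_add_comm, mul_add, map_add, map_add, h₁, h₂,
          add_zero]
      | tmul w g =>
        rw [augPoly_tmul, augPoly_tmul, ← TensorProduct.smul_tmul, ← TensorProduct.smul_tmul,
          ← TensorProduct.sub_tmul, ← TensorProduct.sub_tmul, Algebra.TensorProduct.tmul_mul_tmul,
          integral_tmul, map_smul, hl]
        simp [aug_one]
  have h := key p q
  rwa [hp, hq, TensorProduct.tmul_zero, sub_zero, sub_zero] at h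

/-- For a generator `w`, modulo products of two elements of augmentation zero, `H₁(w z)` is `ε(z)
H₁(w)`. So the linear part of `∫ H₁` depends only on the linear part of its argument. -/
theorem IsPath.apply_integral {H₀ : Extension 𝒱 𝒰 →ₐ[ℚ] Poly 𝒱 𝒰}
    {H₁ : Extension 𝒱 𝒰 →ₗ[ℚ] Poly 𝒱 𝒰} (h : IsPath H₀ H₁)
    (hl : ∀ z w, l (z * w) = aug 𝒱 𝒰 z • l w + aug 𝒱 𝒰 w • l z) (z : Extension 𝒱 𝒰) :
    l (integral 𝒱 𝒰 (H₁ z)) = l (integral 𝒱 𝒰 (H₁ (FreeGCA.ι 𝒱 (linV 𝒱 𝒰 z) ᵍ⊗ₜ[ℚ] 1))) +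
      l (integral 𝒱 𝒰 (H₁ (1 ᵍ⊗ₜ[ℚ] FreeGCA.ι 𝒰 (linU 𝒱 𝒰 z)))) := by
  have hmul : ∀ w z : Extension 𝒱 𝒰, aug 𝒱 𝒰 w = 0 → l (integral 𝒱 𝒰 (H₁ (w * z))) =
      aug 𝒱 𝒰 z • l (integral 𝒱 𝒰 (H₁ w)) := by
    intro w z hw
    have e : H₁ (w * z) = sgnPoly 𝒱 𝒰 (H₀ w) * H₁ z + H₁ w * (H₀ (z - aug 𝒱 𝒰 z • 1)) +
        aug 𝒱 𝒰 z • H₁ w := by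
      rw [h.mul, map_sub, map_smul, _root_.map_one, mul_sub, mul_smul_comm, mul_one]; abel
    rw [e, map_add, map_add, map_add, map_add, apply_integral_mul hl, apply_integral_mul hl,
      add_zero, zero_add, map_smul, map_smul]
    · exact h.aug₁ w
    · rw [h.aug₀, map_sub, map_smul, aug_one]; simp
    · rw [augPoly_sgnPoly, h.aug₀, hw, map_zero]
    · exact h.aug₁ z
  have tz : (0 : FreeGCA 𝒱) ᵍ⊗ₜ[ℚ] (1 : FreeGCA 𝒰) = (0 : Extension 𝒱 𝒰) :=
    TensorProduct.zero_tmul _ _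
  have tz' : (1 : FreeGCA 𝒱) ᵍ⊗ₜ[ℚ] (0 : FreeGCA 𝒰) = (0 : Extension 𝒱 𝒰) :=
    TensorProduct.tmul_zero _ _
  induction z using generator_induction with
  | one =>
    rw [h.map_one, one_eq, linV_tmul, linU_tmul, FreeGCA.lin_one, FreeGCA.lin_one]
    simp only [smul_zero, map_zero, tz, tz', add_zero]
  | add z w h₁ h₂ => simp only [map_add, h₁, h₂, add_tmul, tmul_add]; abel
  | smul r z h => simp only [map_smul, h, smul_tmul, tmul_smul, smul_add]
  | ιV_mul v z h =>
    rw [hmul _ _ (aug_ι_tmul_one v), linV_mul, linU_mul, aug_ι_tmul_one, linV_tmul, linU_tmul,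
      FreeGCA.aug_ι, FreeGCA.lin_ι]
    simp only [zero_smul, smul_zero, zero_add, map_zero, tz', add_zero, _root_.map_one, one_smul, map_smul,
      smul_tmul]
  | ιU_mul u z h =>
    rw [hmul _ _ (aug_one_tmul_ι u), linV_mul, linU_mul, aug_one_tmul_ι, linV_tmul, linU_tmul,
      FreeGCA.aug_ι, FreeGCA.lin_ι]
    simp only [zero_smul, smul_zero, zero_add, map_zero, tz, add_zero, _root_.map_one, one_smul, map_smul,
      tmul_smul]

end

/-- Integrating the chain equation gives `w = ∫ H₁(D w) + D ∫ H₁(w)`. The first summand has no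
linear part because `D w` has none, so `w` is a boundary up to decomposables. -/
theorem IsGenerator.exists_lin_eq (hD : IsAcyclicClosure S D) {w : Extension 𝒱 𝒰}
    (hw : IsGenerator w) (h0 : linV 𝒱 𝒰 (D w) = 0) :
    ∃ y, linV 𝒱 𝒰 w = linV 𝒱 𝒰 (D y) ∧ linU 𝒱 𝒰 w = linU 𝒱 𝒰 (D y) := by
  obtain ⟨H₀, H₁, h, hc⟩ := exists_isChainAt hD hw
  have e := integral_polyDeriv (H₀ w)
  rw [h.eval₁, h.eval₀, hw.aug_eq, map_zero, sub_zero, hc.2, map_add, integral_polyMap] at e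
  have tz : (0 : FreeGCA 𝒱) ᵍ⊗ₜ[ℚ] (1 : FreeGCA 𝒰) = (0 : Extension 𝒱 𝒰) :=
    TensorProduct.zero_tmul _ _
  have tz' : (1 : FreeGCA 𝒱) ᵍ⊗ₜ[ℚ] (0 : FreeGCA 𝒰) = (0 : Extension 𝒱 𝒰) :=
    TensorProduct.tmul_zero _ _
  refine ⟨integral 𝒱 𝒰 (H₁ w), ?_, ?_⟩
  · nth_rewrite 1 [← e]
    rw [map_add, h.apply_integral linV_mul, h0, linU_D hD]
    simp only [map_zero, tz, tz', zero_add]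
  · nth_rewrite 1 [← e]
    rw [map_add, h.apply_integral linU_mul, h0, linU_D hD]
    simp only [map_zero, tz, tz', zero_add]

/-- The linear part of the differential of an acyclic closure is an isomorphism `U ≅ V`. -/
theorem delta_bijective (hD : IsAcyclicClosure S D) : Function.Bijective (delta D) := by
  constructor
  · rw [← LinearMap.ker_eq_bot, LinearMap.ker_eq_bot']
    intro u hu
    -- A generator in `ker δ` is a boundary up to decomposables, but boundaries have no component in
    -- `U`.
    obtain ⟨y, -, h⟩ := (IsGenerator.U (𝒱 := 𝒱) (𝒰 := 𝒰) u).exists_lin_eq hD hu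
    rw [linU_D hD, linU_tmul, FreeGCA.lin_ι, map_one, one_smul] at h
    exact h
  · intro v
    obtain ⟨y, h, -⟩ := (IsGenerator.V (𝒱 := 𝒱) (𝒰 := 𝒰) v).exists_lin_eq hD (by
      rw [D_ιV hD, linV_tmul, S.lin_d, smul_zero])
    rw [linV_D hD, linV_tmul, FreeGCA.lin_ι, map_one, one_smul] at h
    exact ⟨_, h.symm⟩

end Extension
end Linearization

/-! ### Homogeneous components of vectors and of linear forms. -/

section Homogeneous

variable {V : Type u} [AddCommGroup V] [Module ℚ V] (𝒱 : ℕ → Submodule ℚ V)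
  [DirectSum.Decomposition 𝒱]

/-- The projection onto the component of degree `i`. -/
def gradedProj (i : ℕ) : V →ₗ[ℚ] V :=
  (𝒱 i).subtype ∘ₗ DirectSum.component ℚ ℕ (fun i => 𝒱 i) i ∘ₗ
    (DirectSum.decomposeLinearEquiv 𝒱).toLinearMap

variable {𝒱}

theorem gradedProj_mem (i : ℕ) (v : V) : gradedProj 𝒱 i v ∈ 𝒱 i := SetLike.coe_mem _

theorem gradedProj_of_mem {i : ℕ} {v : V} (hv : v ∈ 𝒱 i) : gradedProj 𝒱 i v = v :=
  DirectSum.decompose_of_mem_same 𝒱 hv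

theorem gradedProj_of_ne {i j : ℕ} {v : V} (hv : v ∈ 𝒱 i) (h : i ≠ j) : gradedProj 𝒱 j v = 0 :=
  DirectSum.decompose_of_mem_ne 𝒱 hv h

theorem exists_sum_gradedProj (v : V) :
    ∃ N, ∀ M ≥ N, ∑ i ∈ Finset.range M, gradedProj 𝒱 i v = v := by
  induction v using DirectSum.Decomposition.inductionOn 𝒱 with
  | zero => exact ⟨0, fun M _ => by simp⟩
  | @homogeneous i v =>
    refine ⟨i + 1, fun M hM => ?_⟩
    rw [Finset.sum_eq_single i]
    · exact gradedProj_of_mem v.2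
    · exact fun j _ hj => gradedProj_of_ne v.2 hj.symm
    · intro h; rw [Finset.mem_range] at h; omega
  | add v w hv hw =>
    obtain ⟨N, hN⟩ := hv
    obtain ⟨N', hN'⟩ := hw
    refine ⟨max N N', fun M hM => ?_⟩
    simp only [map_add, Finset.sum_add_distrib]
    rw [hN M (le_trans (le_max_left _ _) hM), hN' M (le_trans (le_max_right _ _) hM)]

variable (𝒱) in
/-- The component of degree `p` of a linear form, as an element of the homotopy Lie algebra. -/
def liePart (p : ℕ) : Module.Dual ℚ V →ₗ[ℚ] lie 𝒱 p :=
  LinearMap.codRestrict (lie 𝒱 p) (gradedProj 𝒱 (p + 1)).dualMap fun f j hj v hv => by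
    rw [LinearMap.dualMap_apply, gradedProj_of_ne hv hj, map_zero]

theorem liePart_apply (p : ℕ) (f : Module.Dual ℚ V) (v : V) :
    (liePart 𝒱 p f).1 v = f (gradedProj 𝒱 (p + 1) v) := rfl

theorem exists_sum_liePart (h0 : 𝒱 0 = ⊥) (v : V) :
    ∃ N, ∀ M ≥ N, ∀ f : Module.Dual ℚ V, ∑ p ∈ Finset.range M, (liePart 𝒱 p f).1 v = f v := by
  obtain ⟨N, hN⟩ := exists_sum_gradedProj (𝒱 := 𝒱) v
  refine ⟨N, fun M hM f => ?_⟩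
  have h := hN (M + 1) (by omega)
  -- The shift `p ↦ p + 1` between `L_V` and `V` misses only degree `0`, where `V` vanishes.
  have h1 : gradedProj 𝒱 0 v = 0 := by
    have := gradedProj_mem (𝒱 := 𝒱) 0 v
    rwa [h0, Submodule.mem_bot] at this
  rw [Finset.sum_range_succ', h1, add_zero] at h
  nth_rewrite 2 [← h]
  rw [map_sum]
  rfl

end Homogeneous

/-! ### The Euler derivation, invariants, vanishing of the quotient differential, and the bracket
relation. -/

section Invariants

variable {V : Type u} [AddCommGroup V] [Module ℚ V] {𝒱 : ℕ → Submodule ℚ V}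
  {U : Type v} [AddCommGroup U] [Module ℚ U] {𝒰 : ℕ → Submodule ℚ U}
  [DirectSum.Decomposition 𝒱] [DirectSum.Decomposition 𝒰]
  {S : MinimalSullivanAlgebra 𝒱} {D : Extension 𝒱 𝒰 →ₗ[ℚ] Extension 𝒱 𝒰}

namespace Extension

variable (𝒱 𝒰) in
/-- The projection `∧V ⊗ ∧U → V ⊗ ∧U`. -/
def linId : Extension 𝒱 𝒰 →ₗ[ℚ] V ⊗[ℚ] FreeGCA 𝒰 :=
  TensorProduct.map (FreeGCA.lin 𝒱) LinearMap.id ∘ₗ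
    (GradedTensorProduct.of ℚ (FreeGCA.gr 𝒱) (FreeGCA.gr 𝒰)).symm.toLinearMap

theorem linId_tmul (a : FreeGCA 𝒱) (b : FreeGCA 𝒰) :
    linId 𝒱 𝒰 (a ᵍ⊗ₜ[ℚ] b) = FreeGCA.lin 𝒱 a ⊗ₜ[ℚ] b := rfl

theorem exists_sum_slant (h0 : 𝒱 0 = ⊥) (z : Extension 𝒱 𝒰) :
    ∃ N, ∀ M ≥ N, ∀ f : Module.Dual ℚ V,
      ∑ p ∈ Finset.range M, slant 𝒱 𝒰 (FreeGCA.ev 𝒱 (liePart 𝒱 p f).1) z =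
        slant 𝒱 𝒰 (FreeGCA.ev 𝒱 f) z := by
  induction z using tmul_induction with
  | add z w h₁ h₂ =>
    obtain ⟨N, hN⟩ := h₁
    obtain ⟨N', hN'⟩ := h₂
    refine ⟨max N N', fun M hM f => ?_⟩
    simp only [map_add, Finset.sum_add_distrib]
    rw [hN M (le_trans (le_max_left _ _) hM), hN' M (le_trans (le_max_right _ _) hM)]
  | tmul a b =>
    obtain ⟨N, hN⟩ := exists_sum_liePart h0 (FreeGCA.lin 𝒱 a)
    refine ⟨N, fun M hM f => ?_⟩
    simp only [slant_tmul, FreeGCA.ev_eq]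
    rw [← Finset.sum_smul, hN M hM]

/-- On a fixed `z` every linear form on `V` acts as a finite sum of homogeneous ones, and the
coordinate forms of a basis detect elements of `V ⊗ ∧U`. -/
theorem linId_eq_zero (h0 : 𝒱 0 = ⊥) {z : Extension 𝒱 𝒰}
    (h : ∀ (p : ℕ) (x : lie 𝒱 p), slant 𝒱 𝒰 (FreeGCA.ev 𝒱 x.1) z = 0) : linId 𝒱 𝒰 z = 0 := by
  classical
  have h' : ∀ f : Module.Dual ℚ V, slant 𝒱 𝒰 (FreeGCA.ev 𝒱 f) z = 0 := by
    intro f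
    obtain ⟨N, hN⟩ := exists_sum_slant h0 z
    rw [← hN N le_rfl f]
    exact Finset.sum_eq_zero fun p _ => h p _
  let B := Module.Basis.ofVectorSpace ℚ V
  apply (TensorProduct.equivFinsuppOfBasisLeft (N := FreeGCA 𝒰) B).injective
  rw [map_zero]
  ext i
  rw [Finsupp.zero_apply, ← h' (B.coord i)]
  clear h h'
  induction z using tmul_induction with
  | add z w h₁ h₂ => simp only [map_add, Finsupp.add_apply, h₁, h₂]
  | tmul a b =>
    rw [linId_tmul, TensorProduct.equivFinsuppOfBasisLeft_apply_tmul_apply, slant_tmul,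
      FreeGCA.ev_eq]
    rfl

theorem linV_mem {n : ℕ} {z : Extension 𝒱 𝒰} (hz : z ∈ gr 𝒱 𝒰 n) : linV 𝒱 𝒰 z ∈ 𝒱 n := by
  induction hz using Submodule.span_induction with
  | mem z hz =>
    obtain ⟨i, j, a, b, rfl, ha, hb, rfl⟩ := hz
    rw [linV_tmul]
    by_cases hj : j = 0
    · subst hj; exact Submodule.smul_mem _ _ (FreeGCA.lin_mem ha)
    · rw [FreeGCA.aug_eq_zero hj hb, zero_smul]; exact zero_mem _
  | zero => rw [map_zero]; exact zero_mem _
  | add a b _ _ h₁ h₂ => rw [map_add]; exact add_mem h₁ h₂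
  | smul r a _ h => rw [map_smul]; exact Submodule.smul_mem _ _ h

theorem delta_mem (hD : IsDifferential (gr 𝒱 𝒰) D) {n : ℕ} {u : U} (hu : u ∈ 𝒰 n) :
    delta D u ∈ 𝒱 (n + 1) :=
  linV_mem (hD.degree _ _ (one_tmul_mem_gr (FreeGCA.ι_mem_gr hu)))

theorem delta_gradedProj (hD : IsDifferential (gr 𝒱 𝒰) D) (n : ℕ) (u : U) :
    delta D (gradedProj 𝒰 n u) = gradedProj 𝒱 (n + 1) (delta D u) := by
  induction u using DirectSum.Decomposition.inductionOn 𝒰 with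
  | zero => simp
  | @homogeneous i u =>
    by_cases h : i = n
    · subst h
      rw [gradedProj_of_mem u.2, gradedProj_of_mem (delta_mem hD u.2)]
    · rw [gradedProj_of_ne u.2 h, gradedProj_of_ne (delta_mem hD u.2) (by omega), map_zero]
  | add u w h₁ h₂ => simp only [map_add, h₁, h₂]

/-- The inverse of the linear part of the differential of an acyclic closure. -/
def deltaEquiv (hD : IsAcyclicClosure S D) : U ≃ₗ[ℚ] V :=
  LinearEquiv.ofBijective (delta D) (delta_bijective hD)

theorem deltaEquiv_apply (hD : IsAcyclicClosure S D) (u : U) : deltaEquiv hD u = delta D u := rfl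

theorem deltaEquiv_symm_mem (hD : IsAcyclicClosure S D) {n : ℕ} {v : V} (hv : v ∈ 𝒱 (n + 1)) :
    (deltaEquiv hD).symm v ∈ 𝒰 n := by
  have h : gradedProj 𝒰 n ((deltaEquiv hD).symm v) = (deltaEquiv hD).symm v := by
    apply (deltaEquiv hD).injective
    rw [deltaEquiv_apply, delta_gradedProj hD.isDifferential, ← deltaEquiv_apply hD,
      LinearEquiv.apply_symm_apply, gradedProj_of_mem hv]
  rw [← h]
  exact gradedProj_mem _ _

/-- The map `a ⊗ b ↦ δ⁻¹(lin a) b`, where `δ : U ≅ V` is the linear part of the differential. -/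
def contract (hD : IsAcyclicClosure S D) : Extension 𝒱 𝒰 →ₗ[ℚ] FreeGCA 𝒰 :=
  TensorProduct.lift ((LinearMap.mul ℚ (FreeGCA 𝒰)) ∘ₗ FreeGCA.ι 𝒰 ∘ₗ
    (deltaEquiv hD).symm.toLinearMap) ∘ₗ linId 𝒱 𝒰

theorem contract_tmul (hD : IsAcyclicClosure S D) (a : FreeGCA 𝒱) (b : FreeGCA 𝒰) :
    contract hD (a ᵍ⊗ₜ[ℚ] b) = FreeGCA.ι 𝒰 ((deltaEquiv hD).symm (FreeGCA.lin 𝒱 a)) * b := rfl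

theorem contract_mul_one_tmul (hD : IsAcyclicClosure S D) (z : Extension 𝒱 𝒰) (b : FreeGCA 𝒰) :
    contract hD (z * 1 ᵍ⊗ₜ[ℚ] b) = contract hD z * b := by
  induction z using tmul_induction with
  | add z w h₁ h₂ => rw [add_mul, map_add, h₁, h₂, map_add, add_mul]
  | tmul a c => rw [tmul_mul_one_tmul, contract_tmul, contract_tmul, mul_assoc]

/-- `δ⁻¹` lowers degree by one, so moving `b` across leaves exactly one extra sign `(-1)^{deg b}`.
It cancels the sign in the Leibniz rule of `D`, which makes `euler` an untwisted derivation. -/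
theorem contract_one_tmul_mul (hD : IsAcyclicClosure S D) (b : FreeGCA 𝒰) (z : Extension 𝒱 𝒰) :
    contract hD (1 ᵍ⊗ₜ[ℚ] b * z) = FreeGCA.sgn 𝒰 b * contract hD z := by
  induction b using FreeGCA.grade_induction with
  | add b c h₁ h₂ => rw [tmul_add, add_mul, map_add, h₁, h₂, map_add, add_mul]
  | homog j b hb =>
    induction z using homog_induction with
    | add z w h₁ h₂ => rw [mul_add, map_add, h₁, h₂, map_add, mul_add]
    | tmul i k a c ha hc =>
      rw [tmul_mul_tmul _ _ _ _ hb ha, one_mul, map_smul, contract_tmul, contract_tmul,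
        FreeGCA.sgn_apply hb]
      have hl := FreeGCA.lin_mem ha
      rcases i with _ | i
      · rw [S.pos, Submodule.mem_bot] at hl
        rw [hl]; simp
      · have e := FreeGCA.gr_mul_comm (FreeGCA.ι_mem_gr (deltaEquiv_symm_mem hD hl)) hb
        rw [← mul_assoc, e, smul_mul_assoc, smul_smul, smul_mul_assoc, mul_assoc]
        congr 1
        have e2 : (-1 : ℚ) ^ (i * j) * (-1 : ℚ) ^ (i * j) = 1 := by rw [← mul_pow]; simp
        rw [mul_add, pow_add, mul_one, mul_comm j i]
        linear_combination (-1 : ℚ) ^ j * e2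

/-- The Euler derivation of `∧U`. -/
def euler (hD : IsAcyclicClosure S D) : FreeGCA 𝒰 →ₗ[ℚ] FreeGCA 𝒰 :=
  contract hD ∘ₗ D ∘ₗ
    (GradedTensorProduct.includeRight (FreeGCA.gr 𝒱) (FreeGCA.gr 𝒰)).toLinearMap

theorem euler_apply (hD : IsAcyclicClosure S D) (Φ : FreeGCA 𝒰) :
    euler hD Φ = contract hD (D (1 ᵍ⊗ₜ[ℚ] Φ)) := rfl

theorem euler_mul (hD : IsAcyclicClosure S D) (Φ Ψ : FreeGCA 𝒰) :
    euler hD (Φ * Ψ) = euler hD Φ * Ψ + Φ * euler hD Ψ := by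
  simp only [euler_apply]
  rw [D_one_tmul_mul hD.isDifferential, map_add, contract_mul_one_tmul, contract_one_tmul_mul,
    FreeGCA.sgn_sgn]

theorem contract_sub_mem (hD : IsAcyclicClosure S D) (z : Extension 𝒱 𝒰) :
    contract hD z - FreeGCA.ι 𝒰 ((deltaEquiv hD).symm (linV 𝒱 𝒰 z)) ∈ FreeGCA.wedgeGE 𝒰 2 := by
  induction z using tmul_induction with
  | add z w h₁ h₂ =>
    simp only [map_add]
    rw [add_sub_add_comm]
    exact add_mem h₁ h₂
  | tmul a b =>
    rw [contract_tmul, linV_tmul, map_smul, map_smul, ← mul_one (FreeGCA.ι 𝒰 _),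
      ← mul_smul_comm, mul_assoc, one_mul, ← mul_sub, ← Algebra.algebraMap_eq_smul_one]
    exact FreeGCA.mul_mem_wedgeGE (k := 1) (l := 1) (FreeGCA.ι_mem_wedgeGE _)
      (FreeGCA.mem_wedgeGE_one_of_aug b)

theorem euler_ι_sub_mem (hD : IsAcyclicClosure S D) (u : U) :
    euler hD (FreeGCA.ι 𝒰 u) - FreeGCA.ι 𝒰 u ∈ FreeGCA.wedgeGE 𝒰 2 := by
  have h := contract_sub_mem hD (D (1 ᵍ⊗ₜ[ℚ] FreeGCA.ι 𝒰 u))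
  rwa [← delta_apply, ← deltaEquiv_apply hD, LinearEquiv.symm_apply_apply] at h

theorem euler_mem_wedgeGE_one (hD : IsAcyclicClosure S D) (Φ : FreeGCA 𝒰) :
    euler hD Φ ∈ FreeGCA.wedgeGE 𝒰 1 := by
  rw [euler_apply]
  induction D (1 ᵍ⊗ₜ[ℚ] Φ) using tmul_induction with
  | add z w h₁ h₂ => rw [map_add]; exact add_mem h₁ h₂
  | tmul a b =>
    rw [contract_tmul]
    exact FreeGCA.mul_mem_wedgeGE (k := 1) (l := 0) (FreeGCA.ι_mem_wedgeGE _)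
      (by rw [FreeGCA.wedgeGE_zero]; trivial)

/-- Modulo decomposables `euler` is the identity on generators; being a derivation, it acts as `q`
on the `q`th layer of the word length filtration. -/
theorem euler_sub_mem (hD : IsAcyclicClosure S D) (q : ℕ) {Φ : FreeGCA 𝒰}
    (hΦ : Φ ∈ FreeGCA.wedgeGE 𝒰 q) : euler hD Φ - (q : ℚ) • Φ ∈ FreeGCA.wedgeGE 𝒰 (q + 1) := by
  induction q generalizing Φ with
  | zero => simpa using euler_mem_wedgeGE_one hD Φ
  | succ q ih =>
    induction hΦ using FreeGCA.wedgeGE_succ_induction with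
    | add a b _ _ _ h₁ h₂ =>
      rw [map_add, smul_add, add_sub_add_comm]
      exact add_mem h₁ h₂
    | ι_mul v a _ ha =>
      have e : euler hD (FreeGCA.ι 𝒰 v * a) - ((q + 1 : ℕ) : ℚ) • (FreeGCA.ι 𝒰 v * a) =
          (euler hD (FreeGCA.ι 𝒰 v) - FreeGCA.ι 𝒰 v) * a +
            FreeGCA.ι 𝒰 v * (euler hD a - (q : ℚ) • a) := by
        rw [euler_mul, sub_mul, mul_sub, mul_smul_comm]
        push_cast
        rw [add_smul, one_smul]
        abel
      rw [e]
      refine add_mem ?_ ?_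
      · rw [show q + 1 + 1 = 2 + q by ring]
        exact FreeGCA.mul_mem_wedgeGE (euler_ι_sub_mem hD v) ha
      · rw [show q + 1 + 1 = 1 + (q + 1) by ring]
        exact FreeGCA.mul_mem_wedgeGE (FreeGCA.ι_mem_wedgeGE v) (ih ha)

/-- The invariants of the holonomy representation of the homotopy Lie algebra are the scalars. -/
theorem eq_zero_of_holonomyLie_eq_zero (hD : IsAcyclicClosure S D) {Φ : FreeGCA 𝒰}
    (h : ∀ (p : ℕ) (x : lie 𝒱 p), holonomyLie D x.1 Φ = 0) (haug : FreeGCA.aug 𝒰 Φ = 0) :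
    Φ = 0 := by
  -- `euler` depends only on the component of `D(1 ⊗ Φ)` in `V ⊗ ∧U`, which is zero for an
  -- invariant.
  have hE : euler hD Φ = 0 := by
    rw [euler_apply, contract, LinearMap.comp_apply, linId_eq_zero S.pos, map_zero]
    intro p x
    exact neg_eq_zero.mp (h p x)
  apply FreeGCA.eq_zero_of_forall_mem_wedgeGE
  intro k
  induction k with
  | zero => rw [FreeGCA.wedgeGE_zero]; trivial
  | succ k ih =>
    rcases k with _ | k
    · have h1 := FreeGCA.mem_wedgeGE_one_of_aug Φ
      rwa [haug, map_zero, sub_zero] at h1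
    -- Since `euler Φ = 0`, the nonzero eigenvalue `k + 1` pushes `Φ` one layer deeper.
    · have h1 := euler_sub_mem hD _ ih
      rw [hE, zero_sub, ← neg_smul] at h1
      have h2 := Submodule.smul_mem _ (-((k + 1 : ℕ) : ℚ))⁻¹ h1
      rwa [smul_smul, inv_mul_cancel₀, one_smul] at h2
      rw [neg_ne_zero]; positivity

theorem holonomyLie_apply (x : Module.Dual ℚ V) (Φ : FreeGCA 𝒰) :
    holonomyLie D x Φ = -component D (FreeGCA.ev 𝒱 x) Φ := rfl

theorem component_quotientDifferential (hD : IsAcyclicClosure S D) {p : ℕ} (x : lie 𝒱 p)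
    (Φ : FreeGCA 𝒰) : component D (FreeGCA.ev 𝒱 x.1) (quotientDifferential D Φ) =
      (-1 : ℚ) ^ p • quotientDifferential D (component D (FreeGCA.ev 𝒱 x.1) Φ) := by
  have h := slant_ev_D hD x (D (1 ᵍ⊗ₜ[ℚ] Φ))
  rw [hD.isDifferential.sq, map_zero, ← quotientDifferential_apply, ← component_apply, pow_succ,
    mul_neg_one, neg_smul, ← sub_eq_add_neg] at h
  exact (sub_eq_zero.mp h.symm)

theorem quotientDifferential_eq_zero_of_mem_sub (hD : IsAcyclicClosure S D) {Z : Submodule ℚ U}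
    (hZ : ∀ u ∈ Z, quotientDifferential D (FreeGCA.ι 𝒰 u) = 0) {Φ : FreeGCA 𝒰}
    (hΦ : Φ ∈ FreeGCA.sub 𝒰 Z) : quotientDifferential D Φ = 0 := by
  induction hΦ using Algebra.adjoin_induction with
  | mem x hx => obtain ⟨w, hw, rfl⟩ := hx; exact hZ w hw
  | algebraMap r =>
    rw [Algebra.algebraMap_eq_smul_one, map_smul, quotientDifferential_one hD.isDifferential,
      smul_zero]
  | add a b _ _ h₁ h₂ => rw [map_add, h₁, h₂, add_zero]
  | mul a b _ _ h₁ h₂ =>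
    rw [quotientDifferential_mul hD.isDifferential, h₁, h₂, zero_mul, mul_zero, add_zero]

/-- For `u` in one step of the filtration, `θ_x` carries `D̄u` to `± D̄(θ_x u)`, where `θ_x u`
involves only generators of the previous step. So `D̄u` is invariant with augmentation zero, hence
zero. -/
theorem quotientDifferential_eq_zero (hD : IsAcyclicClosure S D) : quotientDifferential D = 0 := by
  have key : ∀ k, ∀ u ∈ filtration D k, quotientDifferential D (FreeGCA.ι 𝒰 u) = 0 := by
    intro k
    induction k with
    | zero =>
      intro u hu
      have hu' : u = 0 := hu
      rw [hu', map_zero, map_zero]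
    | succ k ih =>
      intro u hu
      have hu' : D (1 ᵍ⊗ₜ[ℚ] FreeGCA.ι 𝒰 u) ∈ sub 𝒱 𝒰 (filtration D k) := hu
      refine eq_zero_of_holonomyLie_eq_zero hD (fun p x => ?_) (aug_quotientDifferential hD _)
      rw [holonomyLie_apply, component_quotientDifferential hD, component_apply,
        quotientDifferential_eq_zero_of_mem_sub hD ih (slant_mem_sub _ hu'), smul_zero, neg_zero]
  ext Φ
  refine quotientDifferential_eq_zero_of_mem_sub hD (Z := ⊤) (fun u _ => ?_) ?_
  · obtain ⟨k, hk⟩ := hD.nilpotent u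
    exact key k u hk
  · rw [FreeGCA.sub_top]; trivial

/-- This is the component of `D²(1 ⊗ Φ) = 0` in `∧²V ⊗ ∧U`, paired with `x` and `y`; the signs are
compared parity by parity. -/
theorem holonomyLie_holonomyLie (hD : IsAcyclicClosure S D) {p q : ℕ} (x : lie 𝒱 p) (y : lie 𝒱 q)
    (Φ : FreeGCA 𝒰) : holonomyLie D x.1 (holonomyLie D y.1 Φ) =
      (-1 : ℚ) ^ (p * q) • holonomyLie D y.1 (holonomyLie D x.1 Φ) +
        holonomyLie D (S.bracket x y).1 Φ := by
  have h0 := quotientDifferential_eq_zero hD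
  have h := slant_pairing_D hD h0 x y (D (1 ᵍ⊗ₜ[ℚ] Φ))
  rw [hD.isDifferential.sq, map_zero, ← quotientDifferential_apply, h0, LinearMap.zero_apply,
    map_zero, add_zero, ← component_apply, ← component_apply, ← component_apply] at h
  simp only [holonomyLie_apply, map_neg, neg_neg]
  rcases Nat.even_or_odd p with hp | hp <;> rcases Nat.even_or_odd q with hq | hq <;>
    simp only [pow_succ, pow_mul, hp.neg_one_pow, hq.neg_one_pow, one_pow, mul_one, mul_neg,
      neg_neg, neg_smul, one_smul] at h ⊢ <;>
    rw [← sub_eq_zero] <;> first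
    | (refine Eq.trans ?_ h.symm; abel1)
    | (refine neg_eq_zero.mp (Eq.trans ?_ h.symm); abel1)

end Extension
end Invariants

/-! ### Finiteness: exhaustion of `V` and `U` by finite pieces, and local nilpotence of the action.
-/

section Flags

variable {V : Type u} [AddCommGroup V] [Module ℚ V] {𝒱 : ℕ → Submodule ℚ V}
  {U : Type v} [AddCommGroup U] [Module ℚ U] {𝒰 : ℕ → Submodule ℚ U}
  [DirectSum.Decomposition 𝒱] [DirectSum.Decomposition 𝒰]
  {S : MinimalSullivanAlgebra 𝒱} {D : Extension 𝒱 𝒰 →ₗ[ℚ] Extension 𝒱 𝒰}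

namespace FreeGCA

theorem gradedProj_ι (n : ℕ) (v : V) :
    gradedProj (gr 𝒱) n (ι 𝒱 v) = ι 𝒱 (gradedProj 𝒱 n v) := by
  induction v using DirectSum.Decomposition.inductionOn 𝒱 with
  | zero => simp
  | @homogeneous i v =>
    by_cases h : i = n
    · subst h
      rw [gradedProj_of_mem v.2, gradedProj_of_mem (ι_mem_gr v.2)]
    · rw [gradedProj_of_ne v.2 h, gradedProj_of_ne (ι_mem_gr v.2) h, map_zero]
  | add u w h₁ h₂ => simp only [map_add, h₁, h₂]

theorem gradedProj_mem_sub {Z : Submodule ℚ V} (hZ : IsGraded 𝒱 Z) {a : FreeGCA 𝒱}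
    (ha : a ∈ sub 𝒱 Z) (n : ℕ) : gradedProj (gr 𝒱) n a ∈ sub 𝒱 Z := decompose_mem_sub hZ ha n

theorem sgn_pow_mem_sub {Z : Submodule ℚ V} (hZ : IsGraded 𝒱 Z) (p : ℕ) {a : FreeGCA 𝒱}
    (ha : a ∈ sub 𝒱 Z) : (sgn 𝒱 ^ p) a ∈ sub 𝒱 Z := by
  have hτ : ∀ {n : ℕ} {a : FreeGCA 𝒱}, a ∈ gr 𝒱 n → (sgn 𝒱 ^ p) a = (-1 : ℚ) ^ (p * n) • a :=
    fun ha => sgn_pow_apply p ha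
  generalize sgn 𝒱 ^ p = τ at hτ ⊢
  induction ha using sub_induction hZ with
  | one => rw [map_one]; exact one_mem _
  | add a b _ _ _ h₁ h₂ => rw [map_add]; exact add_mem h₁ h₂
  | smul r a _ _ h => rw [map_smul]; exact Subalgebra.smul_mem _ h r
  | ι_mul i v a _ _ hv hvZ h =>
    rw [map_mul, hτ (ι_mem_gr hv)]
    exact mul_mem (Subalgebra.smul_mem _ (ι_mem_sub hvZ) _) h

end FreeGCA

namespace MinimalSullivanAlgebra

theorem d_gradedProj (n : ℕ) (a : FreeGCA 𝒱) :
    S.d (gradedProj (FreeGCA.gr 𝒱) n a) = gradedProj (FreeGCA.gr 𝒱) (n + 1) (S.d a) := by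
  induction a using FreeGCA.grade_induction with
  | add a b h₁ h₂ => simp only [map_add, h₁, h₂]
  | homog i a ha =>
    by_cases h : i = n
    · subst h
      rw [gradedProj_of_mem ha, gradedProj_of_mem (S.isDifferential.degree _ _ ha)]
    · rw [gradedProj_of_ne ha h, gradedProj_of_ne (S.isDifferential.degree _ _ ha) (by omega),
        map_zero]

theorem d_mem_sub {W : Submodule ℚ V} (hW : FreeGCA.IsGraded 𝒱 W)
    (hd : ∀ v ∈ W, S.d (FreeGCA.ι 𝒱 v) ∈ FreeGCA.sub 𝒱 W) {a : FreeGCA 𝒱}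
    (ha : a ∈ FreeGCA.sub 𝒱 W) : S.d a ∈ FreeGCA.sub 𝒱 W := by
  induction ha using FreeGCA.sub_induction hW with
  | one => rw [S.isDifferential.map_one]; exact zero_mem _
  | add a b _ _ _ h₁ h₂ => rw [map_add]; exact add_mem h₁ h₂
  | smul r a _ _ h => rw [map_smul]; exact Subalgebra.smul_mem _ h r
  | ι_mul i v a ha _ hv hvW h =>
    rw [S.d_ι_mul hv]
    exact add_mem (mul_mem (hd v hvW) ha)
      (Subalgebra.smul_mem _ (mul_mem (FreeGCA.ι_mem_sub hvW) h) _)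

/-- The zero subspace as an element of the index set. -/
def Index.zero : S.Index where
  space := ⊥
  finite := inferInstance
  homogeneous := FreeGCA.isGraded_bot
  stable _ ha := d_mem_sub FreeGCA.isGraded_bot (fun v hv => by
    rw [(Submodule.mem_bot ℚ).mp hv, map_zero, map_zero]; exact zero_mem _) ha

/-- The index set is directed. -/
def Index.sup (α β : S.Index) : S.Index where
  space := α.space ⊔ β.space
  finite := by
    have := α.finite
    have := β.finite
    infer_instance
  homogeneous := FreeGCA.isGraded_sup α.homogeneous β.homogeneous
  stable _ ha := d_mem_sub (FreeGCA.isGraded_sup α.homogeneous β.homogeneous) (fun v hv => by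
    obtain ⟨a, ha, b, hb, rfl⟩ := Submodule.mem_sup.mp hv
    rw [map_add, map_add]
    exact add_mem (FreeGCA.sub_mono le_sup_left (α.stable _ (FreeGCA.ι_mem_sub ha)))
      (FreeGCA.sub_mono le_sup_right (β.stable _ (FreeGCA.ι_mem_sub hb)))) ha

theorem Index.le_sup_left (α β : S.Index) : α.space ≤ (α.sup β).space :=
  _root_.le_sup_left

theorem Index.le_sup_right (α β : S.Index) : β.space ≤ (α.sup β).space :=
  _root_.le_sup_right

theorem Index.exists_mem_of_homogeneous (α : S.Index) {i : ℕ} {v : V} (hv : v ∈ 𝒱 i)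
    (hd : S.d (FreeGCA.ι 𝒱 v) ∈ FreeGCA.sub 𝒱 α.space) : ∃ β : S.Index, v ∈ β.space := by
  have hgr : FreeGCA.IsGraded 𝒱 (α.space ⊔ Submodule.span ℚ {v}) :=
    FreeGCA.isGraded_sup α.homogeneous (FreeGCA.isGraded_span_singleton hv)
  refine ⟨⟨α.space ⊔ Submodule.span ℚ {v}, ?_, hgr, fun a ha => d_mem_sub hgr (fun w hw => ?_) ha⟩,
    Submodule.mem_sup_right (Submodule.mem_span_singleton_self v)⟩
  · have := α.finite
    infer_instance
  · obtain ⟨a, ha, b, hb, rfl⟩ := Submodule.mem_sup.mp hw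
    obtain ⟨r, rfl⟩ := Submodule.mem_span_singleton.mp hb
    rw [map_add, map_add, map_smul, map_smul]
    exact FreeGCA.sub_mono _root_.le_sup_left
      (add_mem (α.stable _ (FreeGCA.ι_mem_sub ha)) (Subalgebra.smul_mem _ hd r))

/-- If `d v` lies in some `∧V_α`, each homogeneous component of `v` can be adjoined to `V_α`. The
Sullivan filtration lets this reach every `v`. -/
theorem Index.exists_mem (v : V) : ∃ α : S.Index, v ∈ α.space := by
  let C : Submodule ℚ V :=
    { carrier := {v | ∃ α : S.Index, v ∈ α.space}
      zero_mem' := ⟨Index.zero, zero_mem _⟩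
      add_mem' := by
        rintro a b ⟨α, hα⟩ ⟨β, hβ⟩
        exact ⟨α.sup β, add_mem (α.le_sup_left β hα) (α.le_sup_right β hβ)⟩
      smul_mem' := by
        rintro r a ⟨α, hα⟩
        exact ⟨α, Submodule.smul_mem _ r hα⟩ }
  have key : ∀ v : V, (∃ α : S.Index, S.d (FreeGCA.ι 𝒱 v) ∈ FreeGCA.sub 𝒱 α.space) →
      v ∈ C := by
    rintro v ⟨α, hα⟩
    obtain ⟨N, hN⟩ := exists_sum_gradedProj (𝒱 := 𝒱) v
    rw [← hN N le_rfl]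
    refine Submodule.sum_mem _ fun i _ => ?_
    refine α.exists_mem_of_homogeneous (gradedProj_mem i v) ?_
    rw [← FreeGCA.gradedProj_ι, d_gradedProj]
    exact FreeGCA.gradedProj_mem_sub α.homogeneous hα _
  have hfil : ∀ n, ∀ v ∈ sullivanFiltration 𝒱 S.d n, v ∈ C := by
    intro n
    induction n with
    | zero =>
      intro v hv
      have hv' : S.d (FreeGCA.ι 𝒱 v) = 0 := hv
      exact key v ⟨Index.zero, by rw [hv']; exact zero_mem _⟩
    | succ n ih =>
      intro v hv
      have hv' : S.d (FreeGCA.ι 𝒱 v) ∈ FreeGCA.sub 𝒱 (sullivanFiltration 𝒱 S.d n) := hv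
      obtain ⟨Y, ⟨α, rfl⟩, hY⟩ := FreeGCA.exists_mem_sub (P := fun Y => ∃ α : S.Index, α.space = Y)
        ⟨Index.zero, rfl⟩ (by
          rintro _ _ ⟨α, rfl⟩ ⟨β, rfl⟩
          exact ⟨_, ⟨α.sup β, rfl⟩, α.le_sup_left β, α.le_sup_right β⟩) (by
          intro w hw
          obtain ⟨α, hα⟩ := ih w hw
          exact ⟨_, ⟨α, rfl⟩, hα⟩) hv'
      exact key v ⟨α, hY⟩
  obtain ⟨n, hn⟩ := S.sullivan v
  exact hfil n v hn

end MinimalSullivanAlgebra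

namespace Extension

variable (D) in
/-- The operators `θ_f` in `∧U`, as a linear map in `f`. -/
def holonomyHom : Module.Dual ℚ V →ₗ[ℚ] Module.End ℚ (FreeGCA 𝒰) where
  toFun := holonomyLie D
  map_add' f g := by
    ext Φ
    simp only [holonomyLie_apply, LinearMap.add_apply, component_apply]
    induction D (1 ᵍ⊗ₜ[ℚ] Φ) using tmul_induction with
    | add z w h₁ h₂ =>
      simp only [map_add, neg_add] at h₁ h₂ ⊢
      rw [h₁, h₂]; abel
    | tmul a b => simp only [slant_tmul, FreeGCA.ev_eq, LinearMap.add_apply, add_smul, neg_add]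
  map_smul' r f := by
    ext Φ
    simp only [holonomyLie_apply, LinearMap.smul_apply, component_apply, RingHom.id_apply]
    induction D (1 ᵍ⊗ₜ[ℚ] Φ) using tmul_induction with
    | add z w h₁ h₂ =>
      simp only [map_add, neg_add, smul_add] at h₁ h₂ ⊢
      rw [h₁, h₂]
    | tmul a b =>
      simp only [slant_tmul, FreeGCA.ev_eq, LinearMap.smul_apply, smul_neg, smul_smul, smul_eq_mul]

/-- The form `x` lives in degree `p + 1` of `V` and `D` adds one, so the twist is by `p + 2`, that
is by `p`. -/
theorem holonomyLie_mul (hD : IsDifferential (gr 𝒱 𝒰) D) {p : ℕ} (x : lie 𝒱 p) (Φ Ψ : FreeGCA 𝒰) :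
    holonomyLie D x.1 (Φ * Ψ) =
      holonomyLie D x.1 Φ * Ψ + (FreeGCA.sgn 𝒰 ^ p) Φ * holonomyLie D x.1 Ψ := by
  simp only [holonomyLie_apply]
  rw [component_mul hD (isConcentrated_ev x), FreeGCA.sgn_pow_add_two, neg_add, neg_mul, mul_neg]

theorem holonomyLie_one (hD : IsDifferential (gr 𝒱 𝒰) D) {p : ℕ} (x : lie 𝒱 p) :
    holonomyLie D x.1 1 = 0 := by
  have h := holonomyLie_mul hD x 1 1
  have h' : (FreeGCA.sgn 𝒰 ^ p) 1 = 1 := map_one _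
  rw [h', one_mul, one_mul, mul_one] at h
  exact left_eq_add.mp h

theorem holonomyLie_mem_gr (hD : IsDifferential (gr 𝒱 𝒰) D) {p m : ℕ} (x : lie 𝒱 p)
    {Φ : FreeGCA 𝒰} (hΦ : Φ ∈ FreeGCA.gr 𝒰 (p + m)) : holonomyLie D x.1 Φ ∈ FreeGCA.gr 𝒰 m :=
  neg_mem (component_mem_gr hD (isConcentrated_ev x) (by ring) hΦ)

theorem holonomyLie_eq_zero (hD : IsDifferential (gr 𝒱 𝒰) D) {p n : ℕ} (h : n < p) (x : lie 𝒱 p)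
    {Φ : FreeGCA 𝒰} (hΦ : Φ ∈ FreeGCA.gr 𝒰 n) : holonomyLie D x.1 Φ = 0 :=
  neg_eq_zero.mpr (component_eq_zero hD (isConcentrated_ev x) (by omega) hΦ)

theorem holonomyLie_sgn (hD : IsDifferential (gr 𝒱 𝒰) D) {p : ℕ} (x : lie 𝒱 p) (k : ℕ)
    (Φ : FreeGCA 𝒰) : holonomyLie D x.1 ((FreeGCA.sgn 𝒰 ^ k) Φ) =
      (-1 : ℚ) ^ (k * p) • (FreeGCA.sgn 𝒰 ^ k) (holonomyLie D x.1 Φ) := by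
  have hτ : ∀ {n : ℕ} {a : FreeGCA 𝒰}, a ∈ FreeGCA.gr 𝒰 n →
      (FreeGCA.sgn 𝒰 ^ k) a = (-1 : ℚ) ^ (k * n) • a := fun ha => FreeGCA.sgn_pow_apply k ha
  generalize FreeGCA.sgn 𝒰 ^ k = τ at hτ ⊢
  induction Φ using FreeGCA.grade_induction with
  | add a b h₁ h₂ => simp only [map_add, h₁, h₂, smul_add]
  | homog n a ha =>
    rw [hτ ha, map_smul]
    by_cases h : p ≤ n
    · obtain ⟨m, rfl⟩ := Nat.exists_eq_add_of_le h
      rw [hτ (holonomyLie_mem_gr hD x ha), smul_smul, mul_add, pow_add]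
    · rw [holonomyLie_eq_zero hD (by omega) x ha, smul_zero, map_zero, smul_zero]

/-- A form on `V` can have infinitely many homogeneous parts, but only finitely many act on a given
`Φ`. This reduces statements about `θ_f` to homogeneous `f`, for which it is a derivation. -/
theorem exists_sum_holonomyLie (h0 : 𝒱 0 = ⊥) (Φ : FreeGCA 𝒰) :
    ∃ N, ∀ M ≥ N, ∀ f : Module.Dual ℚ V,
      ∑ p ∈ Finset.range M, holonomyLie D (liePart 𝒱 p f).1 Φ = holonomyLie D f Φ := by
  obtain ⟨N, hN⟩ := exists_sum_slant h0 (D (1 ᵍ⊗ₜ[ℚ] Φ))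
  refine ⟨N, fun M hM f => ?_⟩
  rw [holonomyLie_apply, component_apply, ← hN M hM, ← Finset.sum_neg_distrib]
  rfl

theorem holonomyLie_mem_of_forall (h0 : 𝒱 0 = ⊥) {P : Submodule ℚ (FreeGCA 𝒰)} {Φ : FreeGCA 𝒰}
    (f : Module.Dual ℚ V) (h : ∀ p : ℕ, holonomyLie D (liePart 𝒱 p f).1 Φ ∈ P) :
    holonomyLie D f Φ ∈ P := by
  obtain ⟨N, hN⟩ := exists_sum_holonomyLie (D := D) h0 Φ
  rw [← hN N le_rfl]
  exact Submodule.sum_mem _ fun p _ => h p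

theorem aug_holonomyLie_ι (f : Module.Dual ℚ V) (u : U) :
    FreeGCA.aug 𝒰 (holonomyLie D f (FreeGCA.ι 𝒰 u)) = -f (delta D u) := by
  rw [apply_delta, holonomyLie_apply, map_neg]

variable (𝒱 𝒰) in
/-- The projection of `∧V ⊗ ∧U` onto its component of degree `n`. -/
def proj (n : ℕ) : Extension 𝒱 𝒰 →ₗ[ℚ] Extension 𝒱 𝒰 :=
  ∑ ij ∈ Finset.HasAntidiagonal.antidiagonal n,
    (GradedTensorProduct.of ℚ (FreeGCA.gr 𝒱) (FreeGCA.gr 𝒰)).toLinearMap ∘ₗ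
      TensorProduct.map (gradedProj (FreeGCA.gr 𝒱) ij.1) (gradedProj (FreeGCA.gr 𝒰) ij.2) ∘ₗ
      (GradedTensorProduct.of ℚ (FreeGCA.gr 𝒱) (FreeGCA.gr 𝒰)).symm.toLinearMap

theorem proj_tmul (n : ℕ) (a : FreeGCA 𝒱) (b : FreeGCA 𝒰) : proj 𝒱 𝒰 n (a ᵍ⊗ₜ[ℚ] b) =
    ∑ ij ∈ Finset.HasAntidiagonal.antidiagonal n, gradedProj (FreeGCA.gr 𝒱) ij.1 a ᵍ⊗ₜ[ℚ]
      gradedProj (FreeGCA.gr 𝒰) ij.2 b := by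
  rw [proj, LinearMap.sum_apply]
  rfl

theorem zero_tmul (b : FreeGCA 𝒰) : ((0 : FreeGCA 𝒱) ᵍ⊗ₜ[ℚ] b : Extension 𝒱 𝒰) = 0 :=
  TensorProduct.zero_tmul _ _

theorem tmul_zero (a : FreeGCA 𝒱) : (a ᵍ⊗ₜ[ℚ] (0 : FreeGCA 𝒰) : Extension 𝒱 𝒰) = 0 :=
  TensorProduct.tmul_zero _ _

theorem proj_tmul_eq {i j : ℕ} {a : FreeGCA 𝒱} {b : FreeGCA 𝒰} (ha : a ∈ FreeGCA.gr 𝒱 i)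
    (hb : b ∈ FreeGCA.gr 𝒰 j) (n : ℕ) :
    proj 𝒱 𝒰 n (a ᵍ⊗ₜ[ℚ] b) = if i + j = n then a ᵍ⊗ₜ[ℚ] b else 0 := by
  have hz : ∀ ij : ℕ × ℕ, ij ≠ (i, j) → (gradedProj (FreeGCA.gr 𝒱) ij.1 a ᵍ⊗ₜ[ℚ]
      gradedProj (FreeGCA.gr 𝒰) ij.2 b : Extension 𝒱 𝒰) = 0 := by
    rintro ⟨i', j'⟩ h
    by_cases hi : i = i'
    · have hj : j ≠ j' := by rintro rfl; exact h (by rw [hi])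
      rw [gradedProj_of_ne hb hj, tmul_zero]
    · rw [gradedProj_of_ne ha hi, zero_tmul]
  rw [proj_tmul]
  split_ifs with h
  · rw [Finset.sum_eq_single (i, j) (fun ij _ hij => hz ij hij)
      (fun h' => absurd (Finset.HasAntidiagonal.mem_antidiagonal.mpr h) h'), gradedProj_of_mem ha,
      gradedProj_of_mem hb]
  · refine Finset.sum_eq_zero fun ij hij => hz ij ?_
    rintro rfl
    exact h (Finset.HasAntidiagonal.mem_antidiagonal.mp hij)

theorem proj_of_mem {n : ℕ} {z : Extension 𝒱 𝒰} (hz : z ∈ gr 𝒱 𝒰 n) : proj 𝒱 𝒰 n z = z := by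
  induction hz using Submodule.span_induction with
  | mem z hz =>
    obtain ⟨i, j, a, b, rfl, ha, hb, rfl⟩ := hz
    rw [proj_tmul_eq ha hb, if_pos rfl]
  | zero => rw [map_zero]
  | add a b _ _ h₁ h₂ => rw [map_add, h₁, h₂]
  | smul r a _ h => rw [map_smul, h]

theorem proj_of_ne {m n : ℕ} {z : Extension 𝒱 𝒰} (hz : z ∈ gr 𝒱 𝒰 m) (h : m ≠ n) :
    proj 𝒱 𝒰 n z = 0 := by
  induction hz using Submodule.span_induction with
  | mem z hz =>
    obtain ⟨i, j, a, b, rfl, ha, hb, rfl⟩ := hz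
    rw [proj_tmul_eq ha hb, if_neg h]
  | zero => rw [map_zero]
  | add a b _ _ h₁ h₂ => rw [map_add, h₁, h₂, add_zero]
  | smul r a _ h => rw [map_smul, h, smul_zero]

theorem D_proj (hD : IsDifferential (gr 𝒱 𝒰) D) (n : ℕ) (z : Extension 𝒱 𝒰) :
    D (proj 𝒱 𝒰 n z) = proj 𝒱 𝒰 (n + 1) (D z) := by
  induction z using homog_induction with
  | add z w h₁ h₂ => simp only [map_add, h₁, h₂]
  | tmul i j a b ha hb =>
    have hz := tmul_mem_gr ha hb
    by_cases h : i + j = n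
    · rw [← h, proj_of_mem hz, proj_of_mem (hD.degree _ _ hz)]
    · rw [proj_of_ne hz h, proj_of_ne (hD.degree _ _ hz) (by omega), map_zero]

theorem proj_one_tmul_ι (n : ℕ) (u : U) : proj 𝒱 𝒰 n (1 ᵍ⊗ₜ[ℚ] FreeGCA.ι 𝒰 u) =
    1 ᵍ⊗ₜ[ℚ] FreeGCA.ι 𝒰 (gradedProj 𝒰 n u) := by
  induction u using DirectSum.Decomposition.inductionOn 𝒰 with
  | zero => simp only [map_zero, tmul_zero]
  | @homogeneous i u =>
    have hu := one_tmul_mem_gr (𝒱 := 𝒱) (FreeGCA.ι_mem_gr u.2)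
    by_cases h : i = n
    · subst h
      rw [gradedProj_of_mem u.2, proj_of_mem hu]
    · rw [gradedProj_of_ne u.2 h, proj_of_ne hu h, map_zero, tmul_zero]
  | add u w h₁ h₂ => simp only [map_add, tmul_add, h₁, h₂]

theorem proj_mem_sub {Z : Submodule ℚ U} (hZ : FreeGCA.IsGraded 𝒰 Z) (n : ℕ)
    {z : Extension 𝒱 𝒰} (hz : z ∈ sub 𝒱 𝒰 Z) : proj 𝒱 𝒰 n z ∈ sub 𝒱 𝒰 Z := by
  induction hz using Submodule.span_induction with
  | mem z hz =>
    obtain ⟨a, b, hb, rfl⟩ := hz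
    rw [proj_tmul]
    exact Submodule.sum_mem _ fun ij _ =>
      Submodule.subset_span ⟨_, _, FreeGCA.gradedProj_mem_sub hZ hb ij.2, rfl⟩
  | zero => rw [map_zero]; exact zero_mem _
  | add a b _ _ h₁ h₂ => rw [map_add]; exact add_mem h₁ h₂
  | smul r a _ h => rw [map_smul]; exact Submodule.smul_mem _ r h

theorem sub_mono {Z Z' : Submodule ℚ U} (h : Z ≤ Z') : sub 𝒱 𝒰 Z ≤ sub 𝒱 𝒰 Z' := by
  refine Submodule.span_mono ?_
  rintro _ ⟨a, b, hb, rfl⟩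
  exact ⟨a, b, FreeGCA.sub_mono h hb, rfl⟩

/-- Subspaces of `U` obtained by successively adjoining homogeneous elements `u` such that `D(1 ⊗ u)`
lies in the subalgebra generated by `V` and the previous ones. -/
inductive IsFlag (D : Extension 𝒱 𝒰 →ₗ[ℚ] Extension 𝒱 𝒰) : Submodule ℚ U → Prop
  | bot : IsFlag D ⊥
  | sup_span {Z : Submodule ℚ U} {j : ℕ} {u : U} (hZ : IsFlag D Z) (hu : u ∈ 𝒰 j)
      (hDu : D (1 ᵍ⊗ₜ[ℚ] FreeGCA.ι 𝒰 u) ∈ sub 𝒱 𝒰 Z) : IsFlag D (Z ⊔ Submodule.span ℚ {u})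

theorem IsFlag.isGraded {Z : Submodule ℚ U} (hZ : IsFlag D Z) : FreeGCA.IsGraded 𝒰 Z := by
  induction hZ with
  | bot => exact FreeGCA.isGraded_bot
  | sup_span _ hu _ ih => exact FreeGCA.isGraded_sup ih (FreeGCA.isGraded_span_singleton hu)

theorem IsFlag.sup {Z Z' : Submodule ℚ U} (hZ : IsFlag D Z) (hZ' : IsFlag D Z') :
    IsFlag D (Z ⊔ Z') := by
  induction hZ' with
  | bot => rwa [sup_bot_eq]
  | sup_span _ hu hDu ih =>
    rw [← sup_assoc]
    exact .sup_span ih hu (sub_mono le_sup_right hDu)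

theorem exists_isFlag_of_mem_sub {Z : Submodule ℚ U} (h : ∀ u ∈ Z, ∃ Y, IsFlag D Y ∧ u ∈ Y)
    {Φ : FreeGCA 𝒰} (hΦ : Φ ∈ FreeGCA.sub 𝒰 Z) : ∃ Y, IsFlag D Y ∧ Φ ∈ FreeGCA.sub 𝒰 Y :=
  FreeGCA.exists_mem_sub .bot (fun _ _ hY hY' => ⟨_, hY.sup hY', le_sup_left, le_sup_right⟩) h hΦ

theorem exists_isFlag_of_mem_extension_sub {Z : Submodule ℚ U}
    (h : ∀ u ∈ Z, ∃ Y, IsFlag D Y ∧ u ∈ Y) {z : Extension 𝒱 𝒰} (hz : z ∈ sub 𝒱 𝒰 Z) :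
    ∃ Y, IsFlag D Y ∧ z ∈ sub 𝒱 𝒰 Y := by
  induction hz using Submodule.span_induction with
  | mem z hz =>
    obtain ⟨a, b, hb, rfl⟩ := hz
    obtain ⟨Y, hY, hb⟩ := exists_isFlag_of_mem_sub h hb
    exact ⟨Y, hY, Submodule.subset_span ⟨a, b, hb, rfl⟩⟩
  | zero => exact ⟨⊥, .bot, zero_mem _⟩
  | add a b _ _ h₁ h₂ =>
    obtain ⟨Y, hY, h₁⟩ := h₁
    obtain ⟨Y', hY', h₂⟩ := h₂
    exact ⟨_, hY.sup hY', add_mem (sub_mono le_sup_left h₁) (sub_mono le_sup_right h₂)⟩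
  | smul r a _ h =>
    obtain ⟨Y, hY, h⟩ := h
    exact ⟨Y, hY, Submodule.smul_mem _ r h⟩

/-- By nilpotence `D(1 ⊗ u)` involves finitely many earlier generators; these lie in one flag, to
which the homogeneous components of `u` can be adjoined. -/
theorem exists_isFlag_mem (hD : IsAcyclicClosure S D) (u : U) : ∃ Z, IsFlag D Z ∧ u ∈ Z := by
  let C : Submodule ℚ U :=
    { carrier := {u | ∃ Z, IsFlag D Z ∧ u ∈ Z}
      zero_mem' := ⟨⊥, .bot, zero_mem _⟩
      add_mem' := by
        rintro a b ⟨Z, hZ, ha⟩ ⟨Z', hZ', hb⟩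
        exact ⟨_, hZ.sup hZ', add_mem (Submodule.mem_sup_left ha) (Submodule.mem_sup_right hb)⟩
      smul_mem' := by
        rintro r a ⟨Z, hZ, ha⟩
        exact ⟨Z, hZ, Submodule.smul_mem _ r ha⟩ }
  have key : ∀ k, ∀ u ∈ filtration D k, u ∈ C := by
    intro k
    induction k with
    | zero =>
      intro u hu
      have hu' : u = 0 := hu
      rw [hu']
      exact zero_mem C
    | succ k ih =>
      intro u hu
      have hu' : D (1 ᵍ⊗ₜ[ℚ] FreeGCA.ι 𝒰 u) ∈ sub 𝒱 𝒰 (filtration D k) := hu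
      obtain ⟨Y, hY, hu'⟩ := exists_isFlag_of_mem_extension_sub ih hu'
      obtain ⟨N, hN⟩ := exists_sum_gradedProj (𝒱 := 𝒰) u
      rw [← hN N le_rfl]
      refine Submodule.sum_mem _ fun i _ => ?_
      refine ⟨_, .sup_span hY (gradedProj_mem i u) ?_,
        Submodule.mem_sup_right (Submodule.mem_span_singleton_self _)⟩
      rw [← proj_one_tmul_ι, D_proj hD.isDifferential]
      exact proj_mem_sub hY.isGraded _ hu'
  obtain ⟨k, hk⟩ := hD.nilpotent u
  exact key k u hk

theorem exists_isFlag_mem_sub (hD : IsAcyclicClosure S D) (Φ : FreeGCA 𝒰) :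
    ∃ Z, IsFlag D Z ∧ Φ ∈ FreeGCA.sub 𝒰 Z :=
  exists_isFlag_of_mem_sub (Z := ⊤) (fun u _ => exists_isFlag_mem hD u)
    (by rw [FreeGCA.sub_top]; trivial)

theorem exists_isFlag_ge (hD : IsAcyclicClosure S D) {W : Submodule ℚ U} (hW : W.FG) :
    ∃ Z, IsFlag D Z ∧ W ≤ Z := by
  induction W, hW using Submodule.fg_induction with
  | singleton u =>
    obtain ⟨Z, hZ, hu⟩ := exists_isFlag_mem hD u
    exact ⟨Z, hZ, (Submodule.span_singleton_le_iff_mem _ _).mpr hu⟩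
  | sup W W' _ _ h₁ h₂ =>
    obtain ⟨Z, hZ, h₁⟩ := h₁
    obtain ⟨Z', hZ', h₂⟩ := h₂
    exact ⟨_, hZ.sup hZ', sup_le_sup h₁ h₂⟩

theorem IsFlag.D_mem {Z : Submodule ℚ U} (hZ : IsFlag D Z) {u : U} (hu : u ∈ Z) :
    D (1 ᵍ⊗ₜ[ℚ] FreeGCA.ι 𝒰 u) ∈ sub 𝒱 𝒰 Z := by
  induction hZ generalizing u with
  | bot =>
    rw [(Submodule.mem_bot ℚ).mp hu, map_zero, tmul_zero, map_zero]
    exact zero_mem _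
  | sup_span _ _ hDu ih =>
    obtain ⟨a, ha, b, hb, rfl⟩ := Submodule.mem_sup.mp hu
    obtain ⟨r, rfl⟩ := Submodule.mem_span_singleton.mp hb
    rw [map_add, tmul_add, map_add, map_smul, tmul_smul, map_smul]
    exact sub_mono le_sup_left (add_mem (ih ha) (Submodule.smul_mem _ r hDu))

theorem IsFlag.holonomyLie_ι_mem {Z : Submodule ℚ U} (hZ : IsFlag D Z) (f : Module.Dual ℚ V) {u : U}
    (hu : u ∈ Z) : holonomyLie D f (FreeGCA.ι 𝒰 u) ∈ FreeGCA.sub 𝒰 Z :=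
  neg_mem (slant_mem_sub _ (hZ.D_mem hu))

theorem IsFlag.holonomyLie_mem (hD : IsAcyclicClosure S D) {Z : Submodule ℚ U} (hZ : IsFlag D Z)
    (f : Module.Dual ℚ V) {Φ : FreeGCA 𝒰} (hΦ : Φ ∈ FreeGCA.sub 𝒰 Z) :
    holonomyLie D f Φ ∈ FreeGCA.sub 𝒰 Z := by
  refine Extension.holonomyLie_mem_of_forall (P := Subalgebra.toSubmodule (FreeGCA.sub 𝒰 Z)) S.pos
    f fun p => ?_
  rw [Subalgebra.mem_toSubmodule]
  generalize liePart 𝒱 p f = x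
  induction hΦ using Algebra.adjoin_induction with
  | mem x hx => obtain ⟨w, hw, rfl⟩ := hx; exact hZ.holonomyLie_ι_mem _ hw
  | algebraMap r =>
    rw [Algebra.algebraMap_eq_smul_one, map_smul, holonomyLie_one hD.isDifferential, smul_zero]
    exact zero_mem _
  | add a b _ _ h₁ h₂ => rw [map_add]; exact add_mem h₁ h₂
  | mul a b ha hb h₁ h₂ =>
    rw [holonomyLie_mul hD.isDifferential]
    exact add_mem (mul_mem h₁ hb) (mul_mem (FreeGCA.sgn_pow_mem_sub hZ.isGraded p ha) h₂)

theorem exists_index_slant_eq_zero (z : Extension 𝒱 𝒰) : ∃ α : S.Index, ∀ f : Module.Dual ℚ V,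
    (∀ v ∈ α.space, f v = 0) → slant 𝒱 𝒰 (FreeGCA.ev 𝒱 f) z = 0 := by
  induction z using tmul_induction with
  | add z w h₁ h₂ =>
    obtain ⟨α, hα⟩ := h₁
    obtain ⟨β, hβ⟩ := h₂
    refine ⟨α.sup β, fun f hf => ?_⟩
    rw [map_add, hα f fun v hv => hf v (α.le_sup_left β hv),
      hβ f fun v hv => hf v (α.le_sup_right β hv), add_zero]
  | tmul a b =>
    obtain ⟨α, hα⟩ := MinimalSullivanAlgebra.Index.exists_mem (S := S) (FreeGCA.lin 𝒱 a)
    exact ⟨α, fun f hf => by rw [slant_tmul, FreeGCA.ev_eq, hf _ hα, zero_smul]⟩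

/-- The action of `L_V` in the subalgebra of `∧U` generated by a flag factors through `L_α` for some
`α`. -/
theorem IsFlag.exists_index (hD : IsAcyclicClosure S D) {Z : Submodule ℚ U} (hZ : IsFlag D Z) :
    ∃ α : S.Index, ∀ f : Module.Dual ℚ V, (∀ v ∈ α.space, f v = 0) → ∀ Φ ∈ FreeGCA.sub 𝒰 Z,
      holonomyLie D f Φ = 0 := by
  obtain ⟨α, hα⟩ : ∃ α : S.Index, ∀ f : Module.Dual ℚ V, (∀ v ∈ α.space, f v = 0) → ∀ u ∈ Z,
      holonomyLie D f (FreeGCA.ι 𝒰 u) = 0 := by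
    induction hZ with
    | bot =>
      refine ⟨MinimalSullivanAlgebra.Index.zero, fun f _ u hu => ?_⟩
      rw [(Submodule.mem_bot ℚ).mp hu, map_zero, map_zero]
    | @sup_span _ _ u _ _ _ ih =>
      obtain ⟨α, hα⟩ := ih
      obtain ⟨β, hβ⟩ := exists_index_slant_eq_zero (S := S) (D (1 ᵍ⊗ₜ[ℚ] FreeGCA.ι 𝒰 u))
      refine ⟨α.sup β, fun f hf w hw => ?_⟩
      obtain ⟨a, ha, b, hb, rfl⟩ := Submodule.mem_sup.mp hw
      obtain ⟨r, rfl⟩ := Submodule.mem_span_singleton.mp hb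
      have h1 := hβ f fun v hv => hf v (α.le_sup_right β hv)
      rw [map_add, map_add, hα f (fun v hv => hf v (α.le_sup_left β hv)) a ha, map_smul, map_smul,
        holonomyLie_apply, component_apply, h1, neg_zero, smul_zero, add_zero]
  refine ⟨α, fun f hf Φ hΦ => ?_⟩
  refine (Submodule.mem_bot ℚ).mp (Extension.holonomyLie_mem_of_forall S.pos f fun p => ?_)
  -- Homogeneous parts of `f` still vanish on `V_α` because `V_α` is graded.
  have hx : ∀ v ∈ α.space, (liePart 𝒱 p f).1 v = 0 := fun v hv => hf _ (α.homogeneous v hv _)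
  rw [Submodule.mem_bot]
  induction hΦ using Algebra.adjoin_induction with
  | mem x hx' => obtain ⟨w, hw, rfl⟩ := hx'; exact hα _ hx w hw
  | algebraMap r =>
    rw [Algebra.algebraMap_eq_smul_one, map_smul, holonomyLie_one hD.isDifferential, smul_zero]
  | add a b _ _ h₁ h₂ => rw [map_add, h₁, h₂, add_zero]
  | mul a b ha hb h₁ h₂ =>
    rw [holonomyLie_mul hD.isDifferential, h₁, h₂, zero_mul, mul_zero, add_zero]

/-! #### The socle filtration -/

variable (D) in
/-- The socle filtration of `∧U` with respect to the action of `L_V`. -/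
def socle : ℕ → Submodule ℚ (FreeGCA 𝒰)
  | 0 => ⊥
  | n + 1 => ⨅ (p : ℕ) (x : lie 𝒱 p), (socle n).comap (holonomyLie D x.1)

theorem mem_socle_succ {n : ℕ} {Φ : FreeGCA 𝒰} : Φ ∈ socle D (n + 1) ↔
    ∀ (p : ℕ) (x : lie 𝒱 p), holonomyLie D x.1 Φ ∈ socle D n := by
  simp only [socle, Submodule.mem_iInf, Submodule.mem_comap]

theorem socle_le_succ (n : ℕ) : socle D n ≤ socle D (n + 1) := by
  induction n with
  | zero => exact bot_le
  | succ n ih => exact fun Φ hΦ => mem_socle_succ.mpr fun p x => ih (mem_socle_succ.mp hΦ p x)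

theorem socle_mono {m n : ℕ} (h : m ≤ n) : socle D m ≤ socle D n :=
  monotone_nat_of_le_succ socle_le_succ h

theorem holonomyLie_mem_socle {n : ℕ} {Φ : FreeGCA 𝒰} (hΦ : Φ ∈ socle D n) {p : ℕ} (x : lie 𝒱 p) :
    holonomyLie D x.1 Φ ∈ socle D n :=
  mem_socle_succ.mp (socle_le_succ n hΦ) p x

theorem sgn_pow_mem_socle (hD : IsDifferential (gr 𝒱 𝒰) D) (k : ℕ) {n : ℕ} {Φ : FreeGCA 𝒰}
    (hΦ : Φ ∈ socle D n) : (FreeGCA.sgn 𝒰 ^ k) Φ ∈ socle D n := by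
  induction n generalizing Φ with
  | zero =>
    rw [(Submodule.mem_bot ℚ).mp hΦ]
    have : (FreeGCA.sgn 𝒰 ^ k) 0 = 0 := map_zero _
    rw [this]
    exact zero_mem _
  | succ n ih =>
    refine mem_socle_succ.mpr fun p x => ?_
    rw [holonomyLie_sgn hD]
    exact Submodule.smul_mem _ _ (ih (mem_socle_succ.mp hΦ p x))

/-- By the Leibniz rule each operator lowers the layer of one of the two factors. -/
theorem mul_mem_socle (hD : IsDifferential (gr 𝒱 𝒰) D) {m n : ℕ} {Φ Ψ : FreeGCA 𝒰}
    (hΦ : Φ ∈ socle D m) (hΨ : Ψ ∈ socle D n) : Φ * Ψ ∈ socle D (m + n) := by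
  induction k : m + n generalizing m n Φ Ψ with
  | zero =>
    obtain ⟨rfl, rfl⟩ : m = 0 ∧ n = 0 := by omega
    rw [(Submodule.mem_bot ℚ).mp hΦ, zero_mul]
    exact zero_mem _
  | succ k ih =>
    rcases m with _ | m
    · rw [(Submodule.mem_bot ℚ).mp hΦ, zero_mul]
      exact zero_mem _
    rcases n with _ | n
    · rw [(Submodule.mem_bot ℚ).mp hΨ, mul_zero]
      exact zero_mem _
    refine mem_socle_succ.mpr fun p x => ?_
    rw [holonomyLie_mul hD]
    exact add_mem (ih (mem_socle_succ.mp hΦ p x) hΨ (by omega))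
      (ih (sgn_pow_mem_socle hD p hΦ) (mem_socle_succ.mp hΨ p x) (by omega))

theorem one_mem_socle (hD : IsDifferential (gr 𝒱 𝒰) D) : 1 ∈ socle D 1 :=
  mem_socle_succ.mpr fun p x => by rw [holonomyLie_one hD]; exact zero_mem _

/-- The bound has to be uniform in `f`. An element of `∧V ⊗ ∧Z` is a finite sum of tensors, so only
finitely many elements of `∧Z` occur. -/
theorem exists_slant_mem_socle {Z : Submodule ℚ U}
    (h : ∀ Φ ∈ FreeGCA.sub 𝒰 Z, ∃ n, Φ ∈ socle D n) {z : Extension 𝒱 𝒰} (hz : z ∈ sub 𝒱 𝒰 Z) :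
    ∃ n, ∀ f : Module.Dual ℚ V, slant 𝒱 𝒰 (FreeGCA.ev 𝒱 f) z ∈ socle D n := by
  induction hz using Submodule.span_induction with
  | mem z hz =>
    obtain ⟨a, b, hb, rfl⟩ := hz
    obtain ⟨n, hn⟩ := h b hb
    exact ⟨n, fun f => Submodule.smul_mem _ _ hn⟩
  | zero => exact ⟨0, fun f => by rw [map_zero]; exact zero_mem _⟩
  | add a b _ _ h₁ h₂ =>
    obtain ⟨m, hm⟩ := h₁
    obtain ⟨n, hn⟩ := h₂
    refine ⟨max m n, fun f => ?_⟩
    rw [map_add]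
    exact add_mem (socle_mono (le_max_left _ _) (hm f)) (socle_mono (le_max_right _ _) (hn f))
  | smul r a _ h =>
    obtain ⟨n, hn⟩ := h
    exact ⟨n, fun f => by rw [map_smul]; exact Submodule.smul_mem _ r (hn f)⟩

theorem exists_mem_socle_of_ι (hD : IsDifferential (gr 𝒱 𝒰) D) {Z : Submodule ℚ U}
    (h : ∀ u ∈ Z, ∃ n, FreeGCA.ι 𝒰 u ∈ socle D n) {Φ : FreeGCA 𝒰} (hΦ : Φ ∈ FreeGCA.sub 𝒰 Z) :
    ∃ n, Φ ∈ socle D n := by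
  induction hΦ using Algebra.adjoin_induction with
  | mem x hx => obtain ⟨w, hw, rfl⟩ := hx; exact h w hw
  | algebraMap r =>
    rw [Algebra.algebraMap_eq_smul_one]
    exact ⟨1, Submodule.smul_mem _ r (one_mem_socle hD)⟩
  | add a b _ _ h₁ h₂ =>
    obtain ⟨m, hm⟩ := h₁
    obtain ⟨n, hn⟩ := h₂
    exact ⟨max m n, add_mem (socle_mono (le_max_left _ _) hm) (socle_mono (le_max_right _ _) hn)⟩
  | mul a b _ _ h₁ h₂ =>
    obtain ⟨m, hm⟩ := h₁
    obtain ⟨n, hn⟩ := h₂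
    exact ⟨_, mul_mem_socle hD hm hn⟩

theorem IsFlag.exists_ι_mem_socle (hD : IsDifferential (gr 𝒱 𝒰) D) {Z : Submodule ℚ U}
    (hZ : IsFlag D Z) : ∀ u ∈ Z, ∃ n, FreeGCA.ι 𝒰 u ∈ socle D n := by
  induction hZ with
  | bot =>
    intro u hu
    exact ⟨0, by rw [(Submodule.mem_bot ℚ).mp hu, map_zero]; exact zero_mem _⟩
  | sup_span _ _ hDu ih =>
    intro w hw
    obtain ⟨a, ha, b, hb, rfl⟩ := Submodule.mem_sup.mp hw
    obtain ⟨r, rfl⟩ := Submodule.mem_span_singleton.mp hb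
    obtain ⟨m, hm⟩ := ih a ha
    obtain ⟨n, hn⟩ := exists_slant_mem_socle
      (fun Φ hΦ => exists_mem_socle_of_ι hD ih hΦ) hDu
    refine ⟨max m (n + 1), ?_⟩
    rw [map_add, map_smul]
    refine add_mem (socle_mono (le_max_left _ _) hm)
      (Submodule.smul_mem _ r (socle_mono (le_max_right _ _) ?_))
    exact mem_socle_succ.mpr fun p x => neg_mem (hn x.1)

/-- Every operator sends a new generator of a flag into the subalgebra of the earlier ones, where
layers are already bounded, and layers add under products. This is the local nilpotence that makes
powers of the augmentation ideal act by zero. -/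
theorem exists_mem_socle (hD : IsAcyclicClosure S D) (Φ : FreeGCA 𝒰) : ∃ n, Φ ∈ socle D n := by
  obtain ⟨Z, hZ, hΦ⟩ := exists_isFlag_mem_sub hD Φ
  exact exists_mem_socle_of_ι hD.isDifferential (hZ.exists_ι_mem_socle hD.isDifferential) hΦ

end Extension
end Flags

/-! ### Words in `L_V`, their images in `UL_α`, and the holonomy representation of the completion.
-/

section Words

variable {V : Type u} [AddCommGroup V] [Module ℚ V] {𝒱 : ℕ → Submodule ℚ V}
  {U : Type v} [AddCommGroup U] [Module ℚ U] {𝒰 : ℕ → Submodule ℚ U}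
  [DirectSum.Decomposition 𝒱] [DirectSum.Decomposition 𝒰]
  {S : MinimalSullivanAlgebra 𝒱} {D : Extension 𝒱 𝒰 →ₗ[ℚ] Extension 𝒱 𝒰}

variable (𝒱) in
/-- The free associative algebra on the homogeneous elements of the homotopy Lie algebra. -/
abbrev LieWord : Type _ := FreeAlgebra ℚ (Σ p : ℕ, lie 𝒱 p)

namespace LieWord

/-- An element of the homotopy Lie algebra as a word. -/
def of {p : ℕ} (x : lie 𝒱 p) : LieWord 𝒱 := FreeAlgebra.ι ℚ ⟨p, x⟩

@[elab_as_elim]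
theorem induction {P : LieWord 𝒱 → Prop} (algebraMap : ∀ r : ℚ, P (algebraMap ℚ _ r))
    (of : ∀ (p : ℕ) (x : lie 𝒱 p), P (of x)) (mul : ∀ s t, P s → P t → P (s * t))
    (add : ∀ s t, P s → P t → P (s + t)) (t : LieWord 𝒱) : P t :=
  FreeAlgebra.induction ℚ _ algebraMap (fun x => of x.1 x.2) mul add t

variable (𝒱) in
/-- The augmentation. -/
def aug : LieWord 𝒱 →ₐ[ℚ] ℚ := FreeAlgebra.lift ℚ fun _ => 0

theorem aug_of {p : ℕ} (x : lie 𝒱 p) : aug 𝒱 (of x) = 0 := FreeAlgebra.lift_ι_apply _ _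

variable (𝒱) in
/-- The automorphism `t ↦ (-1)^{k deg t} t`. -/
def sgn (k : ℕ) : LieWord 𝒱 →ₐ[ℚ] LieWord 𝒱 :=
  FreeAlgebra.lift ℚ fun x => (-1 : ℚ) ^ (k * x.1) • of x.2

theorem sgn_of (k : ℕ) {p : ℕ} (x : lie 𝒱 p) : sgn 𝒱 k (of x) = (-1 : ℚ) ^ (k * p) • of x :=
  FreeAlgebra.lift_ι_apply _ _

theorem sgn_sgn (k : ℕ) (t : LieWord 𝒱) : sgn 𝒱 k (sgn 𝒱 k t) = t := by
  induction t using induction with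
  | algebraMap r => rw [AlgHom.commutes, AlgHom.commutes]
  | of p x =>
    rw [sgn_of, map_smul, sgn_of, smul_smul, ← mul_pow]
    simp
  | mul s t h₁ h₂ => rw [map_mul, map_mul, h₁, h₂]
  | add s t h₁ h₂ => rw [map_add, map_add, h₁, h₂]

theorem sgn_of_even {k : ℕ} (hk : Even k) (t : LieWord 𝒱) : sgn 𝒱 k t = t := by
  induction t using induction with
  | algebraMap r => rw [AlgHom.commutes]
  | of p x => rw [sgn_of, (hk.mul_right p).neg_one_pow, one_smul]
  | mul s t h₁ h₂ => rw [map_mul, h₁, h₂]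
  | add s t h₁ h₂ => rw [map_add, h₁, h₂]

/-- Words `x₁ ⋯ x_k` of total degree `n`. -/
inductive IsMonomial : ℕ → LieWord 𝒱 → Prop
  | one : IsMonomial 0 1
  | cons {p n : ℕ} (x : lie 𝒱 p) {a : LieWord 𝒱} (ha : IsMonomial n a) : IsMonomial (p + n) (of x * a)

theorem IsMonomial.mul {m n : ℕ} {a b : LieWord 𝒱} (ha : IsMonomial m a) (hb : IsMonomial n b) :
    IsMonomial (m + n) (a * b) := by
  induction ha with
  | one => simpa using hb
  | cons x _ ih => rw [mul_assoc, add_assoc]; exact .cons x ih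

variable (𝒱) in
/-- The component of degree `n`. -/
def gr (n : ℕ) : Submodule ℚ (LieWord 𝒱) := Submodule.span ℚ {a | IsMonomial n a}

theorem mem_iSup_gr (t : LieWord 𝒱) : t ∈ ⨆ n, gr 𝒱 n := by
  have h1 : ∀ {n : ℕ} {a : LieWord 𝒱}, IsMonomial n a → a ∈ ⨆ n, gr 𝒱 n := fun {n a} ha =>
    Submodule.mem_iSup_of_mem n (Submodule.subset_span ha)
  have hspan : (⨆ n, gr 𝒱 n) = Submodule.span ℚ {a | ∃ n, IsMonomial n a} := by
    refine le_antisymm (iSup_le fun n => Submodule.span_mono fun a ha => ⟨n, ha⟩) ?_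
    rw [Submodule.span_le]
    rintro a ⟨n, ha⟩
    exact h1 ha
  induction t using induction with
  | algebraMap r =>
    rw [Algebra.algebraMap_eq_smul_one]
    exact Submodule.smul_mem _ _ (h1 .one)
  | of p x => exact h1 (by simpa using IsMonomial.cons x .one)
  | add s t h₁ h₂ => exact add_mem h₁ h₂
  | mul s t h₁ h₂ =>
    rw [hspan] at h₁ h₂
    induction h₁, h₂ using Submodule.span_induction₂ with
    | mem_mem a b ha hb => exact h1 (ha.choose_spec.mul hb.choose_spec)
    | zero_left b hb => rw [zero_mul]; exact zero_mem _
    | zero_right a ha => rw [mul_zero]; exact zero_mem _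
    | add_left a b c _ _ _ h₁ h₂ => rw [add_mul]; exact add_mem h₁ h₂
    | add_right a b c _ _ _ h₁ h₂ => rw [mul_add]; exact add_mem h₁ h₂
    | smul_left r a b _ _ h => rw [smul_mul_assoc]; exact Submodule.smul_mem _ r h
    | smul_right r a b _ _ h => rw [mul_smul_comm]; exact Submodule.smul_mem _ r h

variable (D) in
/-- The action on `∧U` through the operators `θ_x`. -/
def act : LieWord 𝒱 →ₐ[ℚ] Module.End ℚ (FreeGCA 𝒰) :=
  FreeAlgebra.lift ℚ fun x => Extension.holonomyLie D x.2.1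

theorem act_of {p : ℕ} (x : lie 𝒱 p) : act D (of x) = Extension.holonomyLie D x.1 :=
  FreeAlgebra.lift_ι_apply _ _

theorem act_mul (s t : LieWord 𝒱) (Φ : FreeGCA 𝒰) : act D (s * t) Φ = act D s (act D t Φ) := by
  rw [map_mul, Module.End.mul_apply]

theorem act_algebraMap (r : ℚ) (Φ : FreeGCA 𝒰) : act D (algebraMap ℚ _ r) Φ = r • Φ := by
  rw [AlgHom.commutes, Module.algebraMap_end_apply]

theorem act_add (s t : LieWord 𝒱) (Φ : FreeGCA 𝒰) : act D (s + t) Φ = act D s Φ + act D t Φ := by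
  rw [map_add, LinearMap.add_apply]

theorem act_sub (s t : LieWord 𝒱) (Φ : FreeGCA 𝒰) : act D (s - t) Φ = act D s Φ - act D t Φ := by
  rw [map_sub, LinearMap.sub_apply]

theorem act_smul (r : ℚ) (t : LieWord 𝒱) (Φ : FreeGCA 𝒰) : act D (r • t) Φ = r • act D t Φ := by
  rw [map_smul, LinearMap.smul_apply]

theorem act_mem_gr (hD : IsDifferential (Extension.gr 𝒱 𝒰) D) {n m : ℕ} {t : LieWord 𝒱}
    (ht : t ∈ gr 𝒱 n) {Φ : FreeGCA 𝒰} (hΦ : Φ ∈ FreeGCA.gr 𝒰 (n + m)) :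
    act D t Φ ∈ FreeGCA.gr 𝒰 m := by
  induction ht using Submodule.span_induction with
  | mem t ht =>
    induction ht generalizing m with
    | one => rw [map_one]; simpa using hΦ
    | @cons p n x a ha ih =>
      rw [act_mul, act_of]
      exact Extension.holonomyLie_mem_gr hD x (ih (by rwa [← add_assoc, add_comm n p]))
  | zero => rw [map_zero]; exact zero_mem _
  | add a b _ _ h₁ h₂ => rw [act_add]; exact add_mem h₁ h₂
  | smul r a _ h => rw [act_smul]; exact Submodule.smul_mem _ r h

theorem act_eq_zero (hD : IsDifferential (Extension.gr 𝒱 𝒰) D) {n m : ℕ} (h : m < n)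
    {t : LieWord 𝒱} (ht : t ∈ gr 𝒱 n) {Φ : FreeGCA 𝒰} (hΦ : Φ ∈ FreeGCA.gr 𝒰 m) :
    act D t Φ = 0 := by
  induction ht using Submodule.span_induction with
  | mem t ht =>
    induction ht with
    | one => omega
    | @cons p n x a ha ih =>
      rw [act_mul, act_of]
      by_cases h' : m < n
      · rw [ih h', map_zero]
      · obtain ⟨k, rfl⟩ := Nat.exists_eq_add_of_le (not_lt.mp h')
        exact Extension.holonomyLie_eq_zero hD (by omega) x
          (act_mem_gr hD (Submodule.subset_span ha) hΦ)
  | zero => rw [map_zero, LinearMap.zero_apply]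
  | add a b _ _ h₁ h₂ => rw [act_add, h₁, h₂, add_zero]
  | smul r a _ h => rw [act_smul, h, smul_zero]

theorem aug_act_eq_zero (hD : IsDifferential (Extension.gr 𝒱 𝒰) D) {n m : ℕ} (h : m ≠ n)
    {t : LieWord 𝒱} (ht : t ∈ gr 𝒱 n) {Φ : FreeGCA 𝒰} (hΦ : Φ ∈ FreeGCA.gr 𝒰 m) :
    FreeGCA.aug 𝒰 (act D t Φ) = 0 := by
  rcases lt_or_gt_of_ne h with h | h
  · rw [act_eq_zero hD h ht hΦ, map_zero]
  · obtain ⟨k, rfl⟩ := Nat.exists_eq_add_of_le h.le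
    exact FreeGCA.aug_eq_zero (by omega) (act_mem_gr hD ht hΦ)

theorem act_mem_socle (t : LieWord 𝒱) {n : ℕ} {Φ : FreeGCA 𝒰} (hΦ : Φ ∈ Extension.socle D n) :
    act D t Φ ∈ Extension.socle D n := by
  induction t using induction generalizing Φ with
  | algebraMap r => rw [act_algebraMap]; exact Submodule.smul_mem _ r hΦ
  | of p x => rw [act_of]; exact Extension.holonomyLie_mem_socle hΦ x
  | mul s t h₁ h₂ => rw [act_mul]; exact h₁ (h₂ hΦ)
  | add s t h₁ h₂ => rw [act_add]; exact add_mem (h₁ hΦ) (h₂ hΦ)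

/-- Each letter lowers the layer, so on successive quotients only the constant term acts; words of
augmentation zero therefore lower the layer. -/
theorem act_sub_aug_mem_socle (t : LieWord 𝒱) {n : ℕ} {Φ : FreeGCA 𝒰}
    (hΦ : Φ ∈ Extension.socle D (n + 1)) :
    act D t Φ - aug 𝒱 t • Φ ∈ Extension.socle D n := by
  induction t using induction with
  | algebraMap r =>
    rw [act_algebraMap, AlgHom.commutes, Algebra.algebraMap_self_apply, sub_self]
    exact zero_mem _
  | of p x =>
    rw [act_of, aug_of, zero_smul, sub_zero]
    exact Extension.mem_socle_succ.mp hΦ p x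
  | mul s t h₁ h₂ =>
    have e : act D (s * t) Φ - aug 𝒱 (s * t) • Φ =
        act D s (act D t Φ - aug 𝒱 t • Φ) + aug 𝒱 t • (act D s Φ - aug 𝒱 s • Φ) := by
      rw [act_mul, map_sub, map_smul, map_mul, smul_sub, smul_smul, mul_comm]; abel
    rw [e]
    exact add_mem (act_mem_socle s h₂) (Submodule.smul_mem _ _ h₁)
  | add s t h₁ h₂ =>
    rw [act_add, map_add, add_smul, add_sub_add_comm]
    exact add_mem h₁ h₂

theorem act_mem_sub (hD : IsAcyclicClosure S D) {Z : Submodule ℚ U} (hZ : Extension.IsFlag D Z)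
    (t : LieWord 𝒱) {Φ : FreeGCA 𝒰} (hΦ : Φ ∈ FreeGCA.sub 𝒰 Z) : act D t Φ ∈ FreeGCA.sub 𝒰 Z := by
  induction t using induction generalizing Φ with
  | algebraMap r => rw [act_algebraMap]; exact Subalgebra.smul_mem _ hΦ r
  | of p x => rw [act_of]; exact hZ.holonomyLie_mem hD _ hΦ
  | mul s t h₁ h₂ => rw [act_mul]; exact h₁ (h₂ hΦ)
  | add s t h₁ h₂ => rw [act_add]; exact add_mem (h₁ hΦ) (h₂ hΦ)

end LieWord

namespace MinimalSullivanAlgebra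

theorem Index.res_surjective (α : S.Index) : Function.Surjective α.res :=
  Subspace.dualRestrict_surjective

theorem Index.res_eq_iff (α : S.Index) {f g : Module.Dual ℚ V} :
    α.res f = α.res g ↔ ∀ v ∈ α.space, f v = g v :=
  ⟨fun h v hv => LinearMap.congr_fun h ⟨v, hv⟩, fun h => LinearMap.ext fun v => h v v.2⟩

/-- The finite dimensional space `V_α` meets finitely many degrees, so a single bound serves all
forms. -/
theorem Index.exists_sum_liePart (α : S.Index) :
    ∃ N, ∀ f : Module.Dual ℚ V, α.res (∑ p ∈ Finset.range N, (liePart 𝒱 p f).1) = α.res f := by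
  have key : ∀ W : Submodule ℚ V, W.FG → ∃ N, ∀ M ≥ N, ∀ v ∈ W, ∀ f : Module.Dual ℚ V,
      ∑ p ∈ Finset.range M, (liePart 𝒱 p f).1 v = f v := by
    intro W hW
    induction W, hW using Submodule.fg_induction with
    | singleton v =>
      obtain ⟨N, hN⟩ := Sullivan.exists_sum_liePart S.pos v
      refine ⟨N, fun M hM w hw f => ?_⟩
      obtain ⟨r, rfl⟩ := Submodule.mem_span_singleton.mp hw
      simp only [map_smul, ← Finset.smul_sum, hN M hM]
    | sup W W' _ _ h₁ h₂ =>
      obtain ⟨N, hN⟩ := h₁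
      obtain ⟨N', hN'⟩ := h₂
      refine ⟨max N N', fun M hM w hw f => ?_⟩
      obtain ⟨a, ha, b, hb, rfl⟩ := Submodule.mem_sup.mp hw
      simp only [map_add, Finset.sum_add_distrib]
      rw [hN M (le_trans (_root_.le_max_left _ _) hM) a ha,
        hN' M (le_trans (_root_.le_max_right _ _) hM) b hb]
  have := α.finite
  obtain ⟨N, hN⟩ := key α.space (Module.Finite.iff_fg.mp α.finite)
  refine ⟨N, fun f => α.res_eq_iff.mpr fun v hv => ?_⟩
  rw [LinearMap.sum_apply, hN N le_rfl v hv]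

/-- The evaluation of words in `UL_α`. -/
def Index.evalUL (α : S.Index) : LieWord 𝒱 →ₐ[ℚ] α.UL :=
  FreeAlgebra.lift ℚ fun x => α.toUL (α.res x.2.1)

theorem Index.evalUL_of (α : S.Index) {p : ℕ} (x : lie 𝒱 p) :
    α.evalUL (LieWord.of x) = α.toUL (α.res x.1) := FreeAlgebra.lift_ι_apply _ _

theorem Index.UL_induction (α : S.Index) {P : α.UL → Prop}
    (algebraMap : ∀ r : ℚ, P (algebraMap ℚ _ r)) (toUL : ∀ z, P (α.toUL z))
    (mul : ∀ a b, P a → P b → P (a * b)) (add : ∀ a b, P a → P b → P (a + b)) (a : α.UL) : P a := by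
  obtain ⟨t, rfl⟩ := RingQuot.mkAlgHom_surjective ℚ α.Rel a
  induction t using TensorAlgebra.induction with
  | algebraMap r => rw [AlgHom.commutes]; exact algebraMap r
  | ι z => exact toUL z
  | mul a b h₁ h₂ => rw [map_mul]; exact mul _ _ h₁ h₂
  | add a b h₁ h₂ => rw [map_add]; exact add _ _ h₁ h₂

theorem Index.evalUL_surjective (α : S.Index) : Function.Surjective α.evalUL := by
  intro a
  induction a using α.UL_induction with
  | algebraMap r => exact ⟨_, AlgHom.commutes _ r⟩
  | toUL z =>
    obtain ⟨f, rfl⟩ := α.res_surjective z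
    obtain ⟨N, hN⟩ := α.exists_sum_liePart
    refine ⟨∑ p ∈ Finset.range N, LieWord.of (liePart 𝒱 p f), ?_⟩
    rw [← hN f]
    simp only [map_sum, α.evalUL_of]
  | mul a b h₁ h₂ =>
    obtain ⟨s, rfl⟩ := h₁
    obtain ⟨t, rfl⟩ := h₂
    exact ⟨s * t, map_mul _ _ _⟩
  | add a b h₁ h₂ =>
    obtain ⟨s, rfl⟩ := h₁
    obtain ⟨t, rfl⟩ := h₂
    exact ⟨s + t, map_add _ _ _⟩

theorem Index.mapUL_evalUL {α β : S.Index} (h : α.space ≤ β.space) (t : LieWord 𝒱) :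
    Index.mapUL h (β.evalUL t) = α.evalUL t := by
  have : (Index.mapUL h).comp β.evalUL = α.evalUL := by
    apply FreeAlgebra.hom_ext
    funext x
    change Index.mapUL h (β.evalUL (LieWord.of x.2)) = α.evalUL (LieWord.of x.2)
    rw [Index.evalUL_of, Index.evalUL_of, Index.mapUL_toUL]
    rfl
  exact DFunLike.congr_fun this t

theorem Index.augUL_evalUL (α : S.Index) (t : LieWord 𝒱) :
    α.augUL (α.evalUL t) = LieWord.aug 𝒱 t := by
  have : α.augUL.comp α.evalUL = LieWord.aug 𝒱 := by
    apply FreeAlgebra.hom_ext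
    funext x
    change α.augUL (α.evalUL (LieWord.of x.2)) = LieWord.aug 𝒱 (LieWord.of x.2)
    rw [Index.evalUL_of, LieWord.aug_of]
    exact α.liftUL_toUL _ _ _
  exact DFunLike.congr_fun this t

theorem Index.evalUL_mem_pow {α β : S.Index} (h : α.space ≤ β.space) {m n : ℕ} (hmn : m ≤ n)
    {t : LieWord 𝒱} (ht : β.evalUL t ∈ β.I ^ n) : α.evalUL t ∈ α.I ^ m := by
  rw [← Index.mapUL_evalUL h]
  refine pow_le_comap (Index.mapUL h : β.UL →+* α.UL) β.I α.I (fun a ha => ?_) hmn ht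
  have ha' : β.augUL a = 0 := ha
  exact (Index.augUL_mapUL h a).trans ha'

variable (S) in
/-- The evaluation of words in the Sullivan completion. -/
def evalCompletion : LieWord 𝒱 →ₐ[ℚ] S.completion :=
  FreeAlgebra.lift ℚ fun x => S.lieToCompletion x.2.1

theorem evalCompletion_of {p : ℕ} (x : lie 𝒱 p) :
    S.evalCompletion (LieWord.of x) = S.lieToCompletion x.1 := FreeAlgebra.lift_ι_apply _ _

theorem evalCompletion_apply (t : LieWord 𝒱) (α : S.Index) (n : ℕ) :
    (S.evalCompletion t).1 α n = Ideal.Quotient.mk (α.I ^ n) (α.evalUL t) := by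
  induction t using LieWord.induction with
  | algebraMap r => rw [AlgHom.commutes, AlgHom.commutes]; rfl
  | of p x => rw [evalCompletion_of, Index.evalUL_of]; rfl
  | mul s t h₁ h₂ =>
    rw [map_mul, map_mul, map_mul, ← h₁, ← h₂]; rfl
  | add s t h₁ h₂ =>
    rw [map_add, map_add, map_add, ← h₁, ← h₂]; rfl

/-- The word `t` has the same component as `a` in `UL_α / I_α^n`. -/
def Index.Approximates (α : S.Index) (n : ℕ) (t : LieWord 𝒱) (a : S.completion) : Prop :=
  Ideal.Quotient.mk (α.I ^ n) (α.evalUL t) = a.1 α n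

/-- Homogeneous elements of `L_V` generate `UL_α`. By `Approximates.mono` the same word then serves
at every lower level. -/
theorem Index.exists_approximates (α : S.Index) (n : ℕ) (a : S.completion) :
    ∃ t, α.Approximates n t a := by
  obtain ⟨b, hb⟩ := Ideal.Quotient.mk_surjective (a.1 α n)
  obtain ⟨t, rfl⟩ := α.evalUL_surjective b
  exact ⟨t, hb⟩

theorem Index.approximates_evalCompletion (α : S.Index) (n : ℕ) (t : LieWord 𝒱) :
    α.Approximates n t (S.evalCompletion t) := (evalCompletion_apply t α n).symm

theorem Index.Approximates.mono {α β : S.Index} (h : α.space ≤ β.space) {m n : ℕ} (hmn : m ≤ n)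
    {t : LieWord 𝒱} {a : S.completion} (ht : β.Approximates n t a) : α.Approximates m t a := by
  have h1 := a.2 α β h m n hmn
  rw [← ht] at h1
  rw [Index.Approximates, ← h1, ← Index.mapUL_evalUL h]
  rfl

theorem Index.Approximates.sub_mem {α : S.Index} {n : ℕ} {s t : LieWord 𝒱} {a : S.completion}
    (hs : α.Approximates n s a) (ht : α.Approximates n t a) : α.evalUL (s - t) ∈ α.I ^ n := by
  rw [map_sub, ← Ideal.Quotient.eq]
  exact hs.trans ht.symm

end MinimalSullivanAlgebra

open MinimalSullivanAlgebra

/-- The action of a word `t` on `Φ` depends only on the component of `t` in `UL_α / I_α^n`. -/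
def IsGood (D : Extension 𝒱 𝒰 →ₗ[ℚ] Extension 𝒱 𝒰) (Φ : FreeGCA 𝒰) (α : S.Index) (n : ℕ) : Prop :=
  ∀ t : LieWord 𝒱, α.evalUL t ∈ α.I ^ n → LieWord.act D t Φ = 0

theorem IsGood.mono {Φ : FreeGCA 𝒰} {α β : S.Index} {m n : ℕ} (hΦ : IsGood D Φ α m)
    (h : α.space ≤ β.space) (hmn : m ≤ n) : IsGood D Φ β n :=
  fun t ht => hΦ t (Index.evalUL_mem_pow h hmn ht)

namespace Extension

/-- The representation of `UL_α`, for suitable `α`, in the subalgebra of `∧U` generated by a flag. -/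
theorem IsFlag.exists_rep (hD : IsAcyclicClosure S D) {Z : Submodule ℚ U} (hZ : IsFlag D Z) :
    ∃ (α : S.Index) (σ : α.UL →ₐ[ℚ] Module.End ℚ (Subalgebra.toSubmodule (FreeGCA.sub 𝒰 Z))),
      ∀ t Φ, (σ (α.evalUL t) Φ : FreeGCA 𝒰) = LieWord.act D t Φ := by
  obtain ⟨α, hα⟩ := hZ.exists_index hD
  let M := Subalgebra.toSubmodule (FreeGCA.sub 𝒰 Z)
  let θ : Module.Dual ℚ V →ₗ[ℚ] Module.End ℚ M :=
    { toFun := fun f => (holonomyLie D f).restrict fun Φ hΦ => hZ.holonomyLie_mem hD f hΦ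
      map_add' := fun f g => by
        ext Φ
        exact LinearMap.congr_fun ((holonomyHom D).map_add f g) Φ.1
      map_smul' := fun r f => by
        ext Φ
        exact LinearMap.congr_fun ((holonomyHom D).map_smul r f) Φ.1 }
  have hθ : ∀ f Φ, (θ f Φ : FreeGCA 𝒰) = holonomyLie D f Φ := fun f Φ => rfl
  have hres : ∀ f g, α.res f = α.res g → θ f = θ g := by
    intro f g hfg
    ext Φ
    rw [hθ, hθ, ← sub_eq_zero]
    have h := hα (f - g) (fun v hv => by
      rw [LinearMap.sub_apply, α.res_eq_iff.mp hfg v hv, sub_self]) Φ.1 Φ.2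
    have h' := LinearMap.congr_fun ((holonomyHom D).map_sub f g) Φ.1
    exact h'.symm.trans h
  -- The operators depend only on the restriction of `f` to `V_α`, so any linear section of the
  -- restriction defines the action of `L_α`.
  obtain ⟨sec, hsec⟩ := α.res.exists_rightInverse_of_surjective
    (LinearMap.range_eq_top.mpr α.res_surjective)
  have hθs : ∀ f, θ (sec (α.res f)) = θ f := fun f =>
    hres _ _ (LinearMap.congr_fun hsec (α.res f))
  have hrel : ∀ (p q : ℕ) (x : lie 𝒱 p) (y : lie 𝒱 q),
      (θ ∘ₗ sec) (α.res x.1) * (θ ∘ₗ sec) (α.res y.1) =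
        (-1 : ℚ) ^ (p * q) • ((θ ∘ₗ sec) (α.res y.1) * (θ ∘ₗ sec) (α.res x.1)) +
          (θ ∘ₗ sec) (α.res (S.bracket x y).1) := by
    intro p q x y
    simp only [LinearMap.comp_apply, hθs]
    ext Φ
    exact holonomyLie_holonomyLie hD x y Φ.1
  refine ⟨α, α.liftUL (A := Module.End ℚ M) (θ ∘ₗ sec) hrel, ?_⟩
  · intro t
    induction t using LieWord.induction with
    | algebraMap r => intro Φ; rw [LieWord.act_algebraMap, AlgHom.commutes, AlgHom.commutes]; rfl
    | of p x =>
      intro Φ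
      rw [α.evalUL_of, α.liftUL_toUL, LinearMap.comp_apply, hθs, hθ, LieWord.act_of]
    | mul s t h₁ h₂ =>
      intro Φ
      rw [map_mul, map_mul, Module.End.mul_apply, h₁, h₂, LieWord.act_mul]
    | add s t h₁ h₂ =>
      intro Φ
      rw [map_add, map_add, LinearMap.add_apply, Submodule.coe_add, h₁, h₂, LieWord.act_add]

end Extension

/-- A flag containing `Φ` provides `α`, and the socle layer containing `Φ` provides the exponent
`n`. -/
theorem exists_isGood (hD : IsAcyclicClosure S D) (Φ : FreeGCA 𝒰) :
    ∃ (α : S.Index) (n : ℕ), IsGood D Φ α n := by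
  obtain ⟨Z, hZ, hΦ⟩ := Extension.exists_isFlag_mem_sub hD Φ
  obtain ⟨n, hn⟩ := Extension.exists_mem_socle hD Φ
  obtain ⟨α, σ, hσ⟩ := hZ.exists_rep hD
  refine ⟨α, n, fun t ht => ?_⟩
  let M := Subalgebra.toSubmodule (FreeGCA.sub 𝒰 Z)
  -- `J k` annihilates the `k`th socle layer of `∧Z`. It contains `I_α^k`: the last factor of a
  -- product lowers the layer by one and the others act on what remains.
  let J : ℕ → Ideal α.UL := fun k =>
    { carrier := {a | ∀ Ψ : M, (Ψ : FreeGCA 𝒰) ∈ Extension.socle D k → σ a Ψ = 0}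
      zero_mem' := fun Ψ _ => by rw [map_zero, LinearMap.zero_apply]
      add_mem' := fun {a b} ha hb Ψ hΨ => by
        rw [map_add, LinearMap.add_apply, ha Ψ hΨ, hb Ψ hΨ, add_zero]
      smul_mem' := fun r a ha Ψ hΨ => by
        rw [smul_eq_mul, map_mul, Module.End.mul_apply, ha Ψ hΨ, map_zero] }
  have hJ : ∀ k, α.I ^ k ≤ J k := by
    intro k
    induction k with
    | zero =>
      intro a _ Ψ hΨ
      have : Ψ = 0 := Subtype.ext ((Submodule.mem_bot ℚ).mp hΨ)
      rw [this, map_zero]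
    | succ k ih =>
      rw [Submodule.pow_succ, Ideal.mul_le]
      intro r hr s hs Ψ hΨ
      obtain ⟨t, rfl⟩ := α.evalUL_surjective s
      have ht : LieWord.aug 𝒱 t = 0 := (α.augUL_evalUL t).symm.trans hs
      rw [map_mul, Module.End.mul_apply]
      refine ih hr _ ?_
      rw [hσ]
      have h := LieWord.act_sub_aug_mem_socle t hΨ
      rwa [ht, zero_smul, sub_zero] at h
  have h := hJ n ht ⟨Φ, hΦ⟩ hn
  rw [← hσ t ⟨Φ, hΦ⟩, h]
  rfl

theorem exists_isGood₂ (hD : IsAcyclicClosure S D) (Φ Ψ : FreeGCA 𝒰) :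
    ∃ (α : S.Index) (n : ℕ), IsGood D Φ α n ∧ IsGood D Ψ α n := by
  obtain ⟨α, m, hΦ⟩ := exists_isGood hD Φ
  obtain ⟨β, n, hΨ⟩ := exists_isGood hD Ψ
  exact ⟨α.sup β, max m n, hΦ.mono (α.le_sup_left β) (le_max_left _ _),
    hΨ.mono (α.le_sup_right β) (le_max_right _ _)⟩

/-- Auxiliary to `holonomy`. -/
def holonomyFun (hD : IsAcyclicClosure S D) (a : S.completion) (Φ : FreeGCA 𝒰) : FreeGCA 𝒰 :=
  LieWord.act D ((exists_isGood hD Φ).choose.exists_approximates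
    (exists_isGood hD Φ).choose_spec.choose a).choose Φ

/-- Both words are compared with a third one, which approximates `a` at a common refinement of the
two levels. -/
theorem IsGood.act_eq {Φ : FreeGCA 𝒰} {α β : S.Index} {m n : ℕ} (hΦ : IsGood D Φ α m)
    (hΦ' : IsGood D Φ β n) {s t : LieWord 𝒱} {a : S.completion} (hs : α.Approximates m s a)
    (ht : β.Approximates n t a) : LieWord.act D s Φ = LieWord.act D t Φ := by
  obtain ⟨r, hr⟩ := (α.sup β).exists_approximates (max m n) a
  have h1 := hΦ _ (hs.sub_mem (hr.mono (α.le_sup_left β) (le_max_left _ _)))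
  have h2 := hΦ' _ (ht.sub_mem (hr.mono (α.le_sup_right β) (le_max_right _ _)))
  rw [LieWord.act_sub, sub_eq_zero] at h1 h2
  rw [h1, h2]

theorem holonomyFun_eq (hD : IsAcyclicClosure S D) {Φ : FreeGCA 𝒰} {α : S.Index} {n : ℕ}
    (hΦ : IsGood D Φ α n) {t : LieWord 𝒱} {a : S.completion} (ht : α.Approximates n t a) :
    holonomyFun hD a Φ = LieWord.act D t Φ :=
  IsGood.act_eq (exists_isGood hD Φ).choose_spec.choose_spec hΦ
    ((exists_isGood hD Φ).choose.exists_approximates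
      (exists_isGood hD Φ).choose_spec.choose a).choose_spec ht

theorem holonomyFun_add (hD : IsAcyclicClosure S D) (a : S.completion) (Φ Ψ : FreeGCA 𝒰) :
    holonomyFun hD a (Φ + Ψ) = holonomyFun hD a Φ + holonomyFun hD a Ψ := by
  obtain ⟨α, n, hΦ, hΨ⟩ := exists_isGood₂ hD Φ Ψ
  obtain ⟨t, ht⟩ := α.exists_approximates n a
  have h : IsGood D (Φ + Ψ) α n := fun s hs => by rw [map_add, hΦ s hs, hΨ s hs, add_zero]
  rw [holonomyFun_eq hD hΦ ht, holonomyFun_eq hD hΨ ht, holonomyFun_eq hD h ht, map_add]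

theorem holonomyFun_smul (hD : IsAcyclicClosure S D) (a : S.completion) (r : ℚ) (Φ : FreeGCA 𝒰) :
    holonomyFun hD a (r • Φ) = r • holonomyFun hD a Φ := by
  obtain ⟨α, n, hΦ⟩ := exists_isGood hD Φ
  obtain ⟨t, ht⟩ := α.exists_approximates n a
  have h : IsGood D (r • Φ) α n := fun s hs => by rw [map_smul, hΦ s hs, smul_zero]
  rw [holonomyFun_eq hD hΦ ht, holonomyFun_eq hD h ht, map_smul]

theorem add_holonomyFun (hD : IsAcyclicClosure S D) (a b : S.completion) (Φ : FreeGCA 𝒰) :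
    holonomyFun hD (a + b) Φ = holonomyFun hD a Φ + holonomyFun hD b Φ := by
  obtain ⟨α, n, hΦ⟩ := exists_isGood hD Φ
  obtain ⟨s, hs⟩ := α.exists_approximates n a
  obtain ⟨t, ht⟩ := α.exists_approximates n b
  have h : α.Approximates n (s + t) (a + b) := by
    rw [Index.Approximates, map_add, map_add, hs, ht]; rfl
  rw [holonomyFun_eq hD hΦ hs, holonomyFun_eq hD hΦ ht, holonomyFun_eq hD hΦ h, LieWord.act_add]

theorem smul_holonomyFun (hD : IsAcyclicClosure S D) (r : ℚ) (a : S.completion) (Φ : FreeGCA 𝒰) :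
    holonomyFun hD (r • a) Φ = r • holonomyFun hD a Φ := by
  obtain ⟨α, n, hΦ⟩ := exists_isGood hD Φ
  obtain ⟨s, hs⟩ := α.exists_approximates n a
  have h : α.Approximates n (r • s) (r • a) := by
    have h' : Ideal.Quotient.mk (α.I ^ n) (r • α.evalUL s) =
      r • Ideal.Quotient.mk (α.I ^ n) (α.evalUL s) := rfl
    rw [Index.Approximates, map_smul, h', hs]; rfl
  rw [holonomyFun_eq hD hΦ hs, holonomyFun_eq hD hΦ h, LieWord.act_smul]

theorem one_holonomyFun (hD : IsAcyclicClosure S D) (Φ : FreeGCA 𝒰) :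
    holonomyFun hD 1 Φ = Φ := by
  obtain ⟨α, n, hΦ⟩ := exists_isGood hD Φ
  have h : α.Approximates n 1 (1 : S.completion) := by
    rw [Index.Approximates, map_one, map_one]; rfl
  rw [holonomyFun_eq hD hΦ h, map_one, Module.End.one_apply]

theorem mul_holonomyFun (hD : IsAcyclicClosure S D) (a b : S.completion) (Φ : FreeGCA 𝒰) :
    holonomyFun hD (a * b) Φ = holonomyFun hD a (holonomyFun hD b Φ) := by
  obtain ⟨α, n, hΦ, hΨ⟩ := exists_isGood₂ hD Φ (holonomyFun hD b Φ)
  obtain ⟨s, hs⟩ := α.exists_approximates n a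
  obtain ⟨t, ht⟩ := α.exists_approximates n b
  have h : α.Approximates n (s * t) (a * b) := by
    rw [Index.Approximates, map_mul, map_mul, hs, ht]; rfl
  rw [holonomyFun_eq hD hΨ hs, holonomyFun_eq hD hΦ h, LieWord.act_mul, holonomyFun_eq hD hΦ ht]

/-- Auxiliary to `holonomy`. -/
def holonomyEnd (hD : IsAcyclicClosure S D) : S.completion →ₗ[ℚ] Module.End ℚ (FreeGCA 𝒰) :=
  LinearMap.mk₂ ℚ (holonomyFun hD) (add_holonomyFun hD) (smul_holonomyFun hD)
    (holonomyFun_add hD) (fun r a Φ => holonomyFun_smul hD a r Φ)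

/-- The holonomy representation of the Sullivan completion of `UL_V` in `∧U`. -/
def holonomy (hD : IsAcyclicClosure S D) : S.completion →ₐ[ℚ] Module.End ℚ (FreeGCA 𝒰) :=
  AlgHom.ofLinearMap (holonomyEnd hD) (LinearMap.ext (one_holonomyFun hD))
    (fun a b => LinearMap.ext (mul_holonomyFun hD a b))

theorem holonomy_apply (hD : IsAcyclicClosure S D) {Φ : FreeGCA 𝒰} {α : S.Index} {n : ℕ}
    (hΦ : IsGood D Φ α n) {t : LieWord 𝒱} {a : S.completion} (ht : α.Approximates n t a) :
    holonomy hD a Φ = LieWord.act D t Φ := holonomyFun_eq hD hΦ ht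

theorem isHolonomy_holonomy (hD : IsAcyclicClosure S D) : IsHolonomy S D (holonomy hD) where
  extends_lie p x := by
    ext Φ
    obtain ⟨α, n, hΦ⟩ := exists_isGood hD Φ
    rw [← evalCompletion_of, holonomy_apply hD hΦ (α.approximates_evalCompletion n _),
      LieWord.act_of]
  locally Φ := by
    obtain ⟨α, n, hΦ⟩ := exists_isGood hD Φ
    refine ⟨α, n, fun a ha => ?_⟩
    have h : α.Approximates n 0 a := by rw [Index.Approximates, map_zero, map_zero, ha]
    rw [holonomy_apply hD hΦ h, map_zero, LinearMap.zero_apply]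

/-- On a fixed `Φ` both representations factor through one quotient, where `a` is represented by a
word, and on words they agree because they agree on letters. -/
theorem IsHolonomy.eq_holonomy (hD : IsAcyclicClosure S D)
    {ρ : S.completion →ₐ[ℚ] Module.End ℚ (FreeGCA 𝒰)} (hρ : IsHolonomy S D ρ) :
    ρ = holonomy hD := by
  have hw : ∀ t : LieWord 𝒱, ρ (S.evalCompletion t) = LieWord.act D t := by
    intro t
    have : ρ.comp S.evalCompletion = LieWord.act D := by
      apply FreeAlgebra.hom_ext
      funext x
      change ρ (S.evalCompletion (LieWord.of x.2)) = LieWord.act D (LieWord.of x.2)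
      rw [evalCompletion_of, hρ.extends_lie, LieWord.act_of]
    exact DFunLike.congr_fun this t
  ext a Φ
  obtain ⟨α, m, hΦ⟩ := exists_isGood hD Φ
  obtain ⟨β, n, hβ⟩ := hρ.locally Φ
  obtain ⟨t, ht⟩ := (α.sup β).exists_approximates (max m n) a
  rw [holonomy_apply hD (hΦ.mono (α.le_sup_left β) (le_max_left m n)) ht, ← hw, ← sub_eq_zero,
    ← LinearMap.sub_apply, ← map_sub]
  apply hβ
  have h := ht.mono (α.le_sup_right β) (le_max_right m n)
  change a.1 β n - (S.evalCompletion t).1 β n = 0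
  rw [evalCompletion_apply, h, sub_self]

end Words

/-! ### The pairing of `∧U` with words: injectivity, and representability of admissible forms. -/

section Duality

variable {V : Type u} [AddCommGroup V] [Module ℚ V] {𝒱 : ℕ → Submodule ℚ V}
  {U : Type v} [AddCommGroup U] [Module ℚ U] {𝒰 : ℕ → Submodule ℚ U}
  [DirectSum.Decomposition 𝒱] [DirectSum.Decomposition 𝒰]
  {S : MinimalSullivanAlgebra 𝒱} {D : Extension 𝒱 𝒰 →ₗ[ℚ] Extension 𝒱 𝒰}

open MinimalSullivanAlgebra

namespace LieWord

theorem sgn_of_odd {k : ℕ} (hk : Odd k) (t : LieWord 𝒱) : sgn 𝒱 k t = sgn 𝒱 1 t := by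
  induction t using induction with
  | algebraMap r => rw [AlgHom.commutes, AlgHom.commutes]
  | of p x => rw [sgn_of, sgn_of, pow_mul, hk.neg_one_pow, one_mul]
  | mul s t h₁ h₂ => rw [map_mul, map_mul, h₁, h₂]
  | add s t h₁ h₂ => rw [map_add, map_add, h₁, h₂]

theorem act_one (hD : IsDifferential (Extension.gr 𝒱 𝒰) D) (t : LieWord 𝒱) :
    act D t 1 = aug 𝒱 t • (1 : FreeGCA 𝒰) := by
  induction t using induction with
  | algebraMap r => rw [act_algebraMap, AlgHom.commutes, Algebra.algebraMap_self_apply]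
  | of p x => rw [act_of, aug_of, zero_smul, Extension.holonomyLie_one hD]
  | mul s t h₁ h₂ => rw [act_mul, h₂, map_smul, h₁, smul_smul, map_mul, mul_comm]
  | add s t h₁ h₂ => rw [act_add, h₁, h₂, map_add, add_smul]

end LieWord

theorem MinimalSullivanAlgebra.Index.evalUL_sgn_one (α : S.Index) (t : LieWord 𝒱) :
    α.evalUL (LieWord.sgn 𝒱 1 t) = α.signUL (α.evalUL t) := by
  induction t using LieWord.induction with
  | algebraMap r => simp only [AlgHom.commutes]
  | of p x =>
    rw [LieWord.sgn_of, map_smul, Index.evalUL_of, one_mul, Index.signUL, Index.liftUL_toUL,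
      LinearMap.comp_apply, Index.signLie_res, map_smul]
  | mul s t h₁ h₂ => simp only [map_mul, h₁, h₂]
  | add s t h₁ h₂ => simp only [map_add, h₁, h₂]

theorem MinimalSullivanAlgebra.Index.signUL_mem_pow (α : S.Index) {n : ℕ} {a : α.UL}
    (ha : a ∈ α.I ^ n) : α.signUL a ∈ α.I ^ n :=
  pow_le_comap (α.signUL : α.UL →+* α.UL) α.I α.I (fun b hb => by
    have hb' : α.augUL b = 0 := hb
    exact (α.augUL_signUL b).trans hb') le_rfl ha

theorem MinimalSullivanAlgebra.Index.evalUL_sgn_mem_pow (α : S.Index) (k : ℕ) {n : ℕ}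
    {t : LieWord 𝒱} (ht : α.evalUL t ∈ α.I ^ n) : α.evalUL (LieWord.sgn 𝒱 k t) ∈ α.I ^ n := by
  rcases Nat.even_or_odd k with hk | hk
  · rwa [LieWord.sgn_of_even hk]
  · rw [LieWord.sgn_of_odd hk, Index.evalUL_sgn_one]
    exact α.signUL_mem_pow ht

variable (D) in
/-- The pairing `(Φ, t) ↦ ε(t · Φ)` of `∧U` with words. -/
def wordPairing : FreeGCA 𝒰 →ₗ[ℚ] Module.Dual ℚ (LieWord 𝒱) :=
  (LieWord.act D).toLinearMap.flip.compr₂ (FreeGCA.aug 𝒰).toLinearMap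

theorem wordPairing_apply (Φ : FreeGCA 𝒰) (t : LieWord 𝒱) :
    wordPairing D Φ t = FreeGCA.aug 𝒰 (LieWord.act D t Φ) := rfl

/-- Testing against words `t x` shows that each `θ_x Φ` pairs to zero, hence vanishes by induction
on the socle layer. Testing against `1` gives augmentation zero, and such an invariant is zero. -/
theorem eq_zero_of_wordPairing_eq_zero (hD : IsAcyclicClosure S D) {Φ : FreeGCA 𝒰}
    (h : wordPairing D Φ = 0) : Φ = 0 := by
  obtain ⟨n, hn⟩ := Extension.exists_mem_socle hD Φ
  induction n generalizing Φ with
  | zero => exact (Submodule.mem_bot ℚ).mp hn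
  | succ n ih =>
    refine Extension.eq_zero_of_holonomyLie_eq_zero hD (fun p x => ih ?_ (Extension.mem_socle_succ.mp hn p x)) ?_
    · ext t
      have h' := LinearMap.congr_fun h (t * LieWord.of x)
      rwa [wordPairing_apply, LieWord.act_mul, LieWord.act_of] at h'
    · have h' := LinearMap.congr_fun h 1
      rwa [wordPairing_apply, _root_.map_one, Module.End.one_apply] at h'

variable (S) in
/-- The linear form `c` on words factors through some `UL_α / I_α^n`. -/
def IsAdmissible (c : Module.Dual ℚ (LieWord 𝒱)) : Prop :=
  ∃ (α : S.Index) (n : ℕ), ∀ t : LieWord 𝒱, α.evalUL t ∈ α.I ^ n → c t = 0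

theorem isAdmissible_wordPairing (hD : IsAcyclicClosure S D) (Φ : FreeGCA 𝒰) :
    IsAdmissible S (wordPairing D Φ) := by
  obtain ⟨α, n, h⟩ := exists_isGood hD Φ
  exact ⟨α, n, fun t ht => by rw [wordPairing_apply, h t ht, map_zero]⟩

theorem IsAdmissible.sub {c c' : Module.Dual ℚ (LieWord 𝒱)} (hc : IsAdmissible S c)
    (hc' : IsAdmissible S c') : IsAdmissible S (c - c') := by
  obtain ⟨α, m, hc⟩ := hc
  obtain ⟨β, n, hc'⟩ := hc'
  refine ⟨α.sup β, max m n, fun t ht => ?_⟩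
  rw [LinearMap.sub_apply,
    hc t (Index.evalUL_mem_pow (α.le_sup_left β) (le_max_left _ _) ht),
    hc' t (Index.evalUL_mem_pow (α.le_sup_right β) (le_max_right _ _) ht), sub_zero]

/-- Admissible forms respect every relation valid in all `UL_α`; the bracket relation and linearity
in a letter are drawn from this. -/
theorem IsAdmissible.congr {c : Module.Dual ℚ (LieWord 𝒱)} (hc : IsAdmissible S c)
    {s t : LieWord 𝒱} (h : ∀ α : S.Index, α.evalUL s = α.evalUL t) : c s = c t := by
  obtain ⟨α, n, hc⟩ := hc
  rw [← sub_eq_zero, ← map_sub]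
  apply hc
  rw [map_sub, h, sub_self]
  exact zero_mem _

theorem IsAdmissible.of_mul_of_mul {c : Module.Dual ℚ (LieWord 𝒱)} (hc : IsAdmissible S c)
    {p q : ℕ} (x : lie 𝒱 p) (y : lie 𝒱 q) (t : LieWord 𝒱) :
    c (LieWord.of x * (LieWord.of y * t)) = (-1 : ℚ) ^ (p * q) *
      c (LieWord.of y * (LieWord.of x * t)) + c (LieWord.of (S.bracket x y) * t) := by
  have h : c (LieWord.of x * (LieWord.of y * t)) = c ((-1 : ℚ) ^ (p * q) •
      (LieWord.of y * (LieWord.of x * t)) + LieWord.of (S.bracket x y) * t) := by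
    refine hc.congr fun α => ?_
    simp only [map_mul, map_add, map_smul, α.evalUL_of, ← mul_assoc]
    rw [α.toUL_mul x y, add_mul, smul_mul_assoc]
  rw [h, map_add, map_smul, smul_eq_mul]

theorem IsAdmissible.of_add_smul_mul {c : Module.Dual ℚ (LieWord 𝒱)} (hc : IsAdmissible S c)
    {p : ℕ} (x y : lie 𝒱 p) (r : ℚ) (t : LieWord 𝒱) :
    c (LieWord.of (y + r • x) * t) = c (LieWord.of y * t) + r * c (LieWord.of x * t) := by
  have h : c (LieWord.of (y + r • x) * t) = c (LieWord.of y * t + r • (LieWord.of x * t)) := by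
    refine hc.congr fun α => ?_
    simp only [map_mul, map_add, map_smul, α.evalUL_of, Submodule.coe_add, Submodule.coe_smul,
      add_mul, smul_mul_assoc]
  rw [h, map_add, map_smul, smul_eq_mul]

/-- The letter `x` lies in the augmentation ideal, so `x^n` lies in `I_α^n`. The exponent bounds the
inner induction in `exists_eq_wordPairing_of_vanishesOn`. -/
theorem IsAdmissible.exists_pow {c : Module.Dual ℚ (LieWord 𝒱)} (hc : IsAdmissible S c)
    {p : ℕ} (x : lie 𝒱 p) : ∃ N, ∀ t, c (LieWord.of x ^ N * t) = 0 := by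
  obtain ⟨α, n, hc⟩ := hc
  refine ⟨n, fun t => hc _ ?_⟩
  rw [map_mul, map_pow]
  refine Ideal.mul_mem_right _ _ (Ideal.pow_mem_pow ?_ n)
  change α.augUL (α.evalUL (LieWord.of x)) = 0
  rw [α.augUL_evalUL, LieWord.aug_of]

/-- The operation on linear forms on words which is dual to `t ↦ (-1)^{p deg t} x t`. -/
def translate {p : ℕ} (x : lie 𝒱 p) (c : Module.Dual ℚ (LieWord 𝒱)) :
    Module.Dual ℚ (LieWord 𝒱) :=
  c ∘ₗ LinearMap.mulLeft ℚ (LieWord.of x) ∘ₗ (LieWord.sgn 𝒱 p).toLinearMap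

theorem translate_apply {p : ℕ} (x : lie 𝒱 p) (c : Module.Dual ℚ (LieWord 𝒱)) (t : LieWord 𝒱) :
    translate x c t = c (LieWord.of x * LieWord.sgn 𝒱 p t) := rfl

theorem IsAdmissible.translate {c : Module.Dual ℚ (LieWord 𝒱)} (hc : IsAdmissible S c) {p : ℕ}
    (x : lie 𝒱 p) : IsAdmissible S (translate x c) := by
  obtain ⟨α, n, hc⟩ := hc
  refine ⟨α, n, fun t ht => hc _ ?_⟩
  change α.evalUL (LieWord.of x * LieWord.sgn 𝒱 p t) ∈ _
  rw [map_mul]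
  exact Ideal.mul_mem_left _ _ (α.evalUL_sgn_mem_pow p ht)

theorem translate_of_mul {p q : ℕ} (x : lie 𝒱 p) (y : lie 𝒱 q) (c : Module.Dual ℚ (LieWord 𝒱))
    (t : LieWord 𝒱) : translate x c (LieWord.of y * t) =
      (-1 : ℚ) ^ (p * q) * c (LieWord.of x * (LieWord.of y * LieWord.sgn 𝒱 p t)) := by
  rw [translate_apply, map_mul (LieWord.sgn 𝒱 p), LieWord.sgn_of, smul_mul_assoc, mul_smul_comm, map_smul,
    smul_eq_mul]

theorem translate_pow_mul {p : ℕ} (x : lie 𝒱 p) {c : Module.Dual ℚ (LieWord 𝒱)} {N : ℕ}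
    (h : ∀ t, c (LieWord.of x ^ (N + 1) * t) = 0) (t : LieWord 𝒱) :
    translate x c (LieWord.of x ^ N * t) = 0 := by
  rw [translate_apply, map_mul (LieWord.sgn 𝒱 p), map_pow, LieWord.sgn_of, smul_pow, smul_mul_assoc, mul_smul_comm,
    map_smul, ← mul_assoc, ← pow_succ', h, smul_zero]

variable (D) in
/-- The linear form `c` on words vanishes on `y t` for every `y` vanishing on `δ(Z)`. -/
def VanishesOn (Z : Submodule ℚ U) (c : Module.Dual ℚ (LieWord 𝒱)) : Prop :=
  ∀ (q : ℕ) (y : lie 𝒱 q), (∀ u ∈ Z, y.1 (Extension.delta D u) = 0) →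
    ∀ t, c (LieWord.of y * t) = 0

/-- The composite of `θ_y` with `ε` is a derivation over `ε`, and it is `-y ∘ δ` on generators. -/
theorem aug_holonomyLie_eq_zero (hD : IsDifferential (Extension.gr 𝒱 𝒰) D) {Z : Submodule ℚ U}
    {q : ℕ} {y : lie 𝒱 q} (hy : ∀ u ∈ Z, y.1 (Extension.delta D u) = 0) {Φ : FreeGCA 𝒰}
    (hΦ : Φ ∈ FreeGCA.sub 𝒰 Z) : FreeGCA.aug 𝒰 (Extension.holonomyLie D y.1 Φ) = 0 := by
  induction hΦ using Algebra.adjoin_induction with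
  | mem w hw =>
    obtain ⟨w, hw, rfl⟩ := hw
    rw [Extension.aug_holonomyLie_ι, hy w hw, neg_zero]
  | algebraMap r =>
    rw [Algebra.algebraMap_eq_smul_one, map_smul, Extension.holonomyLie_one hD, smul_zero, map_zero]
  | add a b _ _ h₁ h₂ => rw [map_add, map_add, h₁, h₂, add_zero]
  | mul a b _ _ h₁ h₂ =>
    rw [Extension.holonomyLie_mul hD, map_add, map_mul, map_mul, h₁, h₂, zero_mul, mul_zero,
      add_zero]

theorem vanishesOn_wordPairing (hD : IsAcyclicClosure S D) {Z : Submodule ℚ U}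
    (hZ : Extension.IsFlag D Z) {Φ : FreeGCA 𝒰} (hΦ : Φ ∈ FreeGCA.sub 𝒰 Z) :
    VanishesOn D Z (wordPairing D Φ) := by
  intro q y hy t
  rw [wordPairing_apply, LieWord.act_mul, LieWord.act_of]
  exact aug_holonomyLie_eq_zero hD.isDifferential hy (LieWord.act_mem_sub hD hZ t hΦ)

/-- For the zero flag every letter in front kills `c`, so `c` is a multiple of the augmentation,
which is represented by `1`. -/
theorem eq_wordPairing_of_vanishesOn_bot (hD : IsAcyclicClosure S D)
    {c : Module.Dual ℚ (LieWord 𝒱)} (hc : VanishesOn D ⊥ c) :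
    c = wordPairing D (c 1 • (1 : FreeGCA 𝒰)) := by
  have key : ∀ s t, c (s * t) = LieWord.aug 𝒱 s * c t := by
    intro s
    induction s using LieWord.induction with
    | algebraMap r =>
      intro t
      rw [AlgHom.commutes, Algebra.algebraMap_self_apply, ← Algebra.smul_def, map_smul, smul_eq_mul]
    | of p x =>
      intro t
      rw [LieWord.aug_of, zero_mul]
      refine hc p x (fun u hu => ?_) t
      rw [(Submodule.mem_bot ℚ).mp hu, map_zero, map_zero]
    | mul a b h₁ h₂ => intro t; rw [mul_assoc, h₁, h₂, map_mul, mul_assoc]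
    | add a b h₁ h₂ => intro t; rw [add_mul, map_add, h₁, h₂, map_add, add_mul]
  ext t
  have h := key t 1
  rw [mul_one] at h
  rw [h, wordPairing_apply, map_smul, LieWord.act_one hD.isDifferential, map_smul, map_smul,
    _root_.map_one (FreeGCA.aug 𝒰), smul_eq_mul, smul_eq_mul, mul_one, mul_comm]

/-- A homogeneous generator `u` outside a flag `Z` with `D u ∈ ∧V ⊗ ∧Z`, with a dual element `x` of the
homotopy Lie algebra. -/
structure DualPair (D : Extension 𝒱 𝒰 →ₗ[ℚ] Extension 𝒱 𝒰) (Z : Submodule ℚ U) {p : ℕ} (u : U)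
    (x : lie 𝒱 p) : Prop where
  isFlag : Extension.IsFlag D Z
  mem : u ∈ 𝒰 p
  D_mem : D (1 ᵍ⊗ₜ[ℚ] FreeGCA.ι 𝒰 u) ∈ Extension.sub 𝒱 𝒰 Z
  apply_of_mem : ∀ w ∈ Z, x.1 (Extension.delta D w) = 0
  apply_self : x.1 (Extension.delta D u) = -1

theorem exists_dualPair (hD : IsAcyclicClosure S D) {Z : Submodule ℚ U}
    (hZ : Extension.IsFlag D Z) {p : ℕ} {u : U} (hu : u ∈ 𝒰 p) (huZ : u ∉ Z)
    (hDu : D (1 ᵍ⊗ₜ[ℚ] FreeGCA.ι 𝒰 u) ∈ Extension.sub 𝒱 𝒰 Z) : ∃ x : lie 𝒱 p, DualPair D Z u x := by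
  obtain ⟨f, hfu, hfZ⟩ := Submodule.exists_le_ker_of_notMem huZ
  -- The factor normalises `x(δu)` to `-1`; with the sign in the definition of the holonomy
  -- operators this gives `ε(θ_x u) = 1`.
  let g : Module.Dual ℚ V := (-(f u)⁻¹) • (f ∘ₗ (Extension.deltaEquiv hD).symm.toLinearMap)
  have hg : ∀ w, g (Extension.delta D w) = -(f u)⁻¹ * f w := by
    intro w
    rw [← Extension.deltaEquiv_apply hD]
    simp [g]
  refine ⟨liePart 𝒱 p g, hZ, hu, hDu, fun w hw => ?_, ?_⟩
  · rw [liePart_apply, ← Extension.delta_gradedProj hD.isDifferential, hg]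
    have : gradedProj 𝒰 p w ∈ Z := hZ.isGraded w hw p
    rw [show f (gradedProj 𝒰 p w) = 0 from hfZ this, mul_zero]
  · rw [liePart_apply, ← Extension.delta_gradedProj hD.isDifferential, gradedProj_of_mem hu, hg]
    field_simp

namespace DualPair

variable {Z : Submodule ℚ U} {p : ℕ} {u : U} {x : lie 𝒱 p}

theorem isFlag_sup (h : DualPair D Z u x) : Extension.IsFlag D (Z ⊔ Submodule.span ℚ {u}) :=
  .sup_span h.isFlag h.mem h.D_mem

theorem holonomyLie_ι_mem (h : DualPair D Z u x) (f : Module.Dual ℚ V) {w : U}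
    (hw : w ∈ Z ⊔ Submodule.span ℚ {u}) :
    Extension.holonomyLie D f (FreeGCA.ι 𝒰 w) ∈ FreeGCA.sub 𝒰 Z := by
  obtain ⟨a, ha, b, hb, rfl⟩ := Submodule.mem_sup.mp hw
  obtain ⟨r, rfl⟩ := Submodule.mem_span_singleton.mp hb
  rw [map_add, map_add, map_smul, map_smul]
  exact add_mem (h.isFlag.holonomyLie_ι_mem f ha)
    (Subalgebra.smul_mem _ (neg_mem (Extension.slant_mem_sub _ h.D_mem)) r)

/-- Every operator moves `u` into `∧Z`, since `D u ∈ ∧V ⊗ ∧Z`, and there `x` and `y` have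
augmentation zero. So bracketing with `x` takes the annihilator of `δ(Z)` into that of `δ(Z ⊕ ℚu)`;
the case `y = x` is used for odd `x`. -/
theorem bracket_apply (hD : IsAcyclicClosure S D) (h : DualPair D Z u x) {q : ℕ} {y : lie 𝒱 q}
    (hy : ∀ w ∈ Z, y.1 (Extension.delta D w) = 0) {w : U}
    (hw : w ∈ Z ⊔ Submodule.span ℚ {u}) : (S.bracket x y).1 (Extension.delta D w) = 0 := by
  have e := congrArg (FreeGCA.aug 𝒰) (Extension.holonomyLie_holonomyLie hD x y (FreeGCA.ι 𝒰 w))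
  rw [map_add, map_smul, aug_holonomyLie_eq_zero hD.isDifferential h.apply_of_mem
    (h.holonomyLie_ι_mem _ hw), aug_holonomyLie_eq_zero hD.isDifferential hy
    (h.holonomyLie_ι_mem _ hw), smul_zero, zero_add, Extension.aug_holonomyLie_ι] at e
  linarith

end DualPair

/-- The derivation `del` of `∧U` is determined by `del u = ε(x · u)` for `u ∈ U`. -/
structure IsLinearization (D : Extension 𝒱 𝒰 →ₗ[ℚ] Extension 𝒱 𝒰) {p : ℕ} (x : lie 𝒱 p)
    (del : FreeGCA 𝒰 →ₗ[ℚ] FreeGCA 𝒰) : Prop where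
  map_ι : ∀ w, del (FreeGCA.ι 𝒰 w) = algebraMap ℚ _ (-x.1 (Extension.delta D w))
  map_mul : ∀ a b, del (a * b) = del a * b + (FreeGCA.sgn 𝒰 ^ p) a * del b

theorem exists_isLinearization (hD : IsDifferential (Extension.gr 𝒱 𝒰) D) {p : ℕ} (x : lie 𝒱 p) :
    ∃ del, IsLinearization D x del := by
  obtain ⟨del, h₁, h₂⟩ := FreeGCA.exists_derivation (𝒱 := 𝒰) p (-(x.1 ∘ₗ Extension.delta D))
    (fun i hi v hv => by
      rw [LinearMap.neg_apply, LinearMap.comp_apply,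
        x.2 (i + 1) (by omega) _ (Extension.delta_mem hD hv), neg_zero])
  exact ⟨del, h₁, h₂⟩

namespace IsLinearization

variable {p : ℕ} {x : lie 𝒱 p} {del : FreeGCA 𝒰 →ₗ[ℚ] FreeGCA 𝒰}

theorem map_one (h : IsLinearization D x del) : del 1 = 0 := by
  have e := h.map_mul 1 1
  rw [_root_.map_one (FreeGCA.sgn 𝒰 ^ p), one_mul, mul_one, one_mul] at e
  simpa using e

/-- Both sides are derivations over `ε` with the same values on generators. -/
theorem aug_apply (hD : IsDifferential (Extension.gr 𝒱 𝒰) D) (h : IsLinearization D x del)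
    (Φ : FreeGCA 𝒰) :
    FreeGCA.aug 𝒰 (del Φ) = FreeGCA.aug 𝒰 (Extension.holonomyLie D x.1 Φ) := by
  induction Φ using FreeGCA.monomial_induction with
  | one => rw [h.map_one, Extension.holonomyLie_one hD]
  | add a b h₁ h₂ => simp only [map_add, h₁, h₂]
  | smul r a h₁ => simp only [map_smul, h₁]
  | ι_mul i v a hv h₁ =>
    rw [h.map_mul, Extension.holonomyLie_mul hD, map_add, map_add, _root_.map_mul,
      _root_.map_mul, _root_.map_mul, _root_.map_mul, h.map_ι, Extension.aug_holonomyLie_ι,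
      AlgHom.commutes, FreeGCA.aug_sgn_pow, FreeGCA.aug_ι, zero_mul, zero_mul]
    rfl

theorem eq_zero_of_mem (h : IsLinearization D x del) {Z : Submodule ℚ U}
    (hZ : ∀ w ∈ Z, x.1 (Extension.delta D w) = 0) {Φ : FreeGCA 𝒰} (hΦ : Φ ∈ FreeGCA.sub 𝒰 Z) :
    del Φ = 0 := by
  induction hΦ using Algebra.adjoin_induction with
  | mem w hw =>
    obtain ⟨w, hw, rfl⟩ := hw
    rw [h.map_ι, hZ w hw, neg_zero, map_zero]
  | algebraMap r => rw [Algebra.algebraMap_eq_smul_one, map_smul, h.map_one, smul_zero]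
  | add a b _ _ h₁ h₂ => rw [map_add, h₁, h₂, add_zero]
  | mul a b _ _ h₁ h₂ => rw [h.map_mul, h₁, h₂, zero_mul, mul_zero, add_zero]

theorem mem_sub (h : IsLinearization D x del) {Z : Submodule ℚ U} (hZ : FreeGCA.IsGraded 𝒰 Z)
    {Φ : FreeGCA 𝒰} (hΦ : Φ ∈ FreeGCA.sub 𝒰 Z) : del Φ ∈ FreeGCA.sub 𝒰 Z := by
  induction hΦ using Algebra.adjoin_induction with
  | mem w hw =>
    obtain ⟨w, hw, rfl⟩ := hw
    rw [h.map_ι]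
    exact Subalgebra.algebraMap_mem _ _
  | algebraMap r =>
    rw [Algebra.algebraMap_eq_smul_one, map_smul, h.map_one, smul_zero]
    exact zero_mem _
  | add a b _ _ h₁ h₂ => rw [map_add]; exact add_mem h₁ h₂
  | mul a b ha hb h₁ h₂ =>
    rw [h.map_mul]
    exact add_mem (mul_mem h₁ hb) (mul_mem (FreeGCA.sgn_pow_mem_sub hZ p ha) h₂)

variable {Z : Submodule ℚ U} {u : U}

theorem map_self (h : IsLinearization D x del) (hx : DualPair D Z u x) :
    del (FreeGCA.ι 𝒰 u) = 1 := by
  rw [h.map_ι, hx.apply_self, neg_neg, _root_.map_one]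

/-- The graded commutator is a derivation that kills generators: `θ_y w` lies in `∧Z`, where `del`
is zero, and `del w` is a scalar. In group terms, `del` and `θ_x` are translations from opposite
sides which agree at the identity. -/
theorem holonomyLie_comm (hD : IsAcyclicClosure S D) (h : IsLinearization D x del)
    (hx : DualPair D Z u x) {q : ℕ} (y : lie 𝒱 q) {Φ : FreeGCA 𝒰}
    (hΦ : Φ ∈ FreeGCA.sub 𝒰 (Z ⊔ Submodule.span ℚ {u})) :
    del (Extension.holonomyLie D y.1 Φ) =
      (-1 : ℚ) ^ (p * q) • Extension.holonomyLie D y.1 (del Φ) := by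
  have hd := hD.isDifferential
  induction hΦ using FreeGCA.sub_induction hx.isFlag_sup.isGraded with
  | one _ => rw [h.map_one, Extension.holonomyLie_one hd, map_zero, map_zero, smul_zero]
  | add a b _ _ _ h₁ h₂ => rw [map_add, map_add, h₁, h₂, map_add, map_add, smul_add]
  | smul r a _ _ h₁ => rw [map_smul, map_smul, h₁, map_smul, map_smul, smul_comm]
  | ι_mul i w b _ _ hw hwZ ih =>
    have e1 := h.eq_zero_of_mem hx.apply_of_mem (hx.holonomyLie_ι_mem y.1 hwZ)
    have e2 : (-1 : ℚ) ^ (q * i) • del (FreeGCA.ι 𝒰 w) =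
        algebraMap ℚ _ ((-1 : ℚ) ^ (p * q) * -x.1 (Extension.delta D w)) := by
      rw [h.map_ι]
      by_cases hi : i = p
      · rw [hi, mul_comm q p, _root_.map_mul, Algebra.smul_def]
      · rw [x.2 (i + 1) (by omega) _ (Extension.delta_mem hd hw)]
        simp
    have e3 := Extension.holonomyLie_sgn hd y p (FreeGCA.ι 𝒰 w)
    have e4 : del ((FreeGCA.sgn 𝒰 ^ q) (FreeGCA.ι 𝒰 w)) =
        algebraMap ℚ _ ((-1 : ℚ) ^ (p * q) * -x.1 (Extension.delta D w)) := by
      rw [FreeGCA.sgn_pow_apply q (FreeGCA.ι_mem_gr hw), map_smul, e2]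
    have e5 : (FreeGCA.sgn 𝒰 ^ p) ((FreeGCA.sgn 𝒰 ^ q) (FreeGCA.ι 𝒰 w)) =
        (FreeGCA.sgn 𝒰 ^ q) ((FreeGCA.sgn 𝒰 ^ p) (FreeGCA.ι 𝒰 w)) := by
      rw [← AlgHom.mul_apply, ← AlgHom.mul_apply, ← pow_add, ← pow_add, add_comm]
    have e6 : (-1 : ℚ) ^ (p * q) * (-1 : ℚ) ^ (p * q) = 1 := by rw [← mul_pow]; simp
    rw [Extension.holonomyLie_mul hd, map_add, h.map_mul, h.map_mul, e1, e4, e5, ih, h.map_mul,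
      h.map_ι, ← Algebra.smul_def, ← Algebra.smul_def, map_add, map_smul,
      Extension.holonomyLie_mul hd, e3, zero_mul, zero_add, mul_smul, smul_add, smul_add, smul_mul_assoc, smul_smul _ _
      ((FreeGCA.sgn 𝒰 ^ p) (Extension.holonomyLie D y.1 (FreeGCA.ι 𝒰 w)) * del b), e6, one_smul,
      mul_smul_comm]
    abel

theorem act_comm (hD : IsAcyclicClosure S D) (h : IsLinearization D x del)
    (hx : DualPair D Z u x) (t : LieWord 𝒱) {Φ : FreeGCA 𝒰}
    (hΦ : Φ ∈ FreeGCA.sub 𝒰 (Z ⊔ Submodule.span ℚ {u})) :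
    del (LieWord.act D t Φ) = LieWord.act D (LieWord.sgn 𝒱 p t) (del Φ) := by
  induction t using LieWord.induction generalizing Φ with
  | algebraMap r =>
    rw [AlgHom.commutes (LieWord.sgn 𝒱 p), LieWord.act_algebraMap, LieWord.act_algebraMap, map_smul]
  | of q y =>
    rw [LieWord.act_of, h.holonomyLie_comm hD hx y hΦ, LieWord.sgn_of, LieWord.act_smul,
      LieWord.act_of]
  | mul s t h₁ h₂ =>
    rw [LieWord.act_mul, h₁ (LieWord.act_mem_sub hD hx.isFlag_sup t hΦ), h₂ hΦ, _root_.map_mul,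
      LieWord.act_mul]
  | add s t h₁ h₂ => rw [LieWord.act_add, map_add, h₁ hΦ, h₂ hΦ, map_add, LieWord.act_add]

/-- Up to the sign twist on words, `del` commutes past `t` and then agrees with `θ_x` under `ε`;
this puts the letter `x` in front of `t`. -/
theorem wordPairing_del (hD : IsAcyclicClosure S D) (h : IsLinearization D x del)
    (hx : DualPair D Z u x) {Φ : FreeGCA 𝒰}
    (hΦ : Φ ∈ FreeGCA.sub 𝒰 (Z ⊔ Submodule.span ℚ {u})) :
    wordPairing D (del Φ) = translate x (wordPairing D Φ) := by
  ext t
  rw [translate_apply, wordPairing_apply, wordPairing_apply, LieWord.act_mul, LieWord.act_of,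
    ← h.aug_apply hD.isDifferential, h.act_comm hD hx _ hΦ, LieWord.sgn_sgn]

theorem map_pow_succ (hp : Even p) (h : IsLinearization D x del) (hx : DualPair D Z u x) (j : ℕ) :
    del (FreeGCA.ι 𝒰 u ^ (j + 1)) = ((j : ℚ) + 1) • FreeGCA.ι 𝒰 u ^ j := by
  have hs : ∀ a : FreeGCA 𝒰, (FreeGCA.sgn 𝒰 ^ p) a = a := by
    obtain ⟨k, rfl⟩ := hp
    intro a
    rw [← two_mul, ← add_zero (2 * k), FreeGCA.sgn_pow_two_mul_add, pow_zero, AlgHom.one_apply]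
  induction j with
  | zero => rw [zero_add, pow_one, h.map_self hx]; simp
  | succ j ih =>
    rw [pow_succ' _ (j + 1), h.map_mul, h.map_self hx, one_mul, hs, ih, mul_smul_comm, ← pow_succ']
    push_cast
    module

/-- Integration by parts: `del(u^{j+1} g) = (j+1) u^j g + u^{j+1} del g`, and the last term has a
primitive by induction on the nilpotency order `K` of `del` on `g`. -/
theorem exists_del_eq_pow_mul (hp : Even p) (h : IsLinearization D x del)
    (hx : DualPair D Z u x) (K : ℕ) : ∀ (j : ℕ) (g : FreeGCA 𝒰),
      g ∈ FreeGCA.sub 𝒰 (Z ⊔ Submodule.span ℚ {u}) → (del ^ K) g = 0 →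
      ∃ Φ ∈ FreeGCA.sub 𝒰 (Z ⊔ Submodule.span ℚ {u}), del Φ = FreeGCA.ι 𝒰 u ^ j * g := by
  have hs : ∀ a : FreeGCA 𝒰, (FreeGCA.sgn 𝒰 ^ p) a = a := by
    obtain ⟨k, rfl⟩ := hp
    intro a
    rw [← two_mul, ← add_zero (2 * k), FreeGCA.sgn_pow_two_mul_add, pow_zero, AlgHom.one_apply]
  have hu : FreeGCA.ι 𝒰 u ∈ FreeGCA.sub 𝒰 (Z ⊔ Submodule.span ℚ {u}) :=
    FreeGCA.ι_mem_sub (Submodule.mem_sup_right (Submodule.mem_span_singleton_self u))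
  induction K with
  | zero =>
    intro j g _ h0
    have h0' : g = 0 := h0
    exact ⟨0, zero_mem _, by rw [h0', map_zero, mul_zero]⟩
  | succ K ih =>
    intro j g hg hK
    rw [pow_succ, Module.End.mul_apply] at hK
    obtain ⟨Ψ, hΨ, e⟩ := ih (j + 1) (del g) (h.mem_sub hx.isFlag_sup.isGraded hg) hK
    refine ⟨((j : ℚ) + 1)⁻¹ • (FreeGCA.ι 𝒰 u ^ (j + 1) * g - Ψ),
      Subalgebra.smul_mem _ (sub_mem (mul_mem (pow_mem hu _) hg) hΨ) _, ?_⟩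
    rw [map_smul, map_sub, h.map_mul, h.map_pow_succ hp hx, hs, e, add_sub_cancel_right,
      smul_mul_assoc, smul_smul, inv_mul_cancel₀ (by positivity), one_smul]

end IsLinearization

/-- Moving `y` in front of `x` leaves terms starting with `y` and with `[x, y]`, both of which
annihilate `δ(Z ⊕ ℚu)`. -/
theorem translate_vanishesOn (hD : IsAcyclicClosure S D) {Z : Submodule ℚ U} {p : ℕ} {u : U}
    {x : lie 𝒱 p} (hx : DualPair D Z u x) {c : Module.Dual ℚ (LieWord 𝒱)}
    (hc : IsAdmissible S c) (hcZ : VanishesOn D (Z ⊔ Submodule.span ℚ {u}) c) :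
    VanishesOn D (Z ⊔ Submodule.span ℚ {u}) (translate x c) := by
  intro q y hy t
  rw [translate_of_mul, hc.of_mul_of_mul, hcZ q y hy, hcZ _ _ (fun w hw =>
    hx.bracket_apply hD (fun w hw => hy w (Submodule.mem_sup_left hw)) hw), mul_zero, add_zero,
    mul_zero]

/-- A primitive with respect to `del` of the element representing `translate x c`. -/
theorem exists_primitive (hD : IsAcyclicClosure S D) {Z : Submodule ℚ U} {p : ℕ} {u : U}
    {x : lie 𝒱 p} (hx : DualPair D Z u x) {del : FreeGCA 𝒰 →ₗ[ℚ] FreeGCA 𝒰}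
    (hdel : IsLinearization D x del) {c : Module.Dual ℚ (LieWord 𝒱)}
    (hc : IsAdmissible S c) (hcZ : VanishesOn D (Z ⊔ Submodule.span ℚ {u}) c) {g : FreeGCA 𝒰}
    (hg : g ∈ FreeGCA.sub 𝒰 (Z ⊔ Submodule.span ℚ {u})) (hgc : translate x c = wordPairing D g) :
    ∃ Φ ∈ FreeGCA.sub 𝒰 (Z ⊔ Submodule.span ℚ {u}), del Φ = g := by
  rcases Nat.even_or_odd p with hp | hp
  -- Even degree: `del^k g` represents `t ↦ c(x^{k+1} t)`, which is eventually zero, so `del` is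
  -- nilpotent on `g` and integration by parts applies.
  · obtain ⟨N, hN⟩ := hc.exists_pow x
    have key : ∀ k, (del ^ k) g ∈ FreeGCA.sub 𝒰 (Z ⊔ Submodule.span ℚ {u}) ∧
        ∀ t, wordPairing D ((del ^ k) g) t = c (LieWord.of x ^ (k + 1) * t) := by
      intro k
      induction k with
      | zero =>
        refine ⟨hg, fun t => ?_⟩
        rw [pow_zero, Module.End.one_apply, ← hgc, translate_apply, LieWord.sgn_of_even hp,
          zero_add, pow_one]
      | succ k ih =>
        rw [pow_succ' del, Module.End.mul_apply]
        refine ⟨hdel.mem_sub hx.isFlag_sup.isGraded ih.1, fun t => ?_⟩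
        rw [hdel.wordPairing_del hD hx ih.1, translate_apply, LieWord.sgn_of_even hp, ih.2,
          ← mul_assoc, ← pow_succ]
    have h0 : (del ^ N) g = 0 := by
      refine eq_zero_of_wordPairing_eq_zero hD ?_
      ext t
      rw [(key N).2, pow_succ, mul_assoc, hN, LinearMap.zero_apply]
    obtain ⟨Φ, hΦ, e⟩ := hdel.exists_del_eq_pow_mul hp hx N 0 g hg h0
    exact ⟨Φ, hΦ, by rw [e, pow_zero, one_mul]⟩
  -- Odd degree: the bracket relation gives `2 c(x x t) = c([x, x] t) = 0`. Hence `del g = 0`, and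
  -- `u g` is a primitive.
  · have h0 : del g = 0 := by
      refine eq_zero_of_wordPairing_eq_zero hD ?_
      ext t
      have e := hc.of_mul_of_mul x x t
      rw [hcZ _ _ (fun w hw => hx.bracket_apply hD hx.apply_of_mem hw), add_zero,
        (hp.mul hp).neg_one_pow] at e
      have e' : c (LieWord.of x * (LieWord.of x * t)) = 0 := by linarith
      rw [hdel.wordPairing_del hD hx hg, ← hgc, translate_apply, translate_of_mul,
        LieWord.sgn_sgn, e', mul_zero, LinearMap.zero_apply]
    refine ⟨FreeGCA.ι 𝒰 u * g, mul_mem (FreeGCA.ι_mem_sub (Submodule.mem_sup_right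
      (Submodule.mem_span_singleton_self u))) hg, ?_⟩
    rw [hdel.map_mul, hdel.map_self hx, h0, one_mul, mul_zero, add_zero]

/-- Induction on the flag, and for the last generator `u` with dual `x` on the exponent `N` such
that `c(x^N -) = 0`. Translation by `x` lowers `N`, so the translate of `c` is represented by some
`g`. A primitive `Φ` of `g` represents `c` up to a form which vanishes on words starting with `x`,
and hence belongs to the smaller flag. -/
theorem exists_eq_wordPairing_of_vanishesOn (hD : IsAcyclicClosure S D) {Z : Submodule ℚ U}
    (hZ : Extension.IsFlag D Z) {c : Module.Dual ℚ (LieWord 𝒱)} (hc : IsAdmissible S c)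
    (hcZ : VanishesOn D Z c) : ∃ Φ ∈ FreeGCA.sub 𝒰 Z, c = wordPairing D Φ := by
  induction hZ generalizing c with
  | bot => exact ⟨_, Subalgebra.smul_mem _ (one_mem _) _, eq_wordPairing_of_vanishesOn_bot hD hcZ⟩
  | @sup_span Z p u hZ hu hDu ih =>
    by_cases huZ : u ∈ Z
    · have e : Z ⊔ Submodule.span ℚ {u} = Z :=
        sup_eq_left.mpr ((Submodule.span_singleton_le_iff_mem _ _).mpr huZ)
      rw [e] at hcZ ⊢
      exact ih hc hcZ
    obtain ⟨x, hx⟩ := exists_dualPair hD hZ hu huZ hDu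
    obtain ⟨del, hdel⟩ := exists_isLinearization hD.isDifferential x
    obtain ⟨N, hN⟩ := hc.exists_pow x
    induction N generalizing c with
    | zero =>
      refine ⟨0, zero_mem _, ?_⟩
      ext t
      rw [map_zero, LinearMap.zero_apply]
      simpa using hN t
    | succ N ihN =>
      obtain ⟨g, hg, hgc⟩ := ihN (hc.translate x) (translate_vanishesOn hD hx hc hcZ)
        (translate_pow_mul x hN)
      obtain ⟨Φ, hΦ, rfl⟩ := exists_primitive hD hx hdel hc hcZ hg hgc
      have hc' := hc.sub (isAdmissible_wordPairing hD Φ)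
      have hx0 : ∀ t, (c - wordPairing D Φ) (LieWord.of x * t) = 0 := by
        intro t
        have h' := LinearMap.congr_fun hgc (LieWord.sgn 𝒱 p t)
        rw [hdel.wordPairing_del hD hx hΦ, translate_apply, translate_apply, LieWord.sgn_sgn] at h'
        rw [LinearMap.sub_apply, h', sub_self]
      have hcZ' : VanishesOn D Z (c - wordPairing D Φ) := by
        intro q y hy t
        by_cases hq : q = p
        · subst hq
          -- Since `x(δu) = -1`, adding `y(δu) x` to `y` gives an element that annihilates `δu` as
          -- well, without changing the value of the form.
          have h' := hc'.of_add_smul_mul x y (y.1 (Extension.delta D u)) t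
          rw [hx0, mul_zero, add_zero] at h'
          rw [← h']
          have hy' : ∀ w ∈ Z ⊔ Submodule.span ℚ {u},
              (y + y.1 (Extension.delta D u) • x).1 (Extension.delta D w) = 0 := by
            intro w hw
            obtain ⟨a, ha, b, hb, rfl⟩ := Submodule.mem_sup.mp hw
            obtain ⟨r, rfl⟩ := Submodule.mem_span_singleton.mp hb
            rw [Submodule.coe_add, Submodule.coe_smul, LinearMap.add_apply, LinearMap.smul_apply,
              map_add, map_add, map_add, hy a ha, hx.apply_of_mem a ha, map_smul, map_smul,
              map_smul, hx.apply_self]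
            simp only [smul_eq_mul]
            ring
          rw [LinearMap.sub_apply, hcZ _ _ hy', vanishesOn_wordPairing hD hx.isFlag_sup hΦ _ _ hy',
            sub_self]
        · have hy' : ∀ w ∈ Z ⊔ Submodule.span ℚ {u}, y.1 (Extension.delta D w) = 0 := by
            intro w hw
            obtain ⟨a, ha, b, hb, rfl⟩ := Submodule.mem_sup.mp hw
            obtain ⟨r, rfl⟩ := Submodule.mem_span_singleton.mp hb
            rw [map_add, map_add, hy a ha, map_smul, map_smul,
              y.2 (p + 1) (by omega) _ (Extension.delta_mem hD.isDifferential hu), smul_zero,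
              add_zero]
          rw [LinearMap.sub_apply, hcZ _ _ hy', vanishesOn_wordPairing hD hx.isFlag_sup hΦ _ _ hy',
            sub_self]
      obtain ⟨Ψ, hΨ, e⟩ := ih hc' hcZ'
      refine ⟨Ψ + Φ, add_mem (FreeGCA.sub_mono le_sup_left hΨ) hΦ, ?_⟩
      rw [map_add, ← e, sub_add_cancel]

/-- Take a flag `Z` with `δ(Z) ⊇ V_α`. A letter annihilating `δ(Z)` is then zero in `L_α`, through
which `c` factors. -/
theorem IsAdmissible.exists_eq_wordPairing (hD : IsAcyclicClosure S D)
    {c : Module.Dual ℚ (LieWord 𝒱)} (hc : IsAdmissible S c) : ∃ Φ, c = wordPairing D Φ := by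
  obtain ⟨α, n, hcα⟩ := id hc
  have hfin := α.finite
  obtain ⟨Z, hZ, hαZ⟩ := Extension.exists_isFlag_ge hD
    ((Module.Finite.iff_fg.mp hfin).map (Extension.deltaEquiv hD).symm.toLinearMap)
  obtain ⟨Φ, _, h⟩ := exists_eq_wordPairing_of_vanishesOn hD hZ hc (fun q y hy t => by
    refine hcα _ ?_
    have h0 : α.res y.1 = 0 := by
      rw [← map_zero α.res, α.res_eq_iff]
      intro v hv
      have h' := hy _ (hαZ (Submodule.mem_map_of_mem hv))
      rw [← Extension.deltaEquiv_apply hD] at h'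
      simpa using h'
    rw [_root_.map_mul, α.evalUL_of, h0, map_zero, zero_mul]
    exact zero_mem _)
  exact ⟨Φ, h⟩

end Duality

/-! ### Passage to the limit: `(∧U)^∨` as the limit of the finite dimensional quotients `UL_α /
I_α^n`. -/

section Isomorphism

variable {V : Type u} [AddCommGroup V] [Module ℚ V] {𝒱 : ℕ → Submodule ℚ V}
  {U : Type v} [AddCommGroup U] [Module ℚ U] {𝒰 : ℕ → Submodule ℚ U}
  [DirectSum.Decomposition 𝒱] [DirectSum.Decomposition 𝒰]
  {S : MinimalSullivanAlgebra 𝒱} {D : Extension 𝒱 𝒰 →ₗ[ℚ] Extension 𝒱 𝒰}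

theorem apply_gradedProj {M : Type*} [AddCommGroup M] [Module ℚ M] {f : V →ₗ[ℚ] M} {m : ℕ}
    (hf : ∀ j ≠ m, ∀ v ∈ 𝒱 j, f v = 0) (v : V) : f (gradedProj 𝒱 m v) = f v := by
  obtain ⟨N, hN⟩ := exists_sum_gradedProj (𝒱 := 𝒱) v
  rw [← hN (max N (m + 1)) (le_max_left _ _), map_sum, map_sum, map_sum,
    Finset.sum_eq_single_of_mem m (Finset.mem_range.mpr (by omega)),
    Finset.sum_eq_single_of_mem m (Finset.mem_range.mpr (by omega)),
    gradedProj_of_mem (gradedProj_mem m v)]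
  · exact fun j _ hj => hf j hj _ (gradedProj_mem j v)
  · intro j _ hj
    rw [gradedProj_of_ne (gradedProj_mem j v) hj, map_zero]

namespace MinimalSullivanAlgebra

theorem Index.mem_one_sup_mul (α : S.Index) (a : α.UL) :
    a ∈ (1 ⊔ ⊤ * LinearMap.range α.toUL : Submodule ℚ α.UL) := by
  induction a using α.UL_induction with
  | algebraMap r => exact Submodule.mem_sup_left (Submodule.algebraMap_mem r)
  | toUL z =>
    refine Submodule.mem_sup_right ?_
    rw [← one_mul (α.toUL z)]
    exact Submodule.mul_mem_mul trivial ⟨z, rfl⟩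
  | mul a b ha hb =>
    obtain ⟨c, hc, d, hd, rfl⟩ := Submodule.mem_sup.mp hb
    obtain ⟨r, rfl⟩ := Submodule.mem_one.mp hc
    rw [mul_add, ← Algebra.commutes, ← Algebra.smul_def]
    refine add_mem (Submodule.smul_mem _ r ha) (Submodule.mem_sup_right ?_)
    have h := Submodule.mul_mem_mul (Submodule.mem_top (x := a)) hd
    rw [← mul_assoc] at h
    exact (mul_le_mul' le_top le_rfl : _ ≤ (⊤ : Submodule ℚ α.UL) * _) h
  | add a b ha hb => exact add_mem ha hb

theorem Index.toUL_mem_I (α : S.Index) (z : Module.Dual ℚ α.space) : α.toUL z ∈ α.I :=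
  α.liftUL_toUL _ _ _

/-- Iterating `UL_α = ℚ + UL_α L_α` shows that the finite dimensional space `(ℚ + L_α)^n` maps onto
the quotient. Finiteness makes the quotients reflexive, which surjectivity of `orbit` needs. -/
instance Index.finite_quotient (α : S.Index) (n : ℕ) : Module.Finite ℚ (α.UL ⧸ α.I ^ n) := by
  have := α.finite
  let W : Submodule ℚ α.UL := 1 ⊔ LinearMap.range α.toUL
  have hW : W.FG := by
    refine Submodule.FG.sup ?_ (Module.Finite.iff_fg.mp inferInstance)
    rw [Submodule.one_eq_span]
    exact Submodule.fg_span_singleton 1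
  have key : ∀ n : ℕ, ∀ a : α.UL, ∃ w ∈ W ^ n, a - w ∈ α.I ^ n := by
    intro n
    induction n with
    | zero =>
      intro a
      refine ⟨0, zero_mem _, ?_⟩
      rw [Submodule.pow_zero, Ideal.one_eq_top]
      trivial
    | succ n ih =>
      intro a
      obtain ⟨c, hc, d, hd, rfl⟩ := Submodule.mem_sup.mp (α.mem_one_sup_mul a)
      obtain ⟨e, he, hed⟩ : ∃ w ∈ W ^ (n + 1), d - w ∈ α.I ^ (n + 1) := by
        induction hd using Submodule.mul_induction_on' with
        | mem_mul_mem b _ z hz =>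
          obtain ⟨w, hw, hbw⟩ := ih b
          refine ⟨w * z, ?_, ?_⟩
          · rw [pow_succ]
            exact Submodule.mul_mem_mul hw (Submodule.mem_sup_right hz)
          · obtain ⟨z, rfl⟩ := hz
            rw [← sub_mul, Submodule.pow_succ]
            exact Ideal.mul_mem_mul hbw (α.toUL_mem_I z)
        | add x _ y _ h₁ h₂ =>
          obtain ⟨w, hw, h₁⟩ := h₁
          obtain ⟨w', hw', h₂⟩ := h₂
          refine ⟨w + w', add_mem hw hw', ?_⟩
          rw [add_sub_add_comm]
          exact add_mem h₁ h₂
      refine ⟨c + e, add_mem ?_ he, by rwa [add_sub_add_left_eq_sub]⟩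
      have h1 : (1 : Submodule ℚ α.UL) ≤ W ^ (n + 1) := Submodule.one_le.mpr
        (by
          have h := Submodule.pow_mem_pow W
            (Submodule.mem_sup_left (Submodule.one_le.mp le_rfl) : (1 : α.UL) ∈ W) (n + 1)
          rwa [one_pow] at h)
      exact h1 hc
  have hfin : Module.Finite ℚ ↥(W ^ n) := Module.Finite.iff_fg.mpr (hW.pow n)
  refine Module.Finite.of_surjective
    ((Ideal.Quotient.mkₐ ℚ (α.I ^ n)).toLinearMap ∘ₗ (W ^ n).subtype) ?_
  intro b
  obtain ⟨a, rfl⟩ := Ideal.Quotient.mk_surjective b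
  obtain ⟨w, hw, haw⟩ := key n a
  exact ⟨⟨w, hw⟩, (Ideal.Quotient.eq.mpr haw).symm⟩

/-- The evaluation of words in `UL_α / I_α^n`. -/
def Index.evalQuot (α : S.Index) (n : ℕ) : LieWord 𝒱 →ₗ[ℚ] α.UL ⧸ α.I ^ n :=
  (Ideal.Quotient.mkₐ ℚ (α.I ^ n)).toLinearMap ∘ₗ α.evalUL.toLinearMap

theorem Index.evalQuot_eq_zero (α : S.Index) {n : ℕ} {t : LieWord 𝒱} :
    α.evalQuot n t = 0 ↔ α.evalUL t ∈ α.I ^ n := Ideal.Quotient.eq_zero_iff_mem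

theorem Index.evalQuot_surjective (α : S.Index) (n : ℕ) : Function.Surjective (α.evalQuot n) :=
  Ideal.Quotient.mk_surjective.comp α.evalUL_surjective

theorem Index.transition_evalQuot {α β : S.Index} (h : α.space ≤ β.space) {m n : ℕ} (hmn : m ≤ n)
    (t : LieWord 𝒱) : Index.transition h hmn (β.evalQuot n t) = α.evalQuot m t := by
  rw [Index.evalQuot, Index.evalQuot, LinearMap.comp_apply, LinearMap.comp_apply]
  simp only [AlgHom.toLinearMap_apply]
  rw [← Index.mapUL_evalUL h]
  rfl

theorem Index.isAdmissible_comp_evalQuot (α : S.Index) (n : ℕ)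
    (l : Module.Dual ℚ (α.UL ⧸ α.I ^ n)) : IsAdmissible S (l ∘ₗ α.evalQuot n) :=
  ⟨α, n, fun t ht => by rw [LinearMap.comp_apply, α.evalQuot_eq_zero.mpr ht, map_zero]⟩

theorem Index.grUL_le_map_gr (α : S.Index) (m : ℕ) :
    α.grUL m ≤ (LieWord.gr 𝒱 m).map α.evalUL.toLinearMap := by
  refine Submodule.span_le.mpr fun a ha => ?_
  suffices ∃ t, LieWord.IsMonomial m t ∧ α.evalUL t = a by
    obtain ⟨t, ht, rfl⟩ := this
    exact Submodule.mem_map_of_mem (f := α.evalUL.toLinearMap) (Submodule.subset_span ht)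
  induction ha with
  | one => exact ⟨1, .one, map_one _⟩
  | cons x _ ih =>
    obtain ⟨t, ht, rfl⟩ := ih
    exact ⟨_, .cons x ht, by rw [map_mul, α.evalUL_of]⟩

theorem Index.evalUL_mem_grUL (α : S.Index) {m : ℕ} {t : LieWord 𝒱} (ht : t ∈ LieWord.gr 𝒱 m) :
    α.evalUL t ∈ α.grUL m := by
  induction ht using Submodule.span_induction with
  | mem t ht =>
    refine Submodule.subset_span ?_
    induction ht with
    | one => rw [map_one]; exact .one
    | cons x _ ih => rw [map_mul, α.evalUL_of]; exact .cons x ih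
  | zero => rw [map_zero]; exact zero_mem _
  | add a b _ _ h₁ h₂ => rw [map_add]; exact add_mem h₁ h₂
  | smul r a _ h => rw [map_smul]; exact Submodule.smul_mem _ r h

theorem signUL_signUL (α : S.Index) (a : α.UL) : α.signUL (α.signUL a) = a := by
  obtain ⟨t, rfl⟩ := α.evalUL_surjective a
  rw [← Index.evalUL_sgn_one, ← Index.evalUL_sgn_one, LieWord.sgn_sgn]

theorem signCompletion_involutive : Function.Involutive S.signCompletion := by
  intro a
  ext α n
  obtain ⟨b, hb⟩ := Ideal.Quotient.mk_surjective (a.1 α n)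
  change α.signQuot n (α.signQuot n (a.1 α n)) = a.1 α n
  rw [← hb]
  change Ideal.Quotient.mk _ (α.signUL (α.signUL b)) = _
  rw [signUL_signUL]

theorem signCompletion_mem_iff {m : ℕ} {a : S.completion} :
    S.signCompletion a ∈ S.completionGr m ↔ a ∈ S.completionGr m := by
  have h : ∀ {b : S.completion}, b ∈ S.completionGr m → S.signCompletion b ∈ S.completionGr m :=
    fun {b} hb => by rw [signCompletion_apply hb]; exact Submodule.smul_mem _ _ hb
  refine ⟨fun ha => ?_, h⟩
  have := h ha
  rwa [signCompletion_involutive a] at this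

end MinimalSullivanAlgebra

open MinimalSullivanAlgebra

theorem wordPairing_injective (hD : IsAcyclicClosure S D) : Function.Injective (wordPairing D) :=
  (injective_iff_map_eq_zero _).mpr fun _ h => eq_zero_of_wordPairing_eq_zero hD h

/-- The element of `∧U` representing a linear form on `UL_α / I_α^n`. -/
def representing (hD : IsAcyclicClosure S D) (α : S.Index) (n : ℕ) :
    Module.Dual ℚ (α.UL ⧸ α.I ^ n) →ₗ[ℚ] FreeGCA 𝒰 :=
  (LinearEquiv.ofInjective (wordPairing D) (wordPairing_injective hD)).symm.toLinearMap ∘ₗ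
    LinearMap.codRestrict _ (α.evalQuot n).dualMap fun l => by
      obtain ⟨Φ, h⟩ := (α.isAdmissible_comp_evalQuot n l).exists_eq_wordPairing hD
      exact ⟨Φ, h.symm⟩

theorem wordPairing_representing (hD : IsAcyclicClosure S D) (α : S.Index) (n : ℕ)
    (l : Module.Dual ℚ (α.UL ⧸ α.I ^ n)) :
    wordPairing D (representing hD α n l) = l ∘ₗ α.evalQuot n :=
  congrArg Subtype.val (LinearEquiv.apply_symm_apply
    (LinearEquiv.ofInjective (wordPairing D) (wordPairing_injective hD)) _)

/-- The form attached to `Φ` factors through some `UL_α / I_α^n`, and the element representing it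
can only be `Φ`. So `∧U` is the union of the duals of these quotients. -/
theorem exists_representing (hD : IsAcyclicClosure S D) (Φ : FreeGCA 𝒰) :
    ∃ (α : S.Index) (n : ℕ) (l : Module.Dual ℚ (α.UL ⧸ α.I ^ n)), representing hD α n l = Φ := by
  obtain ⟨α, n, h⟩ := isAdmissible_wordPairing hD Φ
  obtain ⟨sec, hsec⟩ := (α.evalQuot n).exists_rightInverse_of_surjective
    (LinearMap.range_eq_top.mpr (α.evalQuot_surjective n))
  refine ⟨α, n, wordPairing D Φ ∘ₗ sec, wordPairing_injective hD ?_⟩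
  rw [wordPairing_representing]
  ext t
  rw [LinearMap.comp_apply, LinearMap.comp_apply, ← sub_eq_zero, ← map_sub]
  apply h
  rw [← α.evalQuot_eq_zero, map_sub, sub_eq_zero]
  exact LinearMap.congr_fun hsec _

/-- The linear map `b ↦ (Φ ↦ ε_U(b · Φ))`. -/
def orbit (hD : IsAcyclicClosure S D) : S.completion →ₗ[ℚ] Module.Dual ℚ (FreeGCA 𝒰) :=
  (holonomy hD).toLinearMap.compr₂ (FreeGCA.aug 𝒰).toLinearMap

theorem orbit_apply (hD : IsAcyclicClosure S D) (b : S.completion) (Φ : FreeGCA 𝒰) :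
    orbit hD b Φ = FreeGCA.aug 𝒰 (holonomy hD b Φ) := rfl

/-- At a level above both `(α, n)` and the one computing the action, `b` is a word, and for words
this is the defining property of the representing element. -/
theorem orbit_representing (hD : IsAcyclicClosure S D) (b : S.completion) (α : S.Index) (n : ℕ)
    (l : Module.Dual ℚ (α.UL ⧸ α.I ^ n)) : orbit hD b (representing hD α n l) = l (b.1 α n) := by
  obtain ⟨β, k, hβ⟩ := exists_isGood hD (representing hD α n l)
  obtain ⟨t, ht⟩ := (α.sup β).exists_approximates (max n k) b
  rw [orbit_apply, holonomy_apply hD (hβ.mono (α.le_sup_right β) (le_max_right n k)) ht,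
    ← wordPairing_apply, wordPairing_representing, LinearMap.comp_apply]
  exact congrArg l (ht.mono (α.le_sup_left β) (le_max_left n k))

theorem orbit_injective (hD : IsAcyclicClosure S D) : Function.Injective (orbit hD) := by
  refine (injective_iff_map_eq_zero _).mpr fun b hb => ?_
  ext α n
  refine (Module.forall_dual_apply_eq_zero_iff ℚ _).mp fun l => ?_
  rw [← orbit_representing hD, hb, LinearMap.zero_apply]

/-- By reflexivity, a form on `∧U` restricted to the dual of each quotient is evaluation at an
element of that quotient; these elements form a compatible family. -/
theorem orbit_surjective (hD : IsAcyclicClosure S D) : Function.Surjective (orbit hD) := by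
  intro F
  let a : ∀ (α : S.Index) (n : ℕ), α.UL ⧸ α.I ^ n := fun α n =>
    (Module.evalEquiv ℚ (α.UL ⧸ α.I ^ n)).symm (F ∘ₗ representing hD α n)
  have ha : ∀ α n l, l (a α n) = F (representing hD α n l) := fun α n l =>
    Module.apply_evalEquiv_symm_apply ℚ (α.UL ⧸ α.I ^ n) l _
  have hcomp : a ∈ S.completion := by
    intro α β h m n hmn
    rw [← sub_eq_zero]
    refine (Module.forall_dual_apply_eq_zero_iff ℚ _).mp fun l => ?_
    rw [map_sub, sub_eq_zero, ha]
    refine (ha β n (l ∘ₗ (Index.transition h hmn).toLinearMap)).trans (congrArg F ?_)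
    -- Uniqueness of representing elements reduces compatibility to an equality of forms on words.
    apply wordPairing_injective hD
    rw [wordPairing_representing, wordPairing_representing]
    ext t
    exact congrArg l (Index.transition_evalQuot h hmn t)
  refine ⟨⟨a, hcomp⟩, ?_⟩
  ext Φ
  obtain ⟨α, n, l, rfl⟩ := exists_representing hD Φ
  rw [orbit_representing, ← ha]

/-- A word of degree `k` lowers degree by `k`, so after `ε` it pairs only with degree `k` of `∧U`.
The converse direction separates a component of `b` from the degree `m` part by a linear form. -/
theorem orbit_mem_dualGr_iff (hD : IsAcyclicClosure S D) {m : ℕ} {b : S.completion} :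
    orbit hD b ∈ dualGr 𝒰 m ↔ b ∈ S.completionGr m := by
  have hd := hD.isDifferential
  constructor
  · intro h α n
    by_contra hb
    obtain ⟨l, hl, hlm⟩ := Submodule.exists_le_ker_of_notMem hb
    refine hl ?_
    -- Words of degree `m` pair to zero by the choice of `l`, the other words for reasons of degree.
    have hΦ : gradedProj (FreeGCA.gr 𝒰) m (representing hD α n l) = 0 := by
      refine eq_zero_of_wordPairing_eq_zero hD ?_
      ext t
      induction LieWord.mem_iSup_gr t using Submodule.iSup_induction' with
      | zero => rw [map_zero, map_zero]
      | add x y _ _ h₁ h₂ => rw [map_add, map_add, h₁, h₂]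
      | mem k t ht =>
        by_cases hk : k = m
        · subst hk
          have e := apply_gradedProj (𝒱 := FreeGCA.gr 𝒰) (f := (wordPairing D).flip t) (m := k)
            (fun j hj Ψ hΨ => LieWord.aug_act_eq_zero hd hj ht hΨ) (representing hD α n l)
          rw [LinearMap.flip_apply, LinearMap.flip_apply, wordPairing_representing] at e
          rw [e]
          exact hlm (Submodule.mem_map_of_mem
            (f := (Ideal.Quotient.mkₐ ℚ (α.I ^ n)).toLinearMap) (α.evalUL_mem_grUL ht))
        · exact LieWord.aug_act_eq_zero hd (Ne.symm hk) ht (gradedProj_mem m _)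
    rw [← orbit_representing hD, ← apply_gradedProj h, hΦ, map_zero]
  · intro h j hj Φ hΦ
    obtain ⟨α, n, hα⟩ := exists_isGood hD Φ
    obtain ⟨w, hw, hwb⟩ := h α n
    obtain ⟨t, ht, rfl⟩ := α.grUL_le_map_gr m hw
    rw [orbit_apply, holonomy_apply hD hα (t := t) hwb]
    exact LieWord.aug_act_eq_zero hd hj ht hΦ

/-- The isomorphism `a ↦ ε_U · a` of the Sullivan completion onto `(∧U)^∨`. -/
def dualityEquiv (hD : IsAcyclicClosure S D) : S.completion ≃ₗ[ℚ] Module.Dual ℚ (FreeGCA 𝒰) :=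
  (LinearEquiv.ofInvolutive S.signCompletion.toLinearMap signCompletion_involutive).trans
    (LinearEquiv.ofBijective (orbit hD) ⟨orbit_injective hD, orbit_surjective hD⟩)

theorem dualityEquiv_apply (hD : IsAcyclicClosure S D) (a : S.completion) :
    dualityEquiv hD a = orbit hD (S.signCompletion a) := rfl

theorem dualityEquiv_mul (hD : IsAcyclicClosure S D) (a b : S.completion) :
    dualityEquiv hD (a * b) = dualRight (holonomy hD) (MulOpposite.op b) (dualityEquiv hD a) := by
  ext Φ
  rw [dualityEquiv_apply, orbit_apply, map_mul, map_mul, Module.End.mul_apply]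
  rfl

end Isomorphism

end Sullivan

end

theorem mainTheorem11 {V : Type*} [AddCommGroup V] [Module ℚ V] (𝒱 : ℕ → Submodule ℚ V)
    [DirectSum.Decomposition 𝒱] {U : Type*} [AddCommGroup U] [Module ℚ U]
    (𝒰 : ℕ → Submodule ℚ U) [DirectSum.Decomposition 𝒰]
    (S : Sullivan.MinimalSullivanAlgebra 𝒱)
    (D : Sullivan.Extension 𝒱 𝒰 →ₗ[ℚ] Sullivan.Extension 𝒱 𝒰) (hD : Sullivan.IsAcyclicClosure S D) :
    Sullivan.Extension.quotientDifferential D = 0 ∧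
    ∃ ρ : S.completion →ₐ[ℚ] Module.End ℚ (Sullivan.FreeGCA 𝒰),
      Sullivan.IsHolonomy S D ρ ∧
      (∀ ρ' : S.completion →ₐ[ℚ] Module.End ℚ (Sullivan.FreeGCA 𝒰),
        Sullivan.IsHolonomy S D ρ' → ρ' = ρ) ∧
      ∃ e : S.completion ≃ₗ[ℚ] Module.Dual ℚ (Sullivan.FreeGCA 𝒰),
        (∀ a : S.completion,
          e a = Sullivan.MinimalSullivanAlgebra.dualRight ρ (MulOpposite.op a)
            (Sullivan.FreeGCA.aug 𝒰).toLinearMap) ∧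
        (∀ a b : S.completion,
          e (a * b) = Sullivan.MinimalSullivanAlgebra.dualRight ρ (MulOpposite.op b) (e a)) ∧
        (∀ (m : ℕ) (a : S.completion),
          a ∈ S.completionGr m ↔ e a ∈ Sullivan.dualGr 𝒰 m) := by
  refine ⟨Sullivan.Extension.quotientDifferential_eq_zero hD, Sullivan.holonomy hD,
    Sullivan.isHolonomy_holonomy hD, fun ρ' hρ' => hρ'.eq_holonomy hD,
    Sullivan.dualityEquiv hD, fun a => rfl, Sullivan.dualityEquiv_mul hD, fun m a => ?_⟩
  -- The equivalence is `orbit` after the degree involution, which preserves each component of the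
  -- completion.
  rw [Sullivan.dualityEquiv_apply, Sullivan.orbit_mem_dualGr_iff,
    Sullivan.MinimalSullivanAlgebra.signCompletion_mem_iff]
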